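/- Let $F$ be a non-archimedean local field with ring of integers $\mathcal O$, uniformizer $\varpi$ and residue field of cardinality $q$ (any residue characteristic $p$ is allowed unless said otherwise). Let $E/F$ be the unramified quadratic extension, $\mathcal O^E$ its ring of integers and $\sigma$ the non-trivial automorphism of $E/F$. Put $\mathcal O_k=\mathcal O/\varpi^k\mathcal O$ and $\mathcal O^E_k=\mathcal O^E/\varpi^k\mathcal O^E$. Let $r=2l$ be even, $l\ge 1$, let $G=GL(2,\mathcal O_r)$ and $K_l=\{g\in G: g\equiv 1 \bmod \varpi^l\}$, and fix an additive character $\psi$ of $\mathcal O_r$ which is non-trivial on $\varpi^{r-1}\mathcal O_r$. For $\beta\in M_2(\mathcal O_r)$ let $\psi_\beta$ be the character $g\mapsto\psi(\mathrm{tr}(\beta(g-1)))$ of $K_l$. If $\theta$ is a character of $\mathcal O_r[\beta]^\times$ coinciding with $\psi_\beta$ on $\mathcal O_r[\beta]^\times\cap K_l$, let $\theta\psi_\beta$ be the character $xy\mapsto\theta(x)\psi_\beta(y)$ of $\mathcal O_r[\beta]^\times K_l$ and let $\pi(\theta,\beta)=\mathrm{Ind}_{\mathcal O_r[\beta]^\times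 K_l}^{G}(\theta\psi_\beta)$. Write $C(\Delta,s)=\begin{pmatrix}0&1\\-\Delta&s\end{pmatrix}$. A smooth representation of $GL(2,\mathcal O)$ has level $k$ if $k\geq 1$ is minimal such that it factorizes through $GL(2,\mathcal O_k)$; its sublevel is the minimal $k\ge 1$ such that some twist of it by a smooth character of $GL(2,\mathcal O)$ factorizes through $GL(2,\mathcal O_k)$. An irreducible finite-dimensional complex representation of $G$ is strongly primitive if, seen as a representation of $GL(2,\mathcal O)$, it has level and sublevel both equal to $r$. An irreducible representation $\pi$ of $G$ is called - principal split if some $\psi_\beta$ with $\beta=\begin{pmatrix}a&0\\0&d\end{pmatrix}$, $a\not\equiv d \bmod \varpi$, occurs in $\pi|_{K_l}$; - cuspidal if some $\psi_\beta$ with $\beta=C(\Delta,s)$, $X^2-sX+\Delta$ irreducible modulo $\varpi$, occurs in $\pi|_{K_l}$; - non-principal split if some $\psi_\beta$ with $\beta=\begin{pmatrix}a&1+b\\c&d\end{pmatrix}$, $b\equiv c\equiv a-d\equiv 0\bmod\varpi$, occurs in $\pi|_{K_l}$. Then these three families are pairwise disjoint, and the strongly primitive irreducible representations of $G$ are exactly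 the members of the three families; up to isomorphism there are $(q-1)q^{2r-1}$ of them. Moreover: 1. (Principal split.) Call a pair $(\mu,\mu')$ of characters of $\mathcal O_r^\times$ regular if $\mu\mu'^{-1}$ is non-trivial on $1+\varpi^{r-1}\mathcal O_r$. Let $T(C_2)\subset G$ be the group of matrices that are diagonal modulo $\varpi^l$, let $\mu\boxtimes\mu'$ be its character $\begin{pmatrix}s_1&\varpi^l y\\\varpi^l z&s_2\end{pmatrix}\mapsto\mu(s_1)\mu'(s_2)$ and let $\Pi_{\mu,\mu'}=\mathrm{Ind}_{T(C_2)}^{G}(\mu\boxtimes\mu')$. The principal split representations are exactly those isomorphic to $\Pi_{\mu,\mu'}$ for some regular $(\mu,\mu')$. For regular pairs, two such representations are isomorphic if and only if the unordered pairs $\{\mu,\mu'\}$ coincide. They have dimension $(q+1)q^{r-1}$, and there are $\frac12(q-1)^3q^{2r-3}$ isomorphism classes. 2. (Cuspidal.) Call a pair $(\nu,\nu')$ of characters of $(\mathcal O^E_r)^\times$ regular if $\nu\nu'^{-1}$ is non-trivial on $\{1+\varpi^{r-1}z: z\in\mathcal O_r^E,\ \sigma(z)=-z\}$. For $\tau\in\mathcal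 O^E_r$ with $\tau\not\equiv\sigma(\tau)\bmod\varpi$ put $\beta(\tau)=C(\tau\sigma(\tau),\tau+\sigma(\tau))$ and let $\theta_{\nu,\nu'}$ be the character $a+b\beta(\tau)\mapsto\nu(a+b\tau)\nu'(a+b\sigma(\tau))$ of $\mathcal O_r[\beta(\tau)]^\times$. For every regular $(\nu,\nu')$ there is such a $\tau$ for which $\theta_{\nu,\nu'}$ coincides with $\psi_{\beta(\tau)}$ on $\mathcal O_r[\beta(\tau)]^\times\cap K_l$, and the representation $\mathcal C_{\nu,\nu'}=\pi(\theta_{\nu,\nu'},\beta(\tau))$ does not depend on the choice of $\tau$, up to isomorphism. The cuspidal representations are exactly those isomorphic to $\mathcal C_{\nu,\nu'}$ for some regular $(\nu,\nu')$. One has $\mathcal C_{\nu,\nu'}\cong\mathcal C_{\nu'\circ\sigma,\nu\circ\sigma}$. They have dimension $(q-1)q^{r-1}$, and there are $\frac12(q-1)(q^2-1)q^{2r-3}$ isomorphism classes. 3. (Non-principal split.) For every $a\in\mathcal O/\varpi$ fix a character $\tilde\chi_a$ of $\mathcal O_r^\times$ with $\tilde\chi_a(1+\varpi^{r-1}x)=\psi(\varpi^{r-1}ax)$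 for all $x$. The non-principal split representations are exactly those isomorphic to $(\tilde\chi_a\circ\det)\otimes\pi(\theta,C(\Delta,s))$ with $a\in\mathcal O/\varpi$, $\Delta,s\in\varpi\mathcal O_r$ and $\theta$ coinciding with $\psi_{C(\Delta,s)}$ on $\mathcal O_r[C(\Delta,s)]^\times\cap K_l$; here $\Delta$ and $s$ may be replaced by any elements congruent to them modulo $\varpi^l$ (with a suitable $\theta$). If $p\ne 2$, fix instead for every $a\in\mathcal O_l$ a character $\tilde\chi_a$ of $\mathcal O_r^\times$ with $\tilde\chi_a(1+\varpi^{l}x)=\psi(\varpi^{l}ax)$ for all $x$; then the non-principal split representations are exactly those isomorphic to $\Xi_{a,\Delta,\theta}=(\tilde\chi_a\circ\det)\otimes\pi(\theta,C(\Delta,0))$ with $a\in\mathcal O_l$, $\Delta\in\varpi\mathcal O_r$ (which again may be changed modulo $\varpi^l$) and $\theta$ coinciding with $\psi_{C(\Delta,0)}$ on $\mathcal O_r[C(\Delta,0)]^\times\cap K_l$. In all residue characteristics the non-principal split representations have dimension $(q^2-1)q^{r-2}$, and there are $(q-1)q^{2r-2}$ isomorphism classes. -/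

import Mathlib

open scoped ValuativeRel

noncomputable section

namespace GL2Rep

open Matrix CategoryTheory

/-! ### Representations of a group: twists, inductions, isomorphism classes -/

section Groups

variable {G : Type*} [Group G]

/-- The twist `χ ⊗ ρ` of a complex representation by a one-dimensional character. -/
def twist {V : Type*} [AddCommGroup V] [Module ℂ V] (χ : G →* ℂˣ) (ρ : Representation ℂ G V) :
    Representation ℂ G V where
  toFun g := (χ g : ℂ) • ρ g
  map_one' := by simp
  map_mul' g h := by
    ext v
    simp [mul_smul, smul_comm (χ g : ℂ) (χ h : ℂ)]

/-- The one-dimensional representation attached to a character. -/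
def charRep (χ : G →* ℂˣ) : Representation ℂ G ℂ := twist χ (Representation.trivial ℂ G ℂ)

/-- The representation `Ind_H^G χ` induced from a character `χ` of a subgroup `H`. -/
abbrev indChar (H : Subgroup G) (χ : H →* ℂˣ) :
    Representation ℂ G (Representation.IndV H.subtype (charRep χ)) :=
  Representation.ind H.subtype (charRep χ)

/-- Isomorphism of representations. -/
def Equivalent {V W : Type*} [AddCommGroup V] [Module ℂ V] [AddCommGroup W] [Module ℂ W]
    (ρ : Representation ℂ G V) (ρ' : Representation ℂ G W) : Prop :=
  Nonempty (ρ.Equiv ρ')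

/-- The number of isomorphism classes of finite-dimensional complex representations of `G`
having the (isomorphism invariant) property `P`. -/
def numIso (P : FDRep ℂ G → Prop) : ℕ :=
  Set.ncard ((Quotient.mk (isIsomorphicSetoid (FDRep ℂ G))) '' {V | P V})

section Glue

variable (S K : Subgroup G) (f : S →* ℂˣ) (k : K →* ℂˣ)

theorem glue_wd (hagree : ∀ g (hS : g ∈ S) (hK : g ∈ K), f ⟨g, hS⟩ = k ⟨g, hK⟩)
    (s s' : S) (x x' : K) (h : (s : G) * x = s' * x') : f s * k x = f s' * k x' := by
  have h1 : (s' : G)⁻¹ * s = x' * (x : G)⁻¹ := by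
    rw [inv_mul_eq_iff_eq_mul, ← mul_assoc, ← h]; group
  have hS : (s' : G)⁻¹ * s ∈ S := S.mul_mem (S.inv_mem s'.2) s.2
  have hK : (s' : G)⁻¹ * s ∈ K := h1 ▸ K.mul_mem x'.2 (K.inv_mem x.2)
  have e := hagree _ hS hK
  have e1 : (⟨(s' : G)⁻¹ * s, hS⟩ : S) = s'⁻¹ * s := rfl
  have e2 : (⟨(s' : G)⁻¹ * s, hK⟩ : K) = x' * x⁻¹ := Subtype.ext h1
  rw [e1, e2, map_mul, map_mul, map_inv, map_inv] at e
  have := congrArg (fun t => f s' * t * k x) e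
  simpa [mul_assoc, mul_comm, mul_left_comm] using this

/-- If `K` is normal, `f` and `k` are characters of `S` and `K` which agree on `S ∩ K`, and `k` is
invariant under conjugation by `S`, then `s x ↦ f s * k x` is a character of `S K`. -/
def glue [K.Normal] (hagree : ∀ g (hS : g ∈ S) (hK : g ∈ K), f ⟨g, hS⟩ = k ⟨g, hK⟩)
    (hinv : ∀ (s : S) (x y : K), (s : G) * y = x * s → k x = k y) :
    (S ⊔ K : Subgroup G) →* ℂˣ :=
  have key : ∀ g : (S ⊔ K : Subgroup G), ∃ p : S × K, (p.1 : G) * p.2 = g := fun g => by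
    obtain ⟨s, hs, x, hx, h⟩ := Subgroup.mem_sup_of_normal_right.1 g.2
    exact ⟨(⟨s, hs⟩, ⟨x, hx⟩), h⟩
  MonoidHom.mk' (fun g => f (key g).choose.1 * k (key g).choose.2) (fun a b => by
    have ha := (key a).choose_spec
    have hb := (key b).choose_spec
    have hab := (key (a * b)).choose_spec
    generalize (key a).choose = p at *
    generalize (key b).choose = p' at *
    generalize (key (a * b)).choose = p'' at *
    have hy : (p'.1 : G)⁻¹ * p.2 * p'.1 ∈ K := by
      simpa using Subgroup.Normal.conj_mem ‹K.Normal› (p.2 : G) p.2.2 (p'.1 : G)⁻¹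
    have h1 := hinv p'.1 p.2 ⟨_, hy⟩ (by simp [mul_assoc])
    have h2 := glue_wd S K f k hagree p''.1 (p.1 * p'.1) p''.2 (⟨_, hy⟩ * p'.2) (by
      rw [hab]
      simp only [Subgroup.coe_mul, ← ha, ← hb]
      group)
    rw [h2, map_mul, map_mul, ← h1]
    simp [mul_assoc, mul_comm, mul_left_comm])

theorem glue_apply [K.Normal] (hagree : ∀ g (hS : g ∈ S) (hK : g ∈ K), f ⟨g, hS⟩ = k ⟨g, hK⟩)
    (hinv : ∀ (s : S) (x y : K), (s : G) * y = x * s → k x = k y)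
    (g : (S ⊔ K : Subgroup G)) (s : S) (x : K) (h : (s : G) * x = g) :
    glue S K f k hagree hinv g = f s * k x := by
  have key : ∃ p : S × K, (p.1 : G) * p.2 = g := ⟨(s, x), h⟩
  exact glue_wd S K f k hagree _ _ _ _ (key.choose_spec.trans h.symm)

end Glue

end Groups

/-! ### Subgroups and characters of `GL₂(R)` for a commutative ring `R` -/

section Ring

variable {R : Type*} [CommRing R]

/-- The principal congruence subgroup `{g ∈ GL₂(R) : g ≡ 1 mod I}`. -/
def congr (I : Ideal R) : Subgroup (GL (Fin 2) R) :=
  (GeneralLinearGroup.map (Ideal.Quotient.mk I)).ker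

instance (I : Ideal R) : (congr I).Normal := by unfold congr; infer_instance

theorem mem_congr {I : Ideal R} {g : GL (Fin 2) R} :
    g ∈ congr I ↔ ∀ i j, ((g : Matrix (Fin 2) (Fin 2) R) - 1) i j ∈ I := by
  rw [congr, MonoidHom.mem_ker, Units.ext_iff, ← Matrix.ext_iff]
  refine forall_congr' fun i => forall_congr' fun j => ?_
  rw [← Ideal.Quotient.eq_zero_iff_mem, Matrix.sub_apply, map_sub, sub_eq_zero]
  by_cases h : i = j <;> simp [Matrix.one_apply, h]

/-- The function `g ↦ ψ(tr(β (g - 1)))`. -/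
def psiFun (ψ : AddChar R ℂ) (β : Matrix (Fin 2) (Fin 2) R) (g : GL (Fin 2) R) : ℂ :=
  ψ (trace (β * ((g : Matrix (Fin 2) (Fin 2) R) - 1)))

theorem psiFun_mul {I : Ideal R} (hI : I * I = ⊥) (ψ : AddChar R ℂ)
    (β : Matrix (Fin 2) (Fin 2) R) (g h : GL (Fin 2) R) (hg : g ∈ congr I) (hh : h ∈ congr I) :
    psiFun ψ β (g * h) = psiFun ψ β g * psiFun ψ β h := by
  have h0 : ((g : Matrix (Fin 2) (Fin 2) R) - 1) * ((h : Matrix (Fin 2) (Fin 2) R) - 1) = 0 := by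
    ext i j
    rw [Matrix.mul_apply, Matrix.zero_apply]
    refine Finset.sum_eq_zero fun m _ => ?_
    have := Ideal.mul_mem_mul (mem_congr.1 hg i m) (mem_congr.1 hh m j)
    rwa [hI, Ideal.mem_bot] at this
  have h1 : ((g * h : GL (Fin 2) R) : Matrix (Fin 2) (Fin 2) R) - 1 =
      ((g : Matrix (Fin 2) (Fin 2) R) - 1) + ((h : Matrix (Fin 2) (Fin 2) R) - 1) := by
    rw [← sub_eq_zero, ← h0, Units.val_mul]
    noncomm_ring
  rw [psiFun, h1, mul_add, trace_add, AddChar.map_add_eq_mul]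
  rfl

/-- If `I² = 0`: the character `ψ_β(g) = ψ(tr(β (g - 1)))` of the congruence subgroup of `I`. -/
def psiHom {I : Ideal R} (hI : I * I = ⊥) (ψ : AddChar R ℂ) (β : Matrix (Fin 2) (Fin 2) R) :
    congr I →* ℂˣ :=
  MonoidHom.toHomUnits
    { toFun := fun g => psiFun ψ β g
      map_one' := by simp [psiFun]
      map_mul' := fun g h => psiFun_mul hI ψ β g h g.2 h.2 }

/-- The group `R[β]ˣ`, as a subgroup of `GL₂(R)`. -/
def unitsAdjoin (β : Matrix (Fin 2) (Fin 2) R) : Subgroup (GL (Fin 2) R) :=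
  (Algebra.adjoin R {β}).toSubmonoid.units

theorem coe_mem_adjoin {β : Matrix (Fin 2) (Fin 2) R} {g : GL (Fin 2) R} (hg : g ∈ unitsAdjoin β) :
    (g : Matrix (Fin 2) (Fin 2) R) ∈ Algebra.adjoin R {β} :=
  (Submonoid.mem_units_iff _ _).1 hg |>.1

theorem commute_of_mem {β : Matrix (Fin 2) (Fin 2) R} {g : GL (Fin 2) R}
    (hg : g ∈ unitsAdjoin β) : Commute β (g : Matrix (Fin 2) (Fin 2) R) := by
  refine Algebra.adjoin_induction (p := fun x _ => Commute β x) ?_ ?_ ?_ ?_ (coe_mem_adjoin hg)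
  · intro x hx
    rw [Set.mem_singleton_iff.1 hx]
  · intro a
    exact (Algebra.commutes a β).symm
  · intro x y _ _ hx hy
    exact hx.add_right hy
  · intro x y _ _ hx hy
    exact hx.mul_right hy

/-- `θ` and `ψ_β` coincide on `R[β]ˣ ∩ {g ≡ 1 mod I}`. -/
def Agrees {I : Ideal R} (hI : I * I = ⊥) (ψ : AddChar R ℂ) (β : Matrix (Fin 2) (Fin 2) R)
    (θ : unitsAdjoin β →* ℂˣ) : Prop :=
  ∀ g (hS : g ∈ unitsAdjoin β) (hK : g ∈ congr I), θ ⟨g, hS⟩ = psiHom hI ψ β ⟨g, hK⟩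

/-- The character `θψ_β` of `R[β]ˣ {g ≡ 1 mod I}`, `(θψ_β)(x y) = θ(x) ψ_β(y)`. -/
def thetaPsi {I : Ideal R} (hI : I * I = ⊥) (ψ : AddChar R ℂ) (β : Matrix (Fin 2) (Fin 2) R)
    (θ : unitsAdjoin β →* ℂˣ) (hθ : Agrees hI ψ β θ) :
    (unitsAdjoin β ⊔ congr I : Subgroup (GL (Fin 2) R)) →* ℂˣ :=
  glue _ _ θ (psiHom hI ψ β) hθ (by
    intro s x y hxy
    apply Units.ext
    change psiFun ψ β (x : GL (Fin 2) R) = psiFun ψ β (y : GL (Fin 2) R)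
    have h1 : (x : GL (Fin 2) R) = s * y * (s : GL (Fin 2) R)⁻¹ := by
      rw [hxy]; group
    have hc := commute_of_mem s.2
    rw [psiFun, psiFun, h1]
    congr 1
    have h2 : (((s : GL (Fin 2) R) * y * (s : GL (Fin 2) R)⁻¹ : GL (Fin 2) R) :
        Matrix (Fin 2) (Fin 2) R) - 1 =
        ((s : GL (Fin 2) R) : Matrix (Fin 2) (Fin 2) R) *
          (((y : GL (Fin 2) R) : Matrix (Fin 2) (Fin 2) R) - 1) *
          (((s : GL (Fin 2) R)⁻¹ : GL (Fin 2) R) : Matrix (Fin 2) (Fin 2) R) := by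
      rw [mul_sub, sub_mul, mul_one, Units.mul_inv, Units.val_mul, Units.val_mul]
    rw [h2, ← mul_assoc, ← mul_assoc, hc.eq, trace_mul_comm, mul_assoc, ← mul_assoc,
      Units.inv_mul, one_mul])

/-- `π(θ, β) = Ind (θψ_β)`, induced to `GL₂(R)` from `R[β]ˣ {g ≡ 1 mod I}`. -/
abbrev piRep {I : Ideal R} (hI : I * I = ⊥) (ψ : AddChar R ℂ) (β : Matrix (Fin 2) (Fin 2) R)
    (θ : unitsAdjoin β →* ℂˣ) (hθ : Agrees hI ψ β θ) :=
  indChar (unitsAdjoin β ⊔ congr I) (thetaPsi hI ψ β θ hθ)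

/-- The character `ψ_β` occurs in the restriction of `ρ` to `{g ≡ 1 mod I}`. -/
def Occurs (I : Ideal R) (ψ : AddChar R ℂ) (β : Matrix (Fin 2) (Fin 2) R)
    {V : Type*} [AddCommGroup V] [Module ℂ V] (ρ : Representation ℂ (GL (Fin 2) R) V) : Prop :=
  ∃ v : V, v ≠ 0 ∧ ∀ g ∈ congr I, ρ g v = psiFun ψ β g • v

/-- The group of matrices in `GL₂(R)` which are diagonal modulo `I`. -/
def diagMod (I : Ideal R) : Subgroup (GL (Fin 2) R) where
  carrier := {g | g.1 0 1 ∈ I ∧ g.1 1 0 ∈ I}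
  one_mem' := by simp
  mul_mem' := by
    rintro g h ⟨g1, g2⟩ ⟨h1, h2⟩
    simp only [Set.mem_ofPred_eq, Units.val_mul, Matrix.mul_apply, Fin.sum_univ_two]
    exact ⟨I.add_mem (I.mul_mem_left _ h1) (I.mul_mem_right _ g1),
      I.add_mem (I.mul_mem_right _ g2) (I.mul_mem_left _ h2)⟩
  inv_mem' := by
    rintro g ⟨g1, g2⟩
    have e : ((g⁻¹ : GL (Fin 2) R) : Matrix (Fin 2) (Fin 2) R) = _ := Matrix.coe_units_inv g
    rw [Matrix.inv_def, Matrix.adjugate_fin_two] at e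
    change ((g⁻¹ : GL (Fin 2) R) : Matrix (Fin 2) (Fin 2) R) 0 1 ∈ I ∧
      ((g⁻¹ : GL (Fin 2) R) : Matrix (Fin 2) (Fin 2) R) 1 0 ∈ I
    rw [e]
    exact ⟨I.mul_mem_left _ (by simpa using g1), I.mul_mem_left _ (by simpa using g2)⟩

/-- If `I² = 0`, a diagonal entry is multiplicative on the matrices that are diagonal mod `I`. -/
def diagEntry {I : Ideal R} (hI : I * I = ⊥) (i : Fin 2) : diagMod I →* Rˣ :=
  MonoidHom.toHomUnits
    { toFun := fun g => g.1.1 i i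
      map_one' := by simp
      map_mul' := by
        rintro ⟨g, g1, g2⟩ ⟨h, h1, h2⟩
        have e1 : g.1 0 1 * h.1 1 0 = 0 := by
          have := Ideal.mul_mem_mul g1 h2
          rwa [hI, Ideal.mem_bot] at this
        have e2 : g.1 1 0 * h.1 0 1 = 0 := by
          have := Ideal.mul_mem_mul g2 h1
          rwa [hI, Ideal.mem_bot] at this
        fin_cases i <;> simp [Matrix.mul_apply, Fin.sum_univ_two, e1, e2] }

/-- The character `μ ⊠ μ'` : `(s₁ y; z s₂) ↦ μ(s₁) μ'(s₂)` of the matrices diagonal mod `I`. -/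
def boxChar {I : Ideal R} (hI : I * I = ⊥) (μ μ' : Rˣ →* ℂˣ) : diagMod I →* ℂˣ :=
  μ.comp (diagEntry hI 0) * μ'.comp (diagEntry hI 1)

/-- `Π_{μ,μ'} = Ind (μ ⊠ μ')`. -/
abbrev principalRep {I : Ideal R} (hI : I * I = ⊥) (μ μ' : Rˣ →* ℂˣ) :=
  indChar (diagMod I) (boxChar hI μ μ')

/-- The matrix `(0 1; -Δ s)`, of determinant `Δ` and trace `s`. -/
def companion (Δ s : R) : Matrix (Fin 2) (Fin 2) R := !![0, 1; -Δ, s]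

section Quadratic

variable {RE : Type*} [CommRing RE] (ι : R →+* RE) (σ : RE →+* RE)

theorem eigen_of_mem {τ : RE} {n t : R} (ht : ι t = τ + σ τ) (hn : ι n = τ * σ τ)
    {M : Matrix (Fin 2) (Fin 2) R} (hM : M ∈ Algebra.adjoin R {companion n t}) :
    ι (M 1 0) + ι (M 1 1) * τ = (ι (M 0 0) + ι (M 0 1) * τ) * τ := by
  refine Algebra.adjoin_induction (p := fun M _ =>
    ι (M 1 0) + ι (M 1 1) * τ = (ι (M 0 0) + ι (M 0 1) * τ) * τ) ?_ ?_ ?_ ?_ hM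
  · intro x hx
    rw [Set.mem_singleton_iff.1 hx]
    simp [companion, ht, hn]
    ring
  · intro a
    simp [Matrix.algebraMap_matrix_apply]
  · intro x y _ _ hx hy
    simp only [Matrix.add_apply, map_add]
    linear_combination hx + hy
  · intro x y _ _ hx hy
    simp only [Matrix.mul_apply, Fin.sum_univ_two, map_add, map_mul]
    linear_combination (ι (x 1 1) - ι (x 0 1) * τ) * hy + (ι (y 0 0) + ι (y 0 1) * τ) * hx

/-- For `β = (0 1; -N(τ) Tr(τ))`, the character `a + bβ ↦ a + bτ` of `R[β]ˣ`; note that `a` and `b`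
are the entries of the first row of `a + bβ`. -/
def quadHom {τ : RE} {n t : R} (ht : ι t = τ + σ τ) (hn : ι n = τ * σ τ) :
    unitsAdjoin (companion n t) →* REˣ :=
  MonoidHom.toHomUnits
    { toFun := fun g => ι (g.1.1 0 0) + ι (g.1.1 0 1) * τ
      map_one' := by simp
      map_mul' := by
        rintro ⟨g, hg⟩ ⟨h, hh⟩
        have e := eigen_of_mem ι σ ht hn (coe_mem_adjoin hh)
        simp only [Subgroup.coe_mul, Units.val_mul, Matrix.mul_apply, Fin.sum_univ_two, map_add,
          map_mul]
        linear_combination (ι (g.1 0 1)) * e }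

/-- The character `θ_{ν,ν'}(a + bβ) = ν(a + bτ) ν'(a + bσ(τ))` of `R[β]ˣ`. -/
def quadChar {τ : RE} {n t : R} (ht : ι t = τ + σ τ) (hn : ι n = τ * σ τ) (ν ν' : REˣ →* ℂˣ) :
    unitsAdjoin (companion n t) →* ℂˣ :=
  ν.comp (quadHom ι σ ht hn) *
    ν'.comp ((Units.map (σ : RE →* RE)).comp (quadHom ι σ ht hn))

end Quadratic

end Ring

/-! ### The rings `A / ϖ^r`, level and sublevel -/

section Trunc

variable {A : Type*} [CommRing A]

/-- `A_r = A / ϖ^r A`. -/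
abbrev Trunc (ϖ : A) (r : ℕ) : Type _ := A ⧸ Ideal.span {ϖ ^ r}

/-- The ideal `ϖ^i A_r` of `A_r`. -/
def lvl (ϖ : A) (r i : ℕ) : Ideal (Trunc ϖ r) :=
  Ideal.span {Ideal.Quotient.mk (Ideal.span {ϖ ^ r}) ϖ ^ i}

theorem lvl_sq (ϖ : A) {r l : ℕ} (hr : r = 2 * l) : lvl ϖ r l * lvl ϖ r l = ⊥ := by
  rw [lvl, Ideal.span_singleton_mul_span_singleton, ← pow_add, ← two_mul, ← hr, ← map_pow,
    Ideal.span_singleton_eq_bot, Ideal.Quotient.eq_zero_iff_mem]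
  exact Ideal.mem_span_singleton_self _

/-- The projection `GL₂(A) → GL₂(A_k)`. -/
def proj (ϖ : A) (k : ℕ) : GL (Fin 2) A →* GL (Fin 2) (Trunc ϖ k) :=
  GeneralLinearGroup.map (Ideal.Quotient.mk (Ideal.span {ϖ ^ k}))

variable {V : Type*} [AddCommGroup V] [Module ℂ V]

/-- `ρ` factorizes through `GL₂(A) → GL₂(A_k)`. -/
def Factors (ϖ : A) (k : ℕ) (ρ : Representation ℂ (GL (Fin 2) A) V) : Prop :=
  ∃ ρ' : Representation ℂ (GL (Fin 2) (Trunc ϖ k)) V, ρ = ρ'.comp (proj ϖ k)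

/-- A character of `GL₂(A)` is smooth if it is trivial on a congruence subgroup. -/
def SmoothChar (ϖ : A) (χ : GL (Fin 2) A →* ℂˣ) : Prop :=
  ∃ m : ℕ, ∀ g ∈ (proj ϖ m).ker, χ g = 1

/-- The level: the smallest `k ≥ 1` such that `ρ` factorizes through `GL₂(A_k)`. -/
def level (ϖ : A) (ρ : Representation ℂ (GL (Fin 2) A) V) : ℕ :=
  sInf {k | 0 < k ∧ Factors ϖ k ρ}

/-- The sublevel: the smallest `k ≥ 1` such that some twist of `ρ` by a smooth character
factorizes through `GL₂(A_k)`. -/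
def sublevel (ϖ : A) (ρ : Representation ℂ (GL (Fin 2) A) V) : ℕ :=
  sInf {k | 0 < k ∧ ∃ χ : GL (Fin 2) A →* ℂˣ, SmoothChar ϖ χ ∧ Factors ϖ k (twist χ ρ)}

/-- An irreducible representation of `GL₂(A_r)` which, as a representation of `GL₂(A)`, has level
and sublevel `r`. -/
def StronglyPrimitive (ϖ : A) (r : ℕ) (V : FDRep ℂ (GL (Fin 2) (Trunc ϖ r))) : Prop :=
  Representation.IsIrreducible V.ρ ∧
    level ϖ (MonoidHom.comp V.ρ (proj ϖ r)) = r ∧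
    sublevel ϖ (MonoidHom.comp V.ρ (proj ϖ r)) = r

end Trunc

/-! ### The families of representations -/

section Families

variable {A : Type*} [CommRing A] (ϖ : A) {r : ℕ} (l : ℕ) (ψ : AddChar (Trunc ϖ r) ℂ)
  (V : FDRep ℂ (GL (Fin 2) (Trunc ϖ r)))

/-- Principal split: irreducible, with an orbit of type `(a 0; 0 d)`, `a ≠ d` modulo `ϖ`. -/
def IsPrincipalSplit : Prop :=
  Representation.IsIrreducible V.ρ ∧ ∃ a d : Trunc ϖ r, a - d ∉ lvl ϖ r 1 ∧
    Occurs (lvl ϖ r l) ψ !![a, 0; 0, d] V.ρ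

/-- Cuspidal: irreducible, with an orbit of type `(0 1; -Δ s)`, where `X² - sX + Δ` is irreducible
modulo `ϖ`. -/
def IsCuspidal : Prop :=
  Representation.IsIrreducible V.ρ ∧ ∃ Δ s : Trunc ϖ r,
    Irreducible (Polynomial.X ^ 2
      - Polynomial.C (Ideal.Quotient.mk (lvl ϖ r 1) s) * Polynomial.X
      + Polynomial.C (Ideal.Quotient.mk (lvl ϖ r 1) Δ)) ∧
    Occurs (lvl ϖ r l) ψ (companion Δ s) V.ρ

/-- Non-principal split: irreducible, with an orbit of type `(a 1+b; c d)`, where `b`, `c`, `a - d`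
are `0` modulo `ϖ`. -/
def IsNonPrincipalSplit : Prop :=
  Representation.IsIrreducible V.ρ ∧ ∃ a b c d : Trunc ϖ r,
    b ∈ lvl ϖ r 1 ∧ c ∈ lvl ϖ r 1 ∧ a - d ∈ lvl ϖ r 1 ∧
    Occurs (lvl ϖ r l) ψ !![a, 1 + b; c, d] V.ρ

/-- `(μ, μ')` is regular: `μ μ'⁻¹` is non-trivial on `1 + ϖ^(r-1) A_r`, that is, its restriction to
`1 + ϖ^l A_r`, `r = 2 l`, has level `l`. -/
def RegularPair {ϖ : A} (μ μ' : (Trunc ϖ r)ˣ →* ℂˣ) : Prop :=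
  ∃ u : (Trunc ϖ r)ˣ, (u : Trunc ϖ r) - 1 ∈ lvl ϖ r (r - 1) ∧ (μ * μ'⁻¹) u ≠ 1

/-- `χ` assigns to each `a ∈ A / ϖ^j` a character of `A_rˣ` which on `1 + ϖ^(r-j) A_r` is
`1 + ϖ^(r-j) x ↦ ψ(ϖ^(r-j) a x)`. -/
def IsTwistFamily {ϖ : A} (ψ : AddChar (Trunc ϖ r) ℂ) (j : ℕ)
    (χ : Trunc ϖ r ⧸ lvl ϖ r j → ((Trunc ϖ r)ˣ →* ℂˣ)) : Prop :=
  ∀ (a x : Trunc ϖ r) (u : (Trunc ϖ r)ˣ),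
    (u : Trunc ϖ r) = 1 + Ideal.Quotient.mk (Ideal.span {ϖ ^ r}) ϖ ^ (r - j) * x →
    (χ (Ideal.Quotient.mk (lvl ϖ r j) a) u : ℂ) =
      ψ (Ideal.Quotient.mk (Ideal.span {ϖ ^ r}) ϖ ^ (r - j) * (a * x))

variable {B : Type*} [CommRing B] [Algebra A B] (σ : B ≃ₐ[A] B)

/-- The map `A_r → B_r` induced by `A → B`. -/
def truncMap (B : Type*) [CommRing B] [Algebra A B] (ϖ : A) (r : ℕ) :
    Trunc ϖ r →+* Trunc (algebraMap A B ϖ) r :=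
  Ideal.quotientMap _ (algebraMap A B) (by
    rw [Ideal.span_singleton_le_iff_mem, Ideal.mem_comap, map_pow]
    exact Ideal.mem_span_singleton_self _)

/-- The map `B_r → B_r` induced by an automorphism of the `A`-algebra `B`. -/
def truncAut (ϖ : A) (r : ℕ) (σ : B ≃ₐ[A] B) :
    Trunc (algebraMap A B ϖ) r →+* Trunc (algebraMap A B ϖ) r :=
  Ideal.quotientMap _ (σ : B →+* B) (by
    rw [Ideal.span_singleton_le_iff_mem, Ideal.mem_comap, map_pow]
    simp)

/-- `(ν, ν')` is regular: `ν ν'⁻¹` is non-trivial on `{1 + ϖ^(r-1) z : σ(z) = -z}`, that is, its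
restriction to `{1 + ϖ^l z : σ(z) = -z}`, `r = 2 l`, has level `l`. -/
def RegularPairE (ν ν' : (Trunc (algebraMap A B ϖ) r)ˣ →* ℂˣ) : Prop :=
  ∃ (z : Trunc (algebraMap A B ϖ) r) (u : (Trunc (algebraMap A B ϖ) r)ˣ),
    truncAut ϖ r σ z = -z ∧
    (u : Trunc (algebraMap A B ϖ) r) = 1 + Ideal.Quotient.mk _ (algebraMap A B ϖ) ^ (r - 1) * z ∧
    (ν * ν'⁻¹) u ≠ 1

/-- An element `τ` of `B_r` with `τ ≠ σ(τ)` modulo `ϖ`, together with its trace `t = τ + σ(τ)` and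
norm `n = τ σ(τ)` in `A_r`. -/
structure EllipticElt (ϖ : A) (r : ℕ) (σ : B ≃ₐ[A] B) where
  τ : Trunc (algebraMap A B ϖ) r
  t : Trunc ϖ r
  n : Trunc ϖ r
  trace_eq : truncMap B ϖ r t = τ + truncAut ϖ r σ τ
  norm_eq : truncMap B ϖ r n = τ * truncAut ϖ r σ τ
  elliptic : τ - truncAut ϖ r σ τ ∉ lvl (algebraMap A B ϖ) r 1

variable {ϖ σ}

/-- The matrix `β(τ) = (0 1; -N(τ) Tr(τ))`. -/
abbrev EllipticElt.β (x : EllipticElt ϖ r σ) : Matrix (Fin 2) (Fin 2) (Trunc ϖ r) :=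
  companion x.n x.t

/-- The character `θ_{ν,ν'}(a + bβ(τ)) = ν(a + bτ) ν'(a + bσ(τ))` of `A_r[β(τ)]ˣ`. -/
def EllipticElt.θ (x : EllipticElt ϖ r σ) (ν ν' : (Trunc (algebraMap A B ϖ) r)ˣ →* ℂˣ) :
    unitsAdjoin x.β →* ℂˣ :=
  quadChar (truncMap B ϖ r) (truncAut ϖ r σ) x.trace_eq x.norm_eq ν ν'

variable {l}

/-- `ρ` is (isomorphic to) `𝒞_{ν,ν'} = π(θ_{ν,ν'}, β(τ))`, where `τ` belongs to `(ν, ν')`, which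
means that `θ_{ν,ν'}` coincides with `ψ_{β(τ)}` on `A_r[β(τ)]ˣ ∩ {g ≡ 1 mod ϖ^l}`. -/
def IsCuspidalRep {W : Type*} [AddCommGroup W] [Module ℂ W] (hr : r = 2 * l)
    (ψ : AddChar (Trunc ϖ r) ℂ) (σ : B ≃ₐ[A] B)
    (ν ν' : (Trunc (algebraMap A B ϖ) r)ˣ →* ℂˣ)
    (ρ : Representation ℂ (GL (Fin 2) (Trunc ϖ r)) W) : Prop :=
  ∃ (x : EllipticElt ϖ r σ) (hx : Agrees (lvl_sq ϖ hr) ψ x.β (x.θ ν ν')),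
    Equivalent ρ (piRep (lvl_sq ϖ hr) ψ x.β (x.θ ν ν') hx)

/-- The representation `(χ ∘ det) ⊗ π(θ, β)`, `β = (0 1; -Δ s)`. With `s = 0` and `χ = χ_a`, this is
`Ξ_{a,Δ,θ}`. -/
abbrev xiRep (hr : r = 2 * l) (ψ : AddChar (Trunc ϖ r) ℂ) (χ : (Trunc ϖ r)ˣ →* ℂˣ)
    (Δ s : Trunc ϖ r) (θ : unitsAdjoin (companion Δ s) →* ℂˣ)
    (hθ : Agrees (lvl_sq ϖ hr) ψ (companion Δ s) θ) :=
  twist (χ.comp GeneralLinearGroup.det) (piRep (lvl_sq ϖ hr) ψ (companion Δ s) θ hθ)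

end Families

end GL2Rep

end

/-!
The classification is Clifford theory for the commutative normal subgroup `K_l` of `G = GL₂(𝒪_r)`.
Since `r = 2 l`, the group `K_l` is isomorphic to the additive group `M₂(𝒪_l)`, and its characters
are the `ψ_β`, with `β` modulo `ϖ^l` (`IsChain.psiFun_eq_iff`, `IsChain.exists_psiFun_eq`); `G` acts
on them by conjugation of `β`. The characters which occur in an irreducible representation form one
orbit (`isConj_of_mem_eig`), so that `det β` and `tr β` modulo `ϖ^l` are invariants of the
representation.

Twisting by a character of `det` shifts `β` by a scalar, and the sublevel drops exactly if `K_{r-1}`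
acts by scalars. Hence a representation is strongly primitive if and only if its `β` are not scalar
modulo `ϖ` (`IsSetup.stronglyPrimitive_iff`). Such a `β` has a cyclic vector, so it is conjugate to
the companion matrix `C(det β, tr β)`, and the three families correspond to the three ways in which
`X² - (tr β) X + det β` can decompose over the residue field: distinct roots, no root, a double root
(`IsSetup.exists_nonscalar_iff`).

For a companion matrix `β` the stabilizer of `ψ_β` is `𝒪_r[β]ˣ K_l`. As `𝒪_r[β]ˣ` is commutative,
its elements have a common eigenvector in the `ψ_β`-eigenspace of a representation, so every
irreducible representation containing `ψ_β` is a quotient of some `Ind (θψ_β)`. Irreducibility of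
the induced representation is a dimension count: any representation containing `ψ_β` contains its
conjugates, in number the index of the stabilizer, and an induced character has just this dimension
(`isIrreducible_indChar`). The same count shows that the `ψ_β`-eigenspace is a line, whence `θ` is
determined by the representation (`extension_unique`). The number of isomorphism classes is therefore
the number of pairs `(Δ, s)` modulo `ϖ^l` of the given type, times the number of `θ` extending the
restriction of `ψ_β`, which is an index of groups (`IsSetup.numIso_occursType`). Indices and numbers
of pairs come down to counting over the residue field.

The explicit descriptions are translations of this. In the split case Hensel's lemma makes `β`
diagonal, with stabilizer the matrices diagonal modulo `ϖ^l`. In the cuspidal case the residue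
field extension contains a root of the reduction, which lifts to `τ`; then `𝒪_r[β]` is identified
with `𝒪^E_r`, and non-degeneracy of the trace form yields `τ` modulo `ϖ^l` from the character
`z ↦ ν(z) ν'(σ(z))`. Replacing `τ` by a congruent element conjugates `β(τ)` to an element of
`𝒪_r[β(τ)]` congruent to it (`IsSetup.equivalent_of_hasShiftE`). In the non-principal split case a
twist moves the double root to `0`; if `2` is a unit, it can even make the trace vanish.

For the ring theory only finite chain rings and their unramified quadratic extensions are needed.
That `σ` moves some element modulo `ϖ` is proved by descent: otherwise each element of `𝒪^E` would
be congruent to one of `𝒪`, and `b - σ(b)` would be divisible by all powers of `ϖ`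
(`IsUnramifiedQuad.exists_not_dvd`).
-/

open scoped ValuativeRel

noncomputable section

namespace GL2Rep

open Matrix CategoryTheory

/-! ### Eigenvectors of subgroups and induced representations -/

section Clifford

variable {G : Type*} [Group G] {V : Type*} [AddCommGroup V] [Module ℂ V]

/-- The simultaneous eigenspace of a subgroup `N` with system of eigenvalues `f`. Only the values
of `f` on `N` matter; `f` is defined on all of `G` so that conjugation is easy to express. -/
def eig (ρ : Representation ℂ G V) (N : Subgroup G) (f : G → ℂ) : Submodule ℂ V where
  carrier := {v | ∀ g ∈ N, ρ g v = f g • v}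
  add_mem' := fun ha hb g hg => by rw [map_add, ha g hg, hb g hg, smul_add]
  zero_mem' := fun g _ => by simp
  smul_mem' := fun c v hv g hg => by rw [map_smul, hv g hg, smul_comm]

theorem map_mem_eig (ρ : Representation ℂ G V) (N : Subgroup G) [N.Normal] (f : G → ℂ) (g : G)
    {v : V} (hv : v ∈ eig ρ N f) : ρ g v ∈ eig ρ N (fun n => f (g⁻¹ * n * g)) := by
  intro n hn
  have h1 : g⁻¹ * n * g ∈ N := by
    simpa using Subgroup.Normal.conj_mem ‹N.Normal› n hn g⁻¹
  have h2 : n * g = g * (g⁻¹ * n * g) := by group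
  rw [← Module.End.mul_apply, ← map_mul, h2, map_mul, Module.End.mul_apply, hv _ h1, map_smul]

/-- Eigenspaces of a commutative group for pairwise distinct systems of eigenvalues are
independent. -/
theorem iSupIndep_eig (ρ : Representation ℂ G V) (N : Subgroup G)
    (hN : ∀ x ∈ N, ∀ y ∈ N, x * y = y * x) {ι : Type*} (f : ι → G → ℂ)
    (hf : ∀ i j, (∀ n ∈ N, f i n = f j n) → i = j) :
    iSupIndep fun i => eig ρ N (f i) := by
  have h := Module.End.independent_iInf_maxGenEigenspace_of_forall_mapsTo
    (fun n : N => (ρ n : Module.End ℂ V)) (by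
      intro i j φ
      refine Module.End.mapsTo_maxGenEigenspace_of_comm ?_ φ
      change ρ j * ρ i = ρ i * ρ j
      rw [← map_mul, ← map_mul, hN _ j.2 _ i.2])
  have hinj : Function.Injective (fun (i : ι) (n : N) => f i n) := fun i j hij =>
    hf i j fun n hn => congrFun hij ⟨n, hn⟩
  refine (h.comp hinj).mono fun i v hv => ?_
  simp only [Function.comp_apply, Submodule.mem_iInf]
  intro n
  refine Module.End.genEigenspace_le_maximal _ _ 1 ?_
  exact Module.End.mem_eigenspace_iff.2 (hv n n.2)

/-- If the stabilizer of `f` lies in `T`, the conjugates of the `f`-eigenspace by `G / T` are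
independent. -/
theorem index_mul_finrank_eig_le [Finite G] [FiniteDimensional ℂ V] (ρ : Representation ℂ G V)
    (N : Subgroup G) [N.Normal] (hN : ∀ x ∈ N, ∀ y ∈ N, x * y = y * x) (f : G → ℂ)
    (T : Subgroup G) (hT : ∀ g, (∀ n ∈ N, f (g⁻¹ * n * g) = f n) → g ∈ T) :
    T.index * Module.finrank ℂ (eig ρ N f) ≤ Module.finrank ℂ V := by
  classical
  have := Fintype.ofFinite (G ⧸ T)
  let F : G ⧸ T → G → ℂ := fun q n => f (q.out⁻¹ * n * q.out)
  have hind : iSupIndep fun i => eig ρ N (F i) := by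
    refine iSupIndep_eig ρ N hN F fun i j hij => ?_
    have : (j.out⁻¹ * i.out)⁻¹ ∈ T := by
      refine T.inv_mem (hT _ fun n hn => ?_)
      have h1 : j.out * n * (j.out)⁻¹ ∈ N := Subgroup.Normal.conj_mem ‹N.Normal› n hn _
      have := hij _ h1
      simp only [F] at this
      convert this using 2 <;> group
    rw [← i.out_eq', ← j.out_eq']
    exact QuotientGroup.eq.2 (by simpa using this)
  have hle := LinearMap.finrank_le_finrank_of_injective hind.dfinsupp_lsum_injective
  refine le_trans ?_ hle
  rw [show Module.finrank ℂ (Π₀ i, eig ρ N (F i)) = ∑ i, Module.finrank ℂ (eig ρ N (F i)) from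
    Module.finrank_directSum (R := ℂ) (fun i => eig ρ N (F i))]
  rw [Subgroup.index, Nat.card_eq_fintype_card, ← smul_eq_mul, ← Finset.card_univ,
    ← Finset.sum_const]
  refine Finset.sum_le_sum fun i _ => ?_
  refine LinearMap.finrank_le_finrank_of_injective
    (f := ((ρ i.out).restrict (fun v hv => map_mem_eig ρ N f i.out hv) :
      eig ρ N f →ₗ[ℂ] eig ρ N (F i))) ?_
  intro v w hvw
  have : ρ i.out v = ρ i.out w := congrArg Subtype.val hvw
  apply Subtype.ext
  rw [← ρ.inv_self_apply i.out (v : V), this, ρ.inv_self_apply]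

/-- Commuting operators which preserve a non-zero subspace have a common eigenvector in it. -/
theorem exists_common_eigenvector [FiniteDimensional ℂ V] (ρ : Representation ℂ G V)
    (S : Subgroup G) (hS : ∀ x ∈ S, ∀ y ∈ S, x * y = y * x) (W : Submodule ℂ V) (hW : W ≠ ⊥)
    (hst : ∀ s ∈ S, ∀ v ∈ W, ρ s v ∈ W) :
    ∃ v ∈ W, v ≠ 0 ∧ ∃ θ : S →* ℂˣ, ∀ s : S, ρ s v = (θ s : ℂ) • v := by
  -- on a stable subspace of minimal dimension every operator is a scalar
  let P : ℕ → Prop := fun n => ∃ U : Submodule ℂ V, U ≤ W ∧ U ≠ ⊥ ∧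
    (∀ s ∈ S, ∀ v ∈ U, ρ s v ∈ U) ∧ Module.finrank ℂ U = n
  have hP : ∃ n, P n := ⟨_, W, le_rfl, hW, hst, rfl⟩
  classical
  obtain ⟨U, hUW, hU, hUst, hUn⟩ := Nat.find_spec hP
  have hmin : ∀ U' : Submodule ℂ V, U' ≤ U → U' ≠ ⊥ → (∀ s ∈ S, ∀ v ∈ U', ρ s v ∈ U') →
      U' = U := by
    intro U' h1 h2 h3
    refine Submodule.eq_of_le_of_finrank_le h1 ?_
    rw [hUn]
    exact Nat.find_min' hP ⟨U', h1.trans hUW, h2, h3, rfl⟩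
  have hscal : ∀ s ∈ S, ∃ c : ℂ, ∀ v ∈ U, ρ s v = c • v := by
    intro s hs
    have : Nontrivial U := (Submodule.nontrivial_iff_ne_bot).2 hU
    obtain ⟨c, hc⟩ := Module.End.exists_eigenvalue ((ρ s).restrict (hUst s hs))
    obtain ⟨w, hw⟩ := hc.exists_hasEigenvector
    refine ⟨c, ?_⟩
    have h := hmin (U ⊓ Module.End.eigenspace (ρ s) c) inf_le_left ?_ ?_
    · intro v hv
      rw [← h] at hv
      exact Module.End.mem_eigenspace_iff.1 hv.2
    · intro h0
      have hw1 : (w : V) ∈ U ⊓ Module.End.eigenspace (ρ s) c := by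
        refine ⟨w.2, Module.End.mem_eigenspace_iff.2 ?_⟩
        exact congrArg Subtype.val hw.apply_eq_smul
      rw [h0, Submodule.mem_bot] at hw1
      exact hw.2 (Subtype.ext hw1)
    · rintro t ht v ⟨hv1, hv2⟩
      refine ⟨hUst t ht v hv1, Module.End.mem_eigenspace_iff.2 ?_⟩
      rw [← Module.End.mul_apply, ← map_mul, hS s hs t ht, map_mul, Module.End.mul_apply,
        Module.End.mem_eigenspace_iff.1 hv2, map_smul]
  obtain ⟨v, hvU, hv0⟩ := Submodule.exists_mem_ne_zero_of_ne_bot hU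
  choose c hc using hscal
  refine ⟨v, hUW hvU, hv0, MonoidHom.toHomUnits
    { toFun := fun s => c s s.2
      map_one' := ?_
      map_mul' := ?_ }, fun s => hc s s.2 v hvU⟩
  · have := hc 1 S.one_mem v hvU
    rw [map_one, Module.End.one_apply] at this
    exact (smul_left_injective ℂ hv0 (by simpa using this)).symm
  · intro s t
    have := hc (s * t : G) (S.mul_mem s.2 t.2) v hvU
    rw [map_mul, Module.End.mul_apply, hc t t.2 v hvU, map_smul, hc s s.2 v hvU, smul_smul] at this
    refine (smul_left_injective ℂ hv0 (show _ • v = _ • v from ?_)).symm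
    rw [mul_comm, this]
    rfl

section Ind

variable (T : Subgroup G) (Θ : T →* ℂˣ)

/-- The canonical generator of an induced representation. -/
def indGen : Representation.IndV T.subtype (charRep Θ) :=
  Representation.IndV.mk T.subtype (charRep Θ) 1 (1 : ℂ)

theorem charRep_apply (t : T) (z : ℂ) : charRep Θ t z = (Θ t : ℂ) * z := by
  simp [charRep, twist]

theorem indMk_mul (t : T) (g : G) (z : ℂ) :
    Representation.IndV.mk T.subtype (charRep Θ) ((t : G) * g) ((Θ t : ℂ) * z) =
      Representation.IndV.mk T.subtype (charRep Θ) g z := by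
  have := Representation.Coinvariants.mk_self_apply
    (Representation.tprod ((Representation.leftRegular ℂ G).comp T.subtype) (charRep Θ)) t
    (TensorProduct.tmul ℂ (MonoidAlgebra.single g 1) z)
  rw [← charRep_apply]
  simpa using this

theorem indMk_eq (g : G) (z : ℂ) :
    Representation.IndV.mk T.subtype (charRep Θ) g z = z • indChar T Θ g⁻¹ (indGen T Θ) := by
  rw [indGen, Representation.ind_mk, ← map_smul]
  simp

theorem indChar_indGen (t : T) : indChar T Θ t (indGen T Θ) = (Θ t : ℂ) • indGen T Θ := by
  rw [indGen, Representation.ind_mk, ← indMk_mul T Θ t, ← map_smul]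
  simp

/-- The induced representation is generated by its canonical generator. -/
theorem indChar_ext {W : Type*} [AddCommGroup W] [Module ℂ W]
    {φ φ' : Representation.IndV T.subtype (charRep Θ) →ₗ[ℂ] W}
    (h : ∀ g, φ (indChar T Θ g (indGen T Θ)) = φ' (indChar T Θ g (indGen T Θ))) : φ = φ' := by
  refine Representation.IndV.hom_ext _ _ fun g => LinearMap.ext fun z => ?_
  change φ (Representation.IndV.mk T.subtype (charRep Θ) g z) =
    φ' (Representation.IndV.mk T.subtype (charRep Θ) g z)
  rw [indMk_eq, map_smul, map_smul, h]

/-- Frobenius reciprocity for an induced character. -/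
theorem exists_intertwiningMap (ρ : Representation ℂ G V) (v : V)
    (hv : ∀ t : T, ρ t v = (Θ t : ℂ) • v) :
    ∃ φ : (indChar T Θ).IntertwiningMap ρ, φ (indGen T Θ) = v := by
  let φ₀ : Representation.IndV T.subtype (charRep Θ) →ₗ[ℂ] V :=
    Representation.Coinvariants.lift _
      (TensorProduct.lift <|
        (Finsupp.lift _ _ _ fun h => ρ h⁻¹ ∘ₗ LinearMap.toSpanSingleton ℂ V v) ∘ₗ
        (MonoidAlgebra.coeffLinearEquiv ℂ).toLinearMap)
      (fun t => by
        ext h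
        simp [charRep_apply, _root_.mul_inv_rev]
        rw [← map_smul, ← map_smul, ← hv, ρ.inv_self_apply])
  have hφ : ∀ g z, φ₀ (Representation.IndV.mk T.subtype (charRep Θ) g z) = z • ρ g⁻¹ v := by
    intro g z
    simp [φ₀]
  refine ⟨⟨φ₀, fun g => indChar_ext T Θ fun h => ?_⟩, ?_⟩
  · rw [LinearMap.comp_apply, LinearMap.comp_apply, indGen, Representation.ind_mk,
      Representation.ind_mk, hφ, hφ]
    simp
  · change φ₀ _ = v
    rw [indGen, hφ]
    simp

theorem indGen_ne_zero : indGen T Θ ≠ 0 := by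
  classical
  -- the functional supported on `T` which is `Θ⁻¹` there does not vanish on the generator
  let F : G → ℂ := fun g => if h : g ∈ T then ((Θ ⟨g, h⟩)⁻¹ : ℂˣ) else 0
  let φ₀ : Representation.IndV T.subtype (charRep Θ) →ₗ[ℂ] ℂ :=
    Representation.Coinvariants.lift _
      (TensorProduct.lift <| (Finsupp.lift _ _ _ fun h => LinearMap.toSpanSingleton ℂ ℂ (F h)) ∘ₗ
        (MonoidAlgebra.coeffLinearEquiv ℂ).toLinearMap)
      (fun t => by
        ext h
        simp [charRep_apply, F]
        by_cases hh : h ∈ T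
        · have : (t : G) * h ∈ T := T.mul_mem t.2 hh
          rw [dif_pos this, dif_pos hh,
            show (⟨(t : G) * h, this⟩ : T) = t * ⟨h, hh⟩ from rfl, map_mul]
          simp [mul_left_comm (Θ t : ℂ)]
        · have : (t : G) * h ∉ T := fun h' => hh (by simpa using T.mul_mem (T.inv_mem t.2) h')
          rw [dif_neg this, dif_neg hh])
  intro h0
  have : φ₀ (indGen T Θ) = F 1 := by simp [φ₀, indGen]
  rw [h0, map_zero] at this
  have h1 : F 1 = 1 := by
    have : (⟨1, T.one_mem⟩ : T) = 1 := rfl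
    simp [F, T.one_mem, this]
  rw [h1] at this
  exact zero_ne_one this

end Ind

variable {W : Type*} [AddCommGroup W] [Module ℂ W]

theorem span_indGen_eq_top (T : Subgroup G) (Θ : T →* ℂˣ) :
    Submodule.span ℂ (Set.range fun c : G ⧸ T => indChar T Θ c.out (indGen T Θ)) = ⊤ := by
  set U := Submodule.span ℂ (Set.range fun c : G ⧸ T => indChar T Θ c.out (indGen T Θ))
  have h : U.mkQ = 0 := by
    refine indChar_ext T Θ fun g => ?_
    rw [LinearMap.zero_apply, Submodule.mkQ_apply, Submodule.Quotient.mk_eq_zero]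
    obtain ⟨t, ht⟩ := QuotientGroup.mk_out_eq_mul T g
    have : g = (g : G ⧸ T).out * ((t⁻¹ : T) : G) := by rw [ht]; simp
    rw [this, map_mul, Module.End.mul_apply, indChar_indGen, map_smul]
    exact U.smul_mem _ (Submodule.subset_span ⟨(g : G ⧸ T), rfl⟩)
  rw [← Submodule.ker_mkQ U, h, LinearMap.ker_zero]

instance finiteDimensional_indChar [Finite G] (T : Subgroup G) (Θ : T →* ℂˣ) :
    FiniteDimensional ℂ (Representation.IndV T.subtype (charRep Θ)) :=
  ⟨Submodule.fg_def.2 ⟨_, Set.finite_range _, span_indGen_eq_top T Θ⟩⟩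

theorem finrank_indChar_le [Finite G] (T : Subgroup G) (Θ : T →* ℂˣ) :
    Module.finrank ℂ (Representation.IndV T.subtype (charRep Θ)) ≤ T.index := by
  classical
  have := Fintype.ofFinite (G ⧸ T)
  have h := finrank_range_le_card (R := ℂ)
    (fun c : G ⧸ T => indChar T Θ c.out (indGen T Θ))
  rw [Set.finrank, span_indGen_eq_top, finrank_top] at h
  rwa [Subgroup.index, Nat.card_eq_fintype_card]

theorem eq_top_of_irreducible {ρ : Representation ℂ G V} (hρ : ρ.IsIrreducible)
    (U : Submodule ℂ V) (hU : ∀ g, ∀ v ∈ U, ρ g v ∈ U) {v : V} (hv : v ∈ U) (hv0 : v ≠ 0) :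
    U = ⊤ := by
  rcases hρ.eq_bot_or_eq_top (⟨U, fun g v hv => hU g v hv⟩ : Subrepresentation ρ) with h | h
  · have : U = ⊥ := congrArg Subrepresentation.toSubmodule h
    rw [this, Submodule.mem_bot] at hv
    exact absurd hv hv0
  · exact congrArg Subrepresentation.toSubmodule h

theorem Equivalent.symm {ρ : Representation ℂ G V} {ρ' : Representation ℂ G W}
    (h : Equivalent ρ ρ') : Equivalent ρ' ρ := h.map fun e => e.symm

theorem Equivalent.trans {U : Type*} [AddCommGroup U] [Module ℂ U] {ρ : Representation ℂ G V}
    {ρ' : Representation ℂ G W} {ρ'' : Representation ℂ G U}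
    (h : Equivalent ρ ρ') (h' : Equivalent ρ' ρ'') : Equivalent ρ ρ'' :=
  h.elim fun e => h'.map fun e' => e.trans e'

theorem Equivalent.finrank_eq {ρ : Representation ℂ G V} {ρ' : Representation ℂ G W}
    (h : Equivalent ρ ρ') : Module.finrank ℂ V = Module.finrank ℂ W :=
  h.elim fun e => e.toLinearEquiv.finrank_eq

theorem Equivalent.apply {ρ : Representation ℂ G V} {ρ' : Representation ℂ G W}
    (e : ρ.Equiv ρ') (g : G) (v : V) : e (ρ g v) = ρ' g (e v) :=
  LinearMap.congr_fun (e.toIntertwiningMap.isIntertwining' g) v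

theorem Equivalent.ne_zero {ρ : Representation ℂ G V} {ρ' : Representation ℂ G W}
    (e : ρ.Equiv ρ') {v : V} (hv : v ≠ 0) : e v ≠ 0 := fun h =>
  hv (e.toLinearEquiv.injective ((show e.toLinearEquiv v = 0 from h).trans (map_zero _).symm))

theorem Equivalent.isIrreducible {ρ : Representation ℂ G V} {ρ' : Representation ℂ G W}
    (h : Equivalent ρ ρ') (hρ : ρ.IsIrreducible) : ρ'.IsIrreducible := by
  obtain ⟨e⟩ := h
  have hnt := hρ.toNontrivial
  refine { exists_pair_ne := ⟨⊥, ⊤, fun h => ?_⟩, eq_bot_or_eq_top := fun M => ?_ }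
  · have h1 : (⊥ : Submodule ℂ W) = ⊤ := congrArg Subrepresentation.toSubmodule h
    have h2 : (⊥ : Subrepresentation ρ) = ⊤ := by
      apply Subrepresentation.toSubmodule_injective
      change (⊥ : Submodule ℂ V) = ⊤
      have := congrArg (Submodule.comap (e.toLinearEquiv : V →ₗ[ℂ] W)) h1
      rwa [Submodule.comap_top, Submodule.comap_bot, LinearEquiv.ker] at this
    exact bot_ne_top h2
  · have hst : ∀ g, ∀ v ∈ M.toSubmodule.comap (e.toLinearEquiv : V →ₗ[ℂ] W),
        ρ g v ∈ M.toSubmodule.comap (e.toLinearEquiv : V →ₗ[ℂ] W) := fun g v hv => by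
      change e (ρ g v) ∈ M.toSubmodule
      rw [Equivalent.apply]
      exact M.apply_mem_toSubmodule g hv
    by_cases hM : M = ⊥
    · exact Or.inl hM
    · right
      obtain ⟨w, hw, hw0⟩ := Submodule.exists_mem_ne_zero_of_ne_bot (p := M.toSubmodule)
        (fun h => hM (Subrepresentation.toSubmodule_injective h))
      have := eq_top_of_irreducible hρ _ hst (v := e.symm w)
        (by change e (e.symm w) ∈ M.toSubmodule; rwa [e.apply_symm_apply])
        (Equivalent.ne_zero e.symm hw0)
      apply Subrepresentation.toSubmodule_injective
      change M.toSubmodule = ⊤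
      refine eq_top_iff.2 fun x _ => ?_
      have hx : e.symm x ∈ M.toSubmodule.comap (e.toLinearEquiv : V →ₗ[ℂ] W) := by
        rw [this]; trivial
      change e (e.symm x) ∈ M.toSubmodule at hx
      rwa [e.apply_symm_apply] at hx

/-- `N` is a commutative subgroup of `T`, and the elements of `G` which fix the function `f` on `N`
under conjugation lie in `T`. -/
structure IsInertia (N T : Subgroup G) (f : G → ℂ) : Prop where
  comm : ∀ x ∈ N, ∀ y ∈ N, x * y = y * x
  le : N ≤ T
  stab : ∀ g, (∀ n ∈ N, f (g⁻¹ * n * g) = f n) → g ∈ T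

/-- The character `Θ` of `T` extends the function `f` on `N`. -/
def Extends (N T : Subgroup G) (f : G → ℂ) (Θ : T →* ℂˣ) : Prop :=
  ∀ n (_ : n ∈ N) (hT : n ∈ T), (Θ ⟨n, hT⟩ : ℂ) = f n

variable {N T : Subgroup G} {f : G → ℂ} {Θ : T →* ℂˣ}

theorem Extends.mem_eig (hΘ : Extends N T f Θ) (h : N ≤ T) {ρ : Representation ℂ G V} {v : V}
    (hv : ∀ t : T, ρ t v = (Θ t : ℂ) • v) : v ∈ eig ρ N f := fun n hn => by
  rw [← hΘ n hn (h hn)]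
  exact hv ⟨n, h hn⟩

/-- A representation in which `f` occurs contains all conjugates of `f`, and there are at least
`T.index` of them. -/
theorem index_le_finrank [Finite G] [N.Normal] [FiniteDimensional ℂ V] (h : IsInertia N T f)
    {ρ : Representation ℂ G V} {v : V} (hv : v ∈ eig ρ N f) (hv0 : v ≠ 0) :
    T.index ≤ Module.finrank ℂ V := by
  refine le_trans ?_ (index_mul_finrank_eig_le ρ N h.comm f T h.stab)
  refine Nat.le_mul_of_pos_right _ ?_
  have : Nontrivial (eig ρ N f) := ⟨⟨v, hv⟩, 0, fun h => hv0 (congrArg Subtype.val h)⟩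
  exact Module.finrank_pos

/-- The representation induced from an extension of `f` is irreducible: every representation in
which `f` occurs has dimension at least `T.index`, so a proper non-zero quotient is too small. -/
theorem isIrreducible_indChar [Finite G] [N.Normal] (h : IsInertia N T f) (hΘ : Extends N T f Θ) :
    (indChar T Θ).IsIrreducible := by
  refine { exists_pair_ne := ⟨⊥, ⊤, fun h => ?_⟩, eq_bot_or_eq_top := fun M => ?_ }
  · have h1 : (⊥ : Submodule ℂ (Representation.IndV T.subtype (charRep Θ))) = ⊤ :=
      congrArg Subrepresentation.toSubmodule h
    have h2 : indGen T Θ ∈ (⊤ : Submodule ℂ (Representation.IndV T.subtype (charRep Θ))) :=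
      trivial
    rw [← h1, Submodule.mem_bot] at h2
    exact indGen_ne_zero T Θ h2
  · by_cases hM : indGen T Θ ∈ M.toSubmodule
    · right
      apply Subrepresentation.toSubmodule_injective
      change M.toSubmodule = ⊤
      rw [eq_top_iff, ← span_indGen_eq_top T Θ, Submodule.span_le]
      rintro _ ⟨c, rfl⟩
      exact M.apply_mem_toSubmodule _ hM
    · -- the quotient by `M` still contains `f`, so it is as large as the whole space
      left
      let ρ' := (indChar T Θ).quotient M.toSubmodule fun g v hv => M.apply_mem_toSubmodule g hv
      have hv : M.toSubmodule.mkQ (indGen T Θ) ∈ eig ρ' N f := by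
        refine hΘ.mem_eig h.le fun t => ?_
        change M.toSubmodule.mkQ (indChar T Θ t (indGen T Θ)) = _
        rw [indChar_indGen, map_smul]
      have h1 := index_le_finrank h hv (by
        rwa [Submodule.mkQ_apply, Ne, Submodule.Quotient.mk_eq_zero])
      have h2 := finrank_indChar_le T Θ
      have h3 := Submodule.finrank_quotient_add_finrank M.toSubmodule
      apply Subrepresentation.toSubmodule_injective
      change M.toSubmodule = ⊥
      exact Submodule.finrank_eq_zero.1 (by omega)

theorem finrank_indChar [Finite G] [N.Normal] (h : IsInertia N T f) (hΘ : Extends N T f Θ) :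
    Module.finrank ℂ (Representation.IndV T.subtype (charRep Θ)) = T.index :=
  (finrank_indChar_le T Θ).antisymm (index_le_finrank h
    (hΘ.mem_eig h.le (indChar_indGen T Θ)) (indGen_ne_zero T Θ))

theorem equivalent_indChar [Finite G] [N.Normal] (h : IsInertia N T f) (hΘ : Extends N T f Θ)
    {ρ : Representation ℂ G V} (hρ : ρ.IsIrreducible) {v : V} (hv0 : v ≠ 0)
    (hv : ∀ t : T, ρ t v = (Θ t : ℂ) • v) : Equivalent ρ (indChar T Θ) := by
  have := isIrreducible_indChar h hΘ
  obtain ⟨φ, hφ⟩ := exists_intertwiningMap T Θ ρ v hv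
  refine Equivalent.symm ⟨φ.ofBijective ((Representation.IsIrreducible.bijective_or_eq_zero φ
    ).resolve_right fun h0 => hv0 ?_)⟩
  rw [← hφ, h0]
  rfl

/-- In a representation of the least possible dimension the `f`-eigenspace is a line, on which `T`
acts by only one character. -/
theorem extension_unique [Finite G] [N.Normal] [FiniteDimensional ℂ V] (h : IsInertia N T f)
    {Θ' : T →* ℂˣ} (hΘ : Extends N T f Θ) (hΘ' : Extends N T f Θ') {ρ : Representation ℂ G V}
    (hd : Module.finrank ℂ V = T.index) {v v' : V} (hv0 : v ≠ 0) (hv0' : v' ≠ 0)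
    (hv : ∀ t : T, ρ t v = (Θ t : ℂ) • v) (hv' : ∀ t : T, ρ t v' = (Θ' t : ℂ) • v') :
    Θ = Θ' := by
  have h1 := index_mul_finrank_eig_le ρ N h.comm f T h.stab
  have hpos : 0 < T.index := Nat.pos_of_ne_zero T.index_ne_zero_of_finite
  have h2 : Module.finrank ℂ (eig ρ N f) ≤ 1 := by
    rw [hd] at h1
    exact Nat.le_of_mul_le_mul_left (by simpa using h1) hpos
  have hw := hΘ.mem_eig h.le hv
  have hw' := hΘ'.mem_eig h.le hv'
  have h3 : Module.finrank ℂ (eig ρ N f) = 1 := le_antisymm h2 (by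
    have : Nontrivial (eig ρ N f) := ⟨⟨v, hw⟩, 0, fun h => hv0 (congrArg Subtype.val h)⟩
    exact Module.finrank_pos)
  obtain ⟨c, hc⟩ := (finrank_eq_one_iff_of_nonzero' (⟨v, hw⟩ : eig ρ N f)
    (fun h => hv0 (congrArg Subtype.val h))).1 h3 ⟨v', hw'⟩
  have hc' : c • v = v' := congrArg Subtype.val hc
  ext t
  have h4 := hv' t
  rw [← hc', map_smul, hv, smul_comm, hc'] at h4
  exact smul_left_injective ℂ hv0' h4

/-- The functions which occur on a commutative normal subgroup in an irreducible representation
form a single orbit: the translates of an eigenvector span everything, and eigenspaces for distinct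
functions are independent. -/
theorem isConj_of_mem_eig [Finite G] [N.Normal] (hN : ∀ x ∈ N, ∀ y ∈ N, x * y = y * x)
    {ρ : Representation ℂ G V} (hρ : ρ.IsIrreducible) {f' : G → ℂ} {v v' : V}
    (hv : v ∈ eig ρ N f) (hv' : v' ∈ eig ρ N f') (hv0 : v ≠ 0) (hv0' : v' ≠ 0) :
    ∃ g : G, ∀ n ∈ N, f' n = f (g⁻¹ * n * g) := by
  classical
  by_contra! hne
  -- choose one element of `G` for each conjugate of `f`
  let F : G → G → ℂ := fun g n => f (g⁻¹ * n * g)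
  let r : G → N → ℂ := fun g n => F g n
  let idx := Option (Set.range r)
  let φ : idx → G → ℂ := fun o => o.elim f' (fun x => F x.2.choose)
  have hind : iSupIndep fun i : idx => eig ρ N (φ i) := by
    refine iSupIndep_eig ρ N hN φ fun i j hij => ?_
    rcases i with _ | i <;> rcases j with _ | j
    · rfl
    · obtain ⟨n, hn, h⟩ := hne j.2.choose
      exact absurd (hij n hn) h
    · obtain ⟨n, hn, h⟩ := hne i.2.choose
      exact absurd (hij n hn).symm h
    · congr 1
      apply Subtype.ext
      rw [← i.2.choose_spec, ← j.2.choose_spec]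
      exact funext fun n => hij n n.2
  let U : Submodule ℂ V := Submodule.span ℂ (Set.range fun g => ρ g v)
  have hUtop : U = ⊤ := by
    refine eq_top_of_irreducible hρ U (fun g w hw => ?_)
      (Submodule.subset_span ⟨1, by simp⟩) hv0
    refine Submodule.span_induction (p := fun w _ => ρ g w ∈ U) ?_ ?_ ?_ ?_ hw
    · rintro _ ⟨h, rfl⟩
      exact Submodule.subset_span ⟨g * h, by simp⟩
    · rw [map_zero]; exact U.zero_mem
    · intro x y _ _ hx hy
      rw [map_add]; exact U.add_mem hx hy
    · intro c x _ hx
      rw [map_smul]; exact U.smul_mem c hx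
  have hle : U ≤ ⨆ (j : idx) (_ : j ≠ none), eig ρ N (φ j) := by
    rw [Submodule.span_le]
    rintro _ ⟨g, rfl⟩
    refine Submodule.mem_iSup_of_mem (some ⟨r g, g, rfl⟩) (Submodule.mem_iSup_of_mem (by simp) ?_)
    have h1 := map_mem_eig ρ N f g hv
    have hsp := (⟨g, rfl⟩ : r g ∈ Set.range r).choose_spec
    intro n hn
    rw [h1 n hn]
    exact congrArg (· • ρ g v) (congrFun hsp ⟨n, hn⟩).symm
  have := (hind none).le_bot (show v' ∈ _ ⊓ _ from ⟨hv', hle (hUtop ▸ trivial)⟩)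
  exact hv0' ((Submodule.mem_bot ℂ).1 this)

/-- Over a commutative subgroup `S` which fixes `f`, an eigenvector for `f` can be chosen to be an
eigenvector for `S` too. -/
theorem exists_eigenvector_sup [N.Normal] [FiniteDimensional ℂ V] {S : Subgroup G}
    (hS : ∀ x ∈ S, ∀ y ∈ S, x * y = y * x) (hf : ∀ s ∈ S, ∀ n ∈ N, f (s⁻¹ * n * s) = f n)
    {ρ : Representation ℂ G V} {v : V} (hv : v ∈ eig ρ N f) (hv0 : v ≠ 0) :
    ∃ w ∈ eig ρ N f, w ≠ 0 ∧ ∃ θ : S →* ℂˣ, ∀ s : S, ρ s w = (θ s : ℂ) • w := by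
  refine exists_common_eigenvector ρ S hS (eig ρ N f) (fun h => hv0 ?_) fun s hs w hw n hn => ?_
  · rwa [h, Submodule.mem_bot] at hv
  · rw [map_mem_eig ρ N f s hw n hn]
    exact congrArg (· • ρ s w) (hf s hs n hn)

end Clifford

/-! ### Twists -/

section Twist

variable {G : Type*} [Group G] {V : Type*} [AddCommGroup V] [Module ℂ V]
  {W : Type*} [AddCommGroup W] [Module ℂ W]

theorem twist_apply (χ : G →* ℂˣ) (ρ : Representation ℂ G V) (g : G) (v : V) :
    twist χ ρ g v = (χ g : ℂ) • ρ g v := rfl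

theorem twist_inv_twist (χ : G →* ℂˣ) (ρ : Representation ℂ G V) :
    twist χ (twist χ⁻¹ ρ) = ρ := by
  ext g v
  simp [twist_apply, smul_smul]

theorem Equivalent.twist {ρ : Representation ℂ G V} {ρ' : Representation ℂ G W} (χ : G →* ℂˣ)
    (h : Equivalent ρ ρ') : Equivalent (GL2Rep.twist χ ρ) (GL2Rep.twist χ ρ') :=
  h.map fun e => Representation.Equiv.mk e.toLinearEquiv fun g => by
    ext v
    change e ((χ g : ℂ) • ρ g v) = (χ g : ℂ) • ρ' g (e v)
    rw [← Equivalent.apply e]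
    exact e.toLinearEquiv.map_smul _ _

theorem isIrreducible_twist (χ : G →* ℂˣ) {ρ : Representation ℂ G V} (hρ : ρ.IsIrreducible) :
    (twist χ ρ).IsIrreducible := by
  have hst : ∀ (M : Subrepresentation (twist χ ρ)) (g : G), ∀ v ∈ M.toSubmodule,
      ρ g v ∈ M.toSubmodule := fun M g v hv => by
    have := M.toSubmodule.smul_mem ((χ g : ℂ)⁻¹) (M.apply_mem_toSubmodule g hv)
    rwa [twist_apply, smul_smul, inv_mul_cancel₀ (Units.ne_zero _), one_smul] at this
  have hnt := hρ.toNontrivial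
  refine { exists_pair_ne := ⟨⊥, ⊤, fun h => ?_⟩, eq_bot_or_eq_top := fun M => ?_ }
  · have h1 : (⊥ : Submodule ℂ V) = ⊤ := congrArg Subrepresentation.toSubmodule h
    exact bot_ne_top (Subrepresentation.toSubmodule_injective (ρ := ρ) h1)
  · rcases hρ.eq_bot_or_eq_top (⟨M.toSubmodule, hst M⟩ : Subrepresentation ρ) with h | h
    · exact Or.inl (Subrepresentation.toSubmodule_injective
        (congrArg (fun M : Subrepresentation ρ => M.toSubmodule) h))
    · exact Or.inr (Subrepresentation.toSubmodule_injective
        (congrArg (fun M : Subrepresentation ρ => M.toSubmodule) h))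

end Twist

/-! ### Counting isomorphism classes -/

section Count

variable {G : Type*} [Group G]

theorem nonempty_iso_iff {V W : FDRep ℂ G} : Nonempty (V ≅ W) ↔ Equivalent V.ρ W.ρ := by
  constructor
  · rintro ⟨i⟩
    refine ⟨Representation.Equiv.mk (FDRep.isoToLinearEquiv i) fun g => ?_⟩
    rw [FDRep.Iso.conj_ρ i g]
    ext v
    simp [LinearEquiv.conj_apply]
  · rintro ⟨e⟩
    exact ⟨Action.mkIso (LinearEquiv.toFGModuleCatIso e.toLinearEquiv) fun g => by
      ext v
      exact Equivalent.apply e g v⟩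

/-- Every finite-dimensional representation, whatever the universe of its space, is isomorphic to
one in `FDRep`. -/
theorem exists_fdRep {V : Type*} [AddCommGroup V] [Module ℂ V] [FiniteDimensional ℂ V]
    (ρ : Representation ℂ G V) : ∃ W : FDRep ℂ G, Equivalent W.ρ ρ := by
  let e : V ≃ₗ[ℂ] (Fin (Module.finrank ℂ V) → ℂ) := (Module.finBasis ℂ V).equivFun
  let ρ' : Representation ℂ G (Fin (Module.finrank ℂ V) → ℂ) :=
    { toFun := fun g => e.conj (ρ g)
      map_one' := by ext; simp [LinearEquiv.conj_apply]
      map_mul' := fun g h => by ext; simp [LinearEquiv.conj_apply] }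
  refine ⟨FDRep.of ρ', Equivalent.symm ⟨Representation.Equiv.mk e fun g => ?_⟩⟩
  ext1 v
  change e (ρ g v) = e (ρ g (e.symm (e v)))
  rw [e.symm_apply_apply]

/-- The number of isomorphism classes with property `P`, if these are parametrized bijectively by
a finite type. -/
theorem numIso_eq_card {X : Type*} [Finite X] {P : FDRep ℂ G → Prop}
    (Rel : FDRep ℂ G → X → Prop) (hP : ∀ V, P V ↔ ∃ x, Rel V x)
    (hinj : ∀ V V' x, Rel V x → Rel V' x → Equivalent V.ρ V'.ρ)
    (hiso : ∀ V V' x, Rel V x → Equivalent V.ρ V'.ρ → Rel V' x)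
    (huniq : ∀ V x x', Rel V x → Rel V x' → x = x') (hex : ∀ x, ∃ V, Rel V x) :
    numIso P = Nat.card X ∧
      ((Quotient.mk (isIsomorphicSetoid (FDRep ℂ G))) '' {V | P V}).Finite := by
  choose R hR using hex
  have himg : (Quotient.mk (isIsomorphicSetoid (FDRep ℂ G))) '' {V | P V} =
      Set.range fun x => Quotient.mk (isIsomorphicSetoid (FDRep ℂ G)) (R x) := by
    ext c
    constructor
    · rintro ⟨V, hV, rfl⟩
      obtain ⟨x, hx⟩ := (hP V).1 hV
      exact ⟨x, Quotient.sound (nonempty_iso_iff.2 (hinj _ _ x (hR x) hx))⟩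
    · rintro ⟨x, rfl⟩
      exact ⟨R x, (hP _).2 ⟨x, hR x⟩, rfl⟩
  have hi : Function.Injective
      fun x => Quotient.mk (isIsomorphicSetoid (FDRep ℂ G)) (R x) := fun x y hxy => by
    have h1 : Equivalent (R x).ρ (R y).ρ := nonempty_iso_iff.1 (Quotient.exact hxy)
    exact huniq _ _ _ (hiso _ _ x (hR x) h1) (hR y)
  rw [numIso, himg]
  refine ⟨?_, Set.finite_range _⟩
  rw [← Set.image_univ, Set.ncard_image_of_injective _ hi, Set.ncard_univ]

theorem numIso_or {P Q : FDRep ℂ G → Prop}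
    (hQ : ∀ V V' : FDRep ℂ G, Equivalent V.ρ V'.ρ → Q V → Q V') (hd : ∀ V, ¬ (P V ∧ Q V))
    (hPf : ((Quotient.mk (isIsomorphicSetoid (FDRep ℂ G))) '' {V | P V}).Finite)
    (hQf : ((Quotient.mk (isIsomorphicSetoid (FDRep ℂ G))) '' {V | Q V}).Finite) :
    numIso (fun V => P V ∨ Q V) = numIso P + numIso Q := by
  rw [numIso, numIso, numIso, ← Set.ncard_union_eq ?_ hPf hQf, ← Set.image_union]
  · rfl
  · rw [Set.disjoint_left]
    rintro _ ⟨V, hV, rfl⟩ ⟨V', hV', h⟩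
    exact hd V ⟨hV, hQ V' V (nonempty_iso_iff.1 (Quotient.exact h)) hV'⟩

end Count

/-! ### Finite chain rings and their additive characters -/

section Chain

/-- In finite abelian groups the fibres of a surjective homomorphism all have the size of the
kernel. -/
theorem card_subtype_comp {A B : Type*} [AddCommGroup A] [AddCommGroup B] [Finite A] (f : A →+ B)
    (hf : Function.Surjective f) (P : B → Prop) :
    Nat.card {a // P (f a)} = Nat.card f.ker * Nat.card {b // P b} := by
  have : Finite B := Finite.of_surjective f hf
  choose g hg using hf
  let e : {a // P (f a)} ≃ f.ker × {b // P b} :=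
    { toFun := fun a => (⟨a - g (f a), by rw [AddMonoidHom.mem_ker, map_sub, hg, sub_self]⟩,
        ⟨f a, a.2⟩)
      invFun := fun p => ⟨p.1 + g p.2, by
        rw [map_add, hg, AddMonoidHom.mem_ker.1 p.1.2, zero_add]; exact p.2.2⟩
      left_inv := fun a => by simp
      right_inv := fun p => by
        have h : f (p.1 + g p.2) = p.2 := by
          rw [map_add, hg, AddMonoidHom.mem_ker.1 p.1.2, zero_add]
        refine Prod.ext (Subtype.ext ?_) (Subtype.ext h)
        simp only [h]
        simp }
  rw [Nat.card_congr e, Nat.card_prod]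

/-- `R` is a finite local principal ideal ring: its maximal ideal is generated by `π`, `r` is the
exponent of nilpotency of `π`, and `q` is the cardinality of the residue field. -/
structure IsChain (R : Type*) [CommRing R] (π : R) (r q : ℕ) : Prop where
  finite : Finite R
  isUnit_or : ∀ x : R, IsUnit x ∨ π ∣ x
  not_isUnit : ¬ IsUnit π
  pow_eq : π ^ r = 0
  dvd_of_mul : ∀ i ≤ r, ∀ x : R, π ^ i * x = 0 → π ^ (r - i) ∣ x
  card_residue : Nat.card (R ⧸ Ideal.span {π}) = q

variable {R : Type*} [CommRing R] {π : R} {r q : ℕ}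

namespace IsChain

theorem not_dvd_isUnit (h : IsChain R π r q) {x : R} (hx : IsUnit x) : ¬ π ∣ x :=
  fun h' => h.not_isUnit (isUnit_of_dvd_unit h' hx)

theorem isUnit_iff (h : IsChain R π r q) {x : R} : IsUnit x ↔ ¬ π ∣ x :=
  ⟨h.not_dvd_isUnit, fun h' => (h.isUnit_or x).resolve_right h'⟩

theorem nontrivial (h : IsChain R π r q) : Nontrivial R := by
  by_contra hn
  rw [not_nontrivial_iff_subsingleton] at hn
  exact h.not_isUnit (isUnit_of_subsingleton π)

theorem pos (h : IsChain R π r q) : 0 < r := by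
  rcases Nat.eq_zero_or_pos r with h0 | h0
  · have := h.pow_eq
    rw [h0, pow_zero] at this
    have := h.nontrivial
    exact absurd ‹(1 : R) = 0› one_ne_zero
  · exact h0

theorem isMaximal (h : IsChain R π r q) : (Ideal.span {π}).IsMaximal := by
  refine Ideal.isMaximal_iff.2 ⟨fun h1 => ?_, fun J x hJ hx hxJ => ?_⟩
  · exact h.not_dvd_isUnit isUnit_one (Ideal.mem_span_singleton.1 h1)
  · rw [Ideal.mem_span_singleton] at hx
    exact (Ideal.eq_top_iff_one J).1 (Ideal.eq_top_of_isUnit_mem J hxJ (h.isUnit_iff.2 hx))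

theorem isUnit_add (h : IsChain R π r q) {x y : R} (hx : IsUnit x) (hy : π ∣ y) :
    IsUnit (x + y) := by
  rw [h.isUnit_iff] at hx ⊢
  exact fun h' => hx ((dvd_add_left hy).1 h')

theorem mul_eq_zero_iff (h : IsChain R π r q) {i : ℕ} (hi : i ≤ r) {x : R} :
    π ^ i * x = 0 ↔ π ^ (r - i) ∣ x := by
  refine ⟨h.dvd_of_mul i hi x, ?_⟩
  rintro ⟨y, rfl⟩
  rw [← mul_assoc, ← pow_add, Nat.add_sub_cancel' hi, h.pow_eq, zero_mul]

theorem exists_eq_pow_mul (h : IsChain R π r q) {c : R} (hc : c ≠ 0) :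
    ∃ i < r, ∃ u : Rˣ, c = π ^ i * u := by
  classical
  have hex : ∃ n, ¬ π ^ n ∣ c := ⟨r, fun h' => hc (by rwa [h.pow_eq, zero_dvd_iff] at h')⟩
  set n := Nat.find hex with hn
  have h1 : ¬ π ^ n ∣ c := Nat.find_spec hex
  have h0 : n ≠ 0 := fun h0 => h1 (by rw [h0, pow_zero]; exact one_dvd c)
  obtain ⟨i, hi⟩ := Nat.exists_eq_succ_of_ne_zero h0
  have h2 : π ^ i ∣ c := not_not.1 (Nat.find_min hex (m := i) (by omega))
  obtain ⟨u, rfl⟩ := h2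
  have hu : IsUnit u := h.isUnit_iff.2 fun ⟨v, hv⟩ => h1 ⟨v, by
    rw [hv, hi, pow_succ, mul_assoc]⟩
  refine ⟨i, ?_, hu.unit, rfl⟩
  by_contra hle
  refine hc ?_
  rw [← Nat.add_sub_cancel' (not_lt.1 hle), pow_add, h.pow_eq, zero_mul, zero_mul]

theorem card_span_pred (h : IsChain R π r q) : Nat.card (Ideal.span {π ^ (r - 1)}) = q := by
  have := h.finite
  have hpos := h.pos
  let f : R →ₗ[R] R := LinearMap.mulLeft R (π ^ (r - 1))
  have hk : Ideal.span {π} = LinearMap.ker f := by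
    ext x
    rw [LinearMap.mem_ker]
    change _ ↔ π ^ (r - 1) * x = 0
    rw [h.mul_eq_zero_iff (by omega), Ideal.mem_span_singleton, show r - (r - 1) = 1 by omega,
      pow_one]
  have hr : LinearMap.range f = Ideal.span {π ^ (r - 1)} := by
    ext x
    change (∃ y, π ^ (r - 1) * y = x) ↔ x ∈ Ideal.span {π ^ (r - 1)}
    rw [Ideal.mem_span_singleton]
    exact ⟨fun ⟨y, hy⟩ => ⟨y, hy.symm⟩, fun ⟨y, hy⟩ => ⟨y, hy.symm⟩⟩
  rw [← h.card_residue]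
  exact (Nat.card_congr (((Submodule.quotEquivOfEq _ _ hk).trans f.quotKerEquivRange).trans
    (LinearEquiv.ofEq _ _ hr)).toEquiv).symm

theorem card_span (h : IsChain R π r q) {i : ℕ} (hi : i ≤ r) :
    Nat.card (Ideal.span {π ^ i}) = q ^ (r - i) := by
  have := h.finite
  induction hk : r - i generalizing i with
  | zero =>
    obtain rfl : i = r := by omega
    rw [h.pow_eq, Ideal.span_singleton_eq_bot.2 rfl, pow_zero]
    exact Nat.card_unique
  | succ k ih =>
    -- multiplication by `π` maps the `i`-th power onto the next one
    let f : Ideal.span {π ^ i} →+ Ideal.span {π ^ (i + 1)} :=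
      { toFun := fun x => ⟨π * x, by
          rw [Ideal.mem_span_singleton, pow_succ']
          exact mul_dvd_mul_left π (Ideal.mem_span_singleton.1 x.2)⟩
        map_zero' := by ext; simp
        map_add' := fun x y => by ext; simp [mul_add] }
    have hf : Function.Surjective f := by
      rintro ⟨x, hx⟩
      obtain ⟨y, rfl⟩ := Ideal.mem_span_singleton.1 hx
      exact ⟨⟨π ^ i * y, Ideal.mem_span_singleton.2 ⟨y, rfl⟩⟩, Subtype.ext (by
        change π * (π ^ i * y) = _; ring)⟩
    have h1 := card_subtype_comp f hf (fun _ => True)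
    have h2 : Nat.card f.ker = q := by
      rw [← h.card_span_pred]
      refine Nat.card_congr
        { toFun := fun x => ⟨x.1.1, ?_⟩
          invFun := fun x => ⟨⟨x.1, ?_⟩, ?_⟩
          left_inv := fun x => rfl
          right_inv := fun x => rfl }
      · have : π ^ 1 * (x.1 : R) = 0 := by
          rw [pow_one]; exact congrArg Subtype.val (AddMonoidHom.mem_ker.1 x.2)
        rw [h.mul_eq_zero_iff h.pos] at this
        exact Ideal.mem_span_singleton.2 this
      · exact Ideal.mem_span_singleton.2
          ((pow_dvd_pow π (by omega)).trans (Ideal.mem_span_singleton.1 x.2))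
      · have : π ^ 1 * (x.1 : R) = 0 := by
          rw [h.mul_eq_zero_iff h.pos]
          exact Ideal.mem_span_singleton.1 x.2
        rw [pow_one] at this
        exact AddMonoidHom.mem_ker.2 (Subtype.ext this)
    rw [h2, Nat.card_congr (Equiv.subtypeUnivEquiv (fun _ => trivial)),
      Nat.card_congr (Equiv.subtypeUnivEquiv (fun _ => trivial)),
      ih (i := i + 1) (by omega) (by omega)] at h1
    rw [h1, pow_succ']

theorem card_eq (h : IsChain R π r q) : Nat.card R = q ^ r := by
  have := h.card_span (Nat.zero_le r)
  rw [pow_zero, Ideal.span_singleton_one, Nat.sub_zero] at this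
  rw [← this]
  exact (Nat.card_congr (Equiv.subtypeUnivEquiv (fun _ => trivial))).symm

variable {ψ : AddChar R ℂ}

theorem eq_zero_of_psi (h : IsChain R π r q) (hψ : ∃ x ∈ Ideal.span {π ^ (r - 1)}, ψ x ≠ 1)
    {c : R} (hc : ∀ x, ψ (c * x) = 1) : c = 0 := by
  by_contra h0
  obtain ⟨i, hi, u, rfl⟩ := h.exists_eq_pow_mul h0
  obtain ⟨x, hx, hx1⟩ := hψ
  obtain ⟨y, rfl⟩ := Ideal.mem_span_singleton.1 hx
  refine hx1 ?_
  rw [← hc (((u⁻¹ : Rˣ) : R) * π ^ (r - 1 - i) * y)]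
  congr 1
  have : π ^ (r - 1) = π ^ i * π ^ (r - 1 - i) := by rw [← pow_add]; congr 1; omega
  rw [this]
  linear_combination (-(π ^ i * π ^ (r - 1 - i) * y)) * u.mul_inv

theorem exists_addChar_eq (h : IsChain R π r q) (hψ : ∃ x ∈ Ideal.span {π ^ (r - 1)}, ψ x ≠ 1)
    (φ : AddChar R ℂ) : ∃ c, ∀ x, φ x = ψ (c * x) := by
  classical
  have := h.finite
  have := Fintype.ofFinite R
  let F : R → AddChar R ℂ := fun c => ψ.mulShift c
  have hF : Function.Injective F := by
    intro c d hcd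
    rw [← sub_eq_zero]
    refine h.eq_zero_of_psi hψ fun x => ?_
    have h1 : ψ (c * x) = ψ (d * x) := DFunLike.congr_fun hcd x
    rw [sub_mul, AddChar.map_sub_eq_div, h1, div_self]
    exact (AddChar.val_isUnit ψ _).ne_zero
  obtain ⟨c, hc⟩ := ((Fintype.bijective_iff_injective_and_card F).2
    ⟨hF, (AddChar.card_eq).symm⟩).2 φ
  exact ⟨c, fun x => by rw [← hc]; rfl⟩

/-- Additive characters which are trivial on the `j`-th power of the maximal ideal. -/
theorem exists_addChar_eq_pow (h : IsChain R π r q)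
    (hψ : ∃ x ∈ Ideal.span {π ^ (r - 1)}, ψ x ≠ 1) {j : ℕ} (hj : j ≤ r) (φ : AddChar R ℂ)
    (hφ : ∀ x, φ (π ^ j * x) = 1) : ∃ a, ∀ x, φ x = ψ (π ^ (r - j) * (a * x)) := by
  obtain ⟨c, hc⟩ := h.exists_addChar_eq hψ φ
  have h1 : π ^ j * c = 0 := h.eq_zero_of_psi hψ fun x => by
    rw [← hφ x, hc]; congr 1; ring
  obtain ⟨a, rfl⟩ := (h.mul_eq_zero_iff hj).1 h1
  exact ⟨a, fun x => by rw [hc, mul_assoc]⟩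

end IsChain

/-- Hensel's lemma for quadratic polynomials over a ring in which `π` is nilpotent. -/
theorem exists_root_of_dvd {S : Type*} [CommRing S] {π : S} {r : ℕ} (hπ : π ^ r = 0) {x s n : S}
    (hx : π ∣ x ^ 2 - s * x + n) (hu : IsUnit (2 * x - s)) :
    ∃ y, IsNilpotent (x - y) ∧ y ^ 2 - s * y + n = 0 := by
  let P : Polynomial S := Polynomial.X ^ 2 - Polynomial.C s * Polynomial.X + Polynomial.C n
  have hP : ∀ y, Polynomial.aeval y P = y ^ 2 - s * y + n := fun y => by simp [P]
  have hP' : Polynomial.aeval x (Polynomial.derivative P) = 2 * x - s := by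
    simp [P, one_add_one_eq_two]
  obtain ⟨y, ⟨hy, hy'⟩, -⟩ := Polynomial.existsUnique_nilpotent_sub_and_aeval_eq_zero
    (P := P) (x := x) (by
      obtain ⟨z, hz⟩ := hx
      exact ⟨r, by rw [hP, hz, mul_pow, hπ, zero_mul]⟩) (by rwa [hP'])
  exact ⟨y, hy, by rwa [← hP]⟩

end Chain

/-! ### Congruence subgroups of square zero and their characters -/

section Congruence

variable {R : Type*} [CommRing R]

/-- The element `1 + a X` of the congruence subgroup of an element `a` of square zero. -/
def oneAdd {a : R} (ha : a * a = 0) (X : Matrix (Fin 2) (Fin 2) R) : GL (Fin 2) R where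
  val := 1 + a • X
  inv := 1 - a • X
  val_inv := by
    rw [mul_sub, mul_one, add_mul, one_mul, Matrix.smul_mul, Matrix.mul_smul, smul_smul, ha,
      zero_smul]
    abel
  inv_val := by
    rw [mul_add, mul_one, sub_mul, one_mul, Matrix.smul_mul, Matrix.mul_smul, smul_smul, ha,
      zero_smul]
    abel

theorem coe_oneAdd {a : R} (ha : a * a = 0) (X : Matrix (Fin 2) (Fin 2) R) :
    (oneAdd ha X : Matrix (Fin 2) (Fin 2) R) = 1 + a • X := rfl

theorem oneAdd_mem {a : R} (ha : a * a = 0) (X : Matrix (Fin 2) (Fin 2) R) :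
    oneAdd ha X ∈ congr (Ideal.span {a}) := by
  rw [mem_congr]
  intro i j
  rw [coe_oneAdd, add_sub_cancel_left, Matrix.smul_apply, smul_eq_mul, Ideal.mem_span_singleton]
  exact dvd_mul_right a _

theorem exists_eq_oneAdd {a : R} (ha : a * a = 0) {g : GL (Fin 2) R}
    (hg : g ∈ congr (Ideal.span {a})) : ∃ X, g = oneAdd ha X := by
  rw [mem_congr] at hg
  choose X hX using fun i j => Ideal.mem_span_singleton.1 (hg i j)
  refine ⟨Matrix.of X, Units.ext ?_⟩
  rw [coe_oneAdd, ← sub_eq_iff_eq_add']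
  ext i j
  exact hX i j

theorem psiFun_oneAdd {a : R} (ha : a * a = 0) (ψ : AddChar R ℂ)
    (β X : Matrix (Fin 2) (Fin 2) R) : psiFun ψ β (oneAdd ha X) = ψ (a * trace (β * X)) := by
  rw [psiFun, coe_oneAdd, add_sub_cancel_left, Matrix.mul_smul, trace_smul, smul_eq_mul]

theorem congr_comm {I : Ideal R} (hI : I * I = ⊥) :
    ∀ x ∈ congr I, ∀ y ∈ congr I, x * y = y * x := by
  have h0 : ∀ x ∈ congr I, ∀ y ∈ congr I,
      ((x : Matrix (Fin 2) (Fin 2) R) - 1) * ((y : Matrix (Fin 2) (Fin 2) R) - 1) = 0 := by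
    intro x hx y hy
    ext i j
    rw [Matrix.mul_apply, Matrix.zero_apply]
    refine Finset.sum_eq_zero fun m _ => ?_
    have := Ideal.mul_mem_mul (mem_congr.1 hx i m) (mem_congr.1 hy m j)
    rwa [hI, Ideal.mem_bot] at this
  intro x hx y hy
  apply Units.ext
  have h1 := h0 x hx y hy
  have h2 := h0 y hy x hx
  rw [Units.val_mul, Units.val_mul, ← sub_eq_zero]
  calc _ = ((x : Matrix (Fin 2) (Fin 2) R) - 1) * ((y : Matrix (Fin 2) (Fin 2) R) - 1) -
      ((y : Matrix (Fin 2) (Fin 2) R) - 1) * ((x : Matrix (Fin 2) (Fin 2) R) - 1) := by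
        noncomm_ring
    _ = 0 := by rw [h1, h2, sub_zero]

theorem psiFun_conj (ψ : AddChar R ℂ) (β : Matrix (Fin 2) (Fin 2) R) (g n : GL (Fin 2) R) :
    psiFun ψ β (g⁻¹ * n * g) =
      psiFun ψ ((g : Matrix (Fin 2) (Fin 2) R) * β *
        ((g⁻¹ : GL (Fin 2) R) : Matrix (Fin 2) (Fin 2) R)) n := by
  rw [psiFun, psiFun]
  congr 1
  have h2 : ((g⁻¹ * n * g : GL (Fin 2) R) : Matrix (Fin 2) (Fin 2) R) - 1 =
      ((g⁻¹ : GL (Fin 2) R) : Matrix (Fin 2) (Fin 2) R) *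
        ((n : Matrix (Fin 2) (Fin 2) R) - 1) * (g : Matrix (Fin 2) (Fin 2) R) := by
    rw [mul_sub, sub_mul, mul_one, Units.inv_mul, Units.val_mul, Units.val_mul]
  rw [h2, ← mul_assoc, ← mul_assoc, trace_mul_comm, ← mul_assoc, ← mul_assoc]

theorem occurs_iff {I : Ideal R} {ψ : AddChar R ℂ} {β : Matrix (Fin 2) (Fin 2) R}
    {V : Type*} [AddCommGroup V] [Module ℂ V] {ρ : Representation ℂ (GL (Fin 2) R) V} :
    Occurs I ψ β ρ ↔ ∃ v ∈ eig ρ (congr I) (psiFun ψ β), v ≠ 0 :=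
  ⟨fun ⟨v, h0, h⟩ => ⟨v, h, h0⟩, fun ⟨v, h, h0⟩ => ⟨v, h0, h⟩⟩

theorem Occurs.conj {I : Ideal R} {ψ : AddChar R ℂ} {β : Matrix (Fin 2) (Fin 2) R}
    {V : Type*} [AddCommGroup V] [Module ℂ V] {ρ : Representation ℂ (GL (Fin 2) R) V}
    (h : Occurs I ψ β ρ) (g : GL (Fin 2) R) :
    Occurs I ψ ((g : Matrix (Fin 2) (Fin 2) R) * β *
      ((g⁻¹ : GL (Fin 2) R) : Matrix (Fin 2) (Fin 2) R)) ρ := by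
  obtain ⟨v, h0, h⟩ := h
  refine ⟨ρ g v, fun h' => h0 ?_, fun n hn => ?_⟩
  · rw [← ρ.inv_self_apply g v, h', map_zero]
  · rw [← psiFun_conj]
    exact map_mem_eig ρ (congr I) (psiFun ψ β) g h n hn

theorem Occurs.of_equivalent {I : Ideal R} {ψ : AddChar R ℂ} {β : Matrix (Fin 2) (Fin 2) R}
    {V : Type*} [AddCommGroup V] [Module ℂ V] {ρ : Representation ℂ (GL (Fin 2) R) V}
    {W : Type*} [AddCommGroup W] [Module ℂ W] {ρ' : Representation ℂ (GL (Fin 2) R) W}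
    (h : Occurs I ψ β ρ) (e : Equivalent ρ ρ') : Occurs I ψ β ρ' := by
  obtain ⟨v, h0, h⟩ := h
  obtain ⟨e⟩ := e
  refine ⟨e v, Equivalent.ne_zero e h0, fun n hn => ?_⟩
  rw [← Equivalent.apply, h n hn]
  exact e.toLinearEquiv.map_smul _ _

theorem det_oneAdd {a : R} (ha : a * a = 0) (X : Matrix (Fin 2) (Fin 2) R) :
    ((GeneralLinearGroup.det (oneAdd ha X) : Rˣ) : R) = 1 + a * trace X := by
  rw [GeneralLinearGroup.val_det_apply, coe_oneAdd, det_fin_two, trace_fin_two]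
  simp
  linear_combination (X 0 0 * X 1 1 - X 0 1 * X 1 0) * ha

namespace IsChain

variable {π : R} {r q : ℕ} {ψ : AddChar R ℂ}

theorem pow_mul_pow (h : IsChain R π r q) {j : ℕ} (hj : r ≤ 2 * j) : π ^ j * π ^ j = 0 := by
  rw [← pow_add, show j + j = r + (2 * j - r) by omega, pow_add, h.pow_eq, zero_mul]

theorem dvd_of_psi_trace (h : IsChain R π r q) (hψ : ∃ x ∈ Ideal.span {π ^ (r - 1)}, ψ x ≠ 1)
    {j : ℕ} (hj : j ≤ r) {D : Matrix (Fin 2) (Fin 2) R}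
    (hD : ∀ X, ψ (π ^ j * trace (D * X)) = 1) (i k : Fin 2) : π ^ (r - j) ∣ D i k := by
  rw [← h.mul_eq_zero_iff hj]
  refine h.eq_zero_of_psi hψ fun x => ?_
  rw [← hD (Matrix.single k i x)]
  congr 1
  have : trace (D * Matrix.single k i x) = D i k * x := by
    rw [trace_mul_comm, Matrix.trace_single_mul]
    simp [mul_comm]
  rw [this, mul_assoc]

theorem psiFun_eq_iff (h : IsChain R π r q) (hψ : ∃ x ∈ Ideal.span {π ^ (r - 1)}, ψ x ≠ 1)
    {j : ℕ} (hj : j ≤ r) (hj' : r ≤ 2 * j) {β β' : Matrix (Fin 2) (Fin 2) R} :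
    (∀ n ∈ congr (Ideal.span {π ^ j}), psiFun ψ β n = psiFun ψ β' n) ↔
      ∀ i k, π ^ (r - j) ∣ β i k - β' i k := by
  have ha := h.pow_mul_pow hj'
  have key : ∀ X, psiFun ψ β (oneAdd ha X) =
      ψ (π ^ j * trace ((β - β') * X)) * psiFun ψ β' (oneAdd ha X) := fun X => by
    rw [psiFun_oneAdd, psiFun_oneAdd, ← AddChar.map_add_eq_mul, ← mul_add, sub_mul, trace_sub,
      sub_add_cancel]
  constructor
  · intro H
    refine h.dvd_of_psi_trace hψ hj (D := β - β') fun X => ?_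
    have h1 := key X
    rw [H _ (oneAdd_mem ha X)] at h1
    refine (mul_eq_right₀ ?_).1 h1.symm
    rw [psiFun]
    exact (AddChar.val_isUnit ψ _).ne_zero
  · intro H n hn
    obtain ⟨X, rfl⟩ := exists_eq_oneAdd ha hn
    choose D hD using H
    have h1 : π ^ j * trace ((β - β') * X) = 0 := by
      have : β - β' = π ^ (r - j) • Matrix.of D := by
        ext i k
        exact hD i k
      rw [this, Matrix.smul_mul, trace_smul, smul_eq_mul, ← mul_assoc, ← pow_add,
        Nat.add_sub_cancel' hj, h.pow_eq, zero_mul]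
    rw [key, h1, AddChar.map_zero_eq_one, one_mul]

/-- Every character of the congruence subgroup of `π ^ j`, `r ≤ 2 j`, is of the form `ψ_β`. -/
theorem exists_psiFun_eq (h : IsChain R π r q) (hψ : ∃ x ∈ Ideal.span {π ^ (r - 1)}, ψ x ≠ 1)
    {j : ℕ} (hj : j ≤ r) (hj' : r ≤ 2 * j) (θ : congr (Ideal.span {π ^ j}) →* ℂˣ) :
    ∃ β, ∀ n (hn : n ∈ congr (Ideal.span {π ^ j})), (θ ⟨n, hn⟩ : ℂ) = psiFun ψ β n := by
  have ha := h.pow_mul_pow hj'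
  let Φ : Matrix (Fin 2) (Fin 2) R → ℂ := fun X => (θ ⟨oneAdd ha X, oneAdd_mem ha X⟩ : ℂ)
  have hadd : ∀ X Y, Φ (X + Y) = Φ X * Φ Y := fun X Y => by
    simp only [Φ]
    rw [← Units.val_mul, ← map_mul]
    congr 2
    apply Subtype.ext
    apply Units.ext
    change 1 + π ^ j • (X + Y) = (1 + π ^ j • X) * (1 + π ^ j • Y)
    rw [mul_add, mul_one, add_mul, one_mul, Matrix.smul_mul, Matrix.mul_smul, smul_smul, ha,
      zero_smul, smul_add]
    abel
  have hzero : ∀ X, Φ (π ^ (r - j) • X) = 1 := fun X => by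
    simp only [Φ]
    rw [← Units.val_one, ← map_one θ]
    congr 2
    apply Subtype.ext
    apply Units.ext
    change 1 + π ^ j • (π ^ (r - j) • X) = 1
    rw [smul_smul, ← pow_add, Nat.add_sub_cancel' hj, h.pow_eq, zero_smul, add_zero]
  have hex : ∀ i k : Fin 2, ∃ b, ∀ x, Φ (Matrix.single i k x) = ψ (π ^ j * (b * x)) := fun i k => by
    have h0 : Φ 0 = 1 := by simpa using hzero 0
    obtain ⟨b, hb⟩ := h.exists_addChar_eq_pow hψ (Nat.sub_le r j)
      { toFun := fun x => Φ (Matrix.single i k x)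
        map_zero_eq_one' := by rw [Matrix.single_zero, h0]
        map_add_eq_mul' := fun x y => by rw [Matrix.single_add, hadd] }
      (fun x => by
        change Φ _ = 1
        rw [← smul_eq_mul, ← Matrix.smul_single, hzero])
    refine ⟨b, fun x => ?_⟩
    rw [Nat.sub_sub_self hj] at hb
    exact hb x
  choose b hb using hex
  refine ⟨Matrix.of fun i k => b k i, fun n hn => ?_⟩
  obtain ⟨X, rfl⟩ := exists_eq_oneAdd ha hn
  have h1 : X = Matrix.single 0 0 (X 0 0) + Matrix.single 0 1 (X 0 1) +
      Matrix.single 1 0 (X 1 0) + Matrix.single 1 1 (X 1 1) := by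
    ext i k
    fin_cases i <;> fin_cases k <;> simp
  change Φ X = _
  rw [psiFun_oneAdd, h1, hadd, hadd, hadd, hb, hb, hb, hb, ← AddChar.map_add_eq_mul,
    ← AddChar.map_add_eq_mul, ← AddChar.map_add_eq_mul, ← h1, trace_fin_two]
  congr 1
  simp [Matrix.mul_apply, Fin.sum_univ_two]
  ring

theorem exists_occurs (h : IsChain R π r q) (hψ : ∃ x ∈ Ideal.span {π ^ (r - 1)}, ψ x ≠ 1)
    {j : ℕ} (hj : j ≤ r) (hj' : r ≤ 2 * j) {V : Type*} [AddCommGroup V] [Module ℂ V]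
    [FiniteDimensional ℂ V] {ρ : Representation ℂ (GL (Fin 2) R) V} (hρ : ρ.IsIrreducible) :
    ∃ β, Occurs (Ideal.span {π ^ j}) ψ β ρ := by
  have hI : Ideal.span {π ^ j} * Ideal.span {π ^ j} = ⊥ := by
    rw [Ideal.span_singleton_mul_span_singleton, h.pow_mul_pow hj', Ideal.span_singleton_eq_bot]
  have hnt := hρ.toNontrivial
  have htop : (⊤ : Submodule ℂ V) ≠ ⊥ := fun h => by
    exact top_ne_bot (Subrepresentation.toSubmodule_injective (ρ := ρ) h)
  obtain ⟨v, -, hv0, θ, hθ⟩ := exists_common_eigenvector ρ _ (congr_comm hI) ⊤ htop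
    (fun _ _ _ _ => trivial)
  obtain ⟨β, hβ⟩ := h.exists_psiFun_eq hψ hj hj' θ
  exact ⟨β, v, hv0, fun n hn => by rw [← hβ n hn]; exact hθ ⟨n, hn⟩⟩

theorem occurs_of_dvd (h : IsChain R π r q) (hψ : ∃ x ∈ Ideal.span {π ^ (r - 1)}, ψ x ≠ 1)
    {j : ℕ} (hj : j ≤ r) (hj' : r ≤ 2 * j) {β β' : Matrix (Fin 2) (Fin 2) R} {V : Type*}
    [AddCommGroup V] [Module ℂ V] {ρ : Representation ℂ (GL (Fin 2) R) V}
    (ho : Occurs (Ideal.span {π ^ j}) ψ β ρ) (hd : ∀ i k, π ^ (r - j) ∣ β i k - β' i k) :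
    Occurs (Ideal.span {π ^ j}) ψ β' ρ := by
  obtain ⟨v, hv0, hv⟩ := ho
  exact ⟨v, hv0, fun n hn => by rw [hv n hn, (h.psiFun_eq_iff hψ hj hj').2 hd n hn]⟩

/-- The orbit of the `β` for which `ψ_β` occurs in an irreducible representation. -/
theorem dvd_conj_of_occurs (h : IsChain R π r q)
    (hψ : ∃ x ∈ Ideal.span {π ^ (r - 1)}, ψ x ≠ 1) {j : ℕ} (hj : j ≤ r) (hj' : r ≤ 2 * j)
    {β β' : Matrix (Fin 2) (Fin 2) R} {V : Type*}
    [AddCommGroup V] [Module ℂ V] {ρ : Representation ℂ (GL (Fin 2) R) V} (hρ : ρ.IsIrreducible)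
    (ho : Occurs (Ideal.span {π ^ j}) ψ β ρ) (ho' : Occurs (Ideal.span {π ^ j}) ψ β' ρ) :
    ∃ g : GL (Fin 2) R, ∀ i k, π ^ (r - j) ∣ β' i k -
      ((g : Matrix (Fin 2) (Fin 2) R) * β *
        ((g⁻¹ : GL (Fin 2) R) : Matrix (Fin 2) (Fin 2) R)) i k := by
  have := h.finite
  have hI : Ideal.span {π ^ j} * Ideal.span {π ^ j} = ⊥ := by
    rw [Ideal.span_singleton_mul_span_singleton, h.pow_mul_pow hj', Ideal.span_singleton_eq_bot]
  obtain ⟨v, hv0, hv⟩ := ho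
  obtain ⟨v', hv0', hv'⟩ := ho'
  obtain ⟨g, hg⟩ := isConj_of_mem_eig (congr_comm hI) hρ hv hv' hv0 hv0'
  refine ⟨g, (h.psiFun_eq_iff hψ hj hj').1 fun n hn => ?_⟩
  rw [hg n hn, psiFun_conj]

end IsChain

end Congruence

/-! ### Regular matrices and their stabilizers -/

section Companion

variable {R : Type*} [CommRing R]

theorem dvd_trace_det {d : R} {A B : Matrix (Fin 2) (Fin 2) R} (h : ∀ i k, d ∣ A i k - B i k) :
    d ∣ trace A - trace B ∧ d ∣ det A - det B := by
  rw [trace_fin_two, trace_fin_two, det_fin_two, det_fin_two]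
  constructor
  · have := dvd_add (h 0 0) (h 1 1)
    convert this using 1; ring
  · have := dvd_sub (dvd_add ((h 0 0).mul_right (A 1 1)) ((h 1 1).mul_left (B 0 0)))
      (dvd_add ((h 0 1).mul_right (A 1 0)) ((h 1 0).mul_left (B 0 1)))
    convert this using 1; ring

theorem trace_conj (g : GL (Fin 2) R) (β : Matrix (Fin 2) (Fin 2) R) :
    trace ((g : Matrix (Fin 2) (Fin 2) R) * β *
      ((g⁻¹ : GL (Fin 2) R) : Matrix (Fin 2) (Fin 2) R)) = trace β := by
  rw [trace_mul_comm, ← mul_assoc, Units.inv_mul, one_mul]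

theorem det_conj (g : GL (Fin 2) R) (β : Matrix (Fin 2) (Fin 2) R) :
    det ((g : Matrix (Fin 2) (Fin 2) R) * β *
      ((g⁻¹ : GL (Fin 2) R) : Matrix (Fin 2) (Fin 2) R)) = det β := by
  rw [det_mul_comm, ← mul_assoc, Units.inv_mul, one_mul]

theorem dvd_comm_of_dvd_conj {d : R} (g : GL (Fin 2) R) {β β' : Matrix (Fin 2) (Fin 2) R}
    (h : ∀ i k, d ∣ ((g : Matrix (Fin 2) (Fin 2) R) * β *
      ((g⁻¹ : GL (Fin 2) R) : Matrix (Fin 2) (Fin 2) R)) i k - β' i k) (i k : Fin 2) :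
    d ∣ ((g : Matrix (Fin 2) (Fin 2) R) * β - β' * g) i k := by
  have h1 : (g : Matrix (Fin 2) (Fin 2) R) * β - β' * g =
      ((g : Matrix (Fin 2) (Fin 2) R) * β * ((g⁻¹ : GL (Fin 2) R) : Matrix (Fin 2) (Fin 2) R) -
        β') * g := by
    rw [sub_mul, mul_assoc _ _ (g : Matrix (Fin 2) (Fin 2) R), Units.inv_mul, mul_one]
  rw [h1, Matrix.mul_apply]
  exact Finset.dvd_sum fun m _ => (h i m).mul_right _

theorem trace_companion (Δ s : R) : trace (companion Δ s) = s := by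
  simp [companion, trace_fin_two]

theorem det_companion (Δ s : R) : det (companion Δ s) = Δ := by
  simp [companion, det_fin_two]

theorem dvd_of_dvd_comm_companion {d Δ s : R} {M : Matrix (Fin 2) (Fin 2) R}
    (h : ∀ i k, d ∣ (M * companion Δ s - companion Δ s * M) i k) :
    d ∣ M 1 0 - -Δ * M 0 1 ∧ d ∣ M 1 1 - (M 0 0 + s * M 0 1) := by
  have h0 := h 0 0
  have h1 := h 0 1
  simp [companion, Matrix.mul_apply, Matrix.vecMul, dotProduct, Fin.sum_univ_two] at h0 h1
  constructor
  · rw [← dvd_neg]; convert h0 using 1; ring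
  · rw [← dvd_neg]; convert h1 using 1; ring

theorem commute_companion_iff {Δ s : R} {M : Matrix (Fin 2) (Fin 2) R} :
    Commute (companion Δ s) M ↔ M 1 0 = -Δ * M 0 1 ∧ M 1 1 = M 0 0 + s * M 0 1 := by
  constructor
  · intro h
    have := dvd_of_dvd_comm_companion (d := 0) (Δ := Δ) (s := s) (M := M) (fun i k => by
      rw [h.eq, sub_self]; exact dvd_zero _)
    rwa [zero_dvd_iff, zero_dvd_iff, sub_eq_zero, sub_eq_zero] at this
  · rintro ⟨h0, h1⟩
    ext i k
    fin_cases i <;> fin_cases k <;>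
      simp [companion, Matrix.mul_apply, Fin.sum_univ_two, h0, h1] <;> ring

theorem mem_unitsAdjoin_iff {Δ s : R} {g : GL (Fin 2) R} :
    g ∈ unitsAdjoin (companion Δ s) ↔ Commute (companion Δ s) (g : Matrix (Fin 2) (Fin 2) R) := by
  refine ⟨commute_of_mem, fun h => ?_⟩
  have key : ∀ M : Matrix (Fin 2) (Fin 2) R, Commute (companion Δ s) M →
      M ∈ Algebra.adjoin R {companion Δ s} := by
    intro M hM
    obtain ⟨h0, h1⟩ := commute_companion_iff.1 hM
    have : M = algebraMap R _ (M 0 0) + M 0 1 • companion Δ s := by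
      ext i k
      fin_cases i <;> fin_cases k <;>
        simp [companion, Matrix.algebraMap_matrix_apply, h0, h1] <;> ring
    rw [this]
    exact add_mem (Subalgebra.algebraMap_mem _ _)
      (Subalgebra.smul_mem _ (Algebra.subset_adjoin (Set.mem_singleton _)) _)
  refine (Submonoid.mem_units_iff _ _).2 ⟨key _ h, key _ ?_⟩
  exact h.units_inv_right

theorem unitsAdjoin_comm (β : Matrix (Fin 2) (Fin 2) R) :
    ∀ x ∈ unitsAdjoin β, ∀ y ∈ unitsAdjoin β, x * y = y * x := by
  intro x hx y hy
  apply Units.ext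
  refine Algebra.adjoin_induction (p := fun z _ => (x : Matrix (Fin 2) (Fin 2) R) * z = z * x)
    ?_ ?_ ?_ ?_ (coe_mem_adjoin hy)
  · intro z hz
    rw [Set.mem_singleton_iff.1 hz]
    exact (commute_of_mem hx).eq.symm
  · intro a
    exact (Algebra.commutes a _).symm
  · intro a b _ _ ha hb
    rw [mul_add, add_mul, ha, hb]
  · intro a b _ _ ha hb
    rw [← mul_assoc, ha, mul_assoc, hb, mul_assoc]

/-- The matrix `x + y β`, `β = (0 1; -Δ s)`. -/
def quadMat (Δ s x y : R) : Matrix (Fin 2) (Fin 2) R := !![x, y; -Δ * y, x + s * y]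

theorem det_quadMat (Δ s x y : R) :
    det (quadMat Δ s x y) = x ^ 2 + s * x * y + Δ * y ^ 2 := by
  simp [quadMat, det_fin_two]
  ring

theorem commute_quadMat (Δ s x y : R) : Commute (companion Δ s) (quadMat Δ s x y) :=
  commute_companion_iff.2 ⟨by simp [quadMat], by simp [quadMat]⟩

theorem eq_quadMat_of_mem {Δ s : R} {g : GL (Fin 2) R} (hg : g ∈ unitsAdjoin (companion Δ s)) :
    (g : Matrix (Fin 2) (Fin 2) R) = quadMat Δ s (g.1 0 0) (g.1 0 1) := by
  obtain ⟨h0, h1⟩ := commute_companion_iff.1 (mem_unitsAdjoin_iff.1 hg)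
  ext i k
  fin_cases i <;> fin_cases k <;> simp [quadMat, h0, h1]

/-- The unit `x + y β`. -/
def quadUnit {Δ s x y : R} (hu : IsUnit (x ^ 2 + s * x * y + Δ * y ^ 2)) : GL (Fin 2) R :=
  Matrix.nonsingInvUnit (quadMat Δ s x y) (by rwa [det_quadMat])

theorem coe_quadUnit {Δ s x y : R} (hu : IsUnit (x ^ 2 + s * x * y + Δ * y ^ 2)) :
    (quadUnit hu : Matrix (Fin 2) (Fin 2) R) = quadMat Δ s x y := rfl

theorem quadUnit_mem {Δ s x y : R} (hu : IsUnit (x ^ 2 + s * x * y + Δ * y ^ 2)) :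
    quadUnit hu ∈ unitsAdjoin (companion Δ s) :=
  mem_unitsAdjoin_iff.2 (commute_quadMat Δ s x y)

theorem isUnit_det_coe (g : GL (Fin 2) R) : IsUnit (det (g : Matrix (Fin 2) (Fin 2) R)) :=
  (GeneralLinearGroup.det g).isUnit

theorem inv_mul_mem_congr {I : Ideal R} {g h : GL (Fin 2) R} (H : ∀ i k, g.1 i k - h.1 i k ∈ I) :
    h⁻¹ * g ∈ congr I := by
  rw [mem_congr]
  intro i k
  have h1 : ((h⁻¹ * g : GL (Fin 2) R) : Matrix (Fin 2) (Fin 2) R) - 1 =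
      ((h⁻¹ : GL (Fin 2) R) : Matrix (Fin 2) (Fin 2) R) *
        ((g : Matrix (Fin 2) (Fin 2) R) - h) := by
    rw [mul_sub, Units.inv_mul, Units.val_mul]
  rw [h1, Matrix.mul_apply]
  exact I.sum_mem fun m _ => I.mul_mem_left _ (H m k)

/-- A matrix which is not scalar modulo the maximal ideal has a cyclic row vector. -/
theorem exists_conj_companion {M : Matrix (Fin 2) (Fin 2) R}
    (h : ∃ w₀ w₁ : R, IsUnit (w₀ * (w₀ * M 0 1 + w₁ * M 1 1) - w₁ * (w₀ * M 0 0 + w₁ * M 1 0))) :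
    ∃ g : GL (Fin 2) R, (g : Matrix (Fin 2) (Fin 2) R) * M *
      ((g⁻¹ : GL (Fin 2) R) : Matrix (Fin 2) (Fin 2) R) = companion (det M) (trace M) := by
  obtain ⟨w₀, w₁, hw⟩ := h
  -- the rows of the conjugating matrix are `w` and `w M`
  let A : Matrix (Fin 2) (Fin 2) R :=
    !![w₀, w₁; w₀ * M 0 0 + w₁ * M 1 0, w₀ * M 0 1 + w₁ * M 1 1]
  have hA : IsUnit A.det := by rwa [det_fin_two_of]
  refine ⟨Matrix.nonsingInvUnit A hA, ?_⟩
  rw [Units.mul_inv_eq_iff_eq_mul]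
  change A * M = companion (det M) (trace M) * A
  ext i k
  fin_cases i <;> fin_cases k <;>
    simp [A, companion, Matrix.mul_apply, Fin.sum_univ_two, det_fin_two, trace_fin_two] <;> ring

namespace IsChain

variable {π : R} {r q l : ℕ} {ψ : AddChar R ℂ}

theorem isUnit_of_dvd_sub (h : IsChain R π r q) {x y : R} (hx : IsUnit x) (hd : π ∣ x - y) :
    IsUnit y := by
  rw [h.isUnit_iff] at hx ⊢
  exact fun h' => hx ((dvd_sub_left h').1 hd)

/-- A matrix is scalar modulo the maximal ideal or it has a cyclic row vector. -/
theorem exists_cyclic (h : IsChain R π r q) {M : Matrix (Fin 2) (Fin 2) R}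
    (hM : ¬ (π ∣ M 0 1 ∧ π ∣ M 1 0 ∧ π ∣ M 0 0 - M 1 1)) :
    ∃ w₀ w₁ : R, IsUnit (w₀ * (w₀ * M 0 1 + w₁ * M 1 1) - w₁ * (w₀ * M 0 0 + w₁ * M 1 0)) := by
  by_cases h1 : π ∣ M 0 1
  · by_cases h2 : π ∣ M 1 0
    · refine ⟨1, 1, ?_⟩
      rw [h.isUnit_iff]
      intro h3
      refine hM ⟨h1, h2, ?_⟩
      have := dvd_sub (dvd_sub h1 h2) h3
      convert this using 1; ring
    · refine ⟨0, 1, ?_⟩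
      have := (h.isUnit_iff.2 h2).neg
      simpa using this
  · exact ⟨1, 0, by simpa using h.isUnit_iff.2 h1⟩

theorem span_sq (h : IsChain R π r q) (hr : r = 2 * l) :
    Ideal.span {π ^ l} * Ideal.span {π ^ l} = ⊥ := by
  rw [Ideal.span_singleton_mul_span_singleton, h.pow_mul_pow hr.le, Ideal.span_singleton_eq_bot]

theorem dvd_of_stab (h : IsChain R π r q) (hψ : ∃ x ∈ Ideal.span {π ^ (r - 1)}, ψ x ≠ 1)
    (hr : r = 2 * l) {β : Matrix (Fin 2) (Fin 2) R} {g : GL (Fin 2) R}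
    (hg : ∀ n ∈ congr (Ideal.span {π ^ l}), psiFun ψ β (g⁻¹ * n * g) = psiFun ψ β n) (i k : Fin 2) :
    π ^ l ∣ ((g : Matrix (Fin 2) (Fin 2) R) * β - β * g) i k := by
  refine dvd_comm_of_dvd_conj g (fun i k => ?_) i k
  have := (h.psiFun_eq_iff hψ (j := l) (by omega) hr.le (β := (g : Matrix (Fin 2) (Fin 2) R) * β *
    ((g⁻¹ : GL (Fin 2) R) : Matrix (Fin 2) (Fin 2) R)) (β' := β)).1
    (fun n hn => by rw [← psiFun_conj, hg n hn]) i k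
  rwa [show r - l = l by omega] at this

/-- An invertible matrix which commutes with `β` modulo `π ^ l` belongs to `R[β]ˣ K_l`. -/
theorem mem_sup_of_dvd (h : IsChain R π r q) (hl : 0 < l) {Δ s : R} {g : GL (Fin 2) R}
    (hg : π ^ l ∣ g.1 1 0 - -Δ * g.1 0 1 ∧ π ^ l ∣ g.1 1 1 - (g.1 0 0 + s * g.1 0 1)) :
    g ∈ unitsAdjoin (companion Δ s) ⊔ congr (Ideal.span {π ^ l}) := by
  obtain ⟨h0, h1⟩ := hg
  have hd : ∀ i k, π ^ l ∣ g.1 i k - quadMat Δ s (g.1 0 0) (g.1 0 1) i k := by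
    intro i k
    fin_cases i <;> fin_cases k
    · simp [quadMat]
    · simp [quadMat]
    · exact h0
    · exact h1
  have hu := h.isUnit_of_dvd_sub (isUnit_det_coe g)
    ((dvd_pow_self π hl.ne').trans (dvd_trace_det hd).2)
  rw [det_quadMat] at hu
  have hm := inv_mul_mem_congr (I := Ideal.span {π ^ l}) (g := g) (h := quadUnit hu)
    (fun i k => Ideal.mem_span_singleton.2 (hd i k))
  rw [← mul_inv_cancel_left (quadUnit hu) g]
  exact mul_mem (Subgroup.mem_sup_left (quadUnit_mem hu)) (Subgroup.mem_sup_right hm)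

theorem isInertia_companion (h : IsChain R π r q)
    (hψ : ∃ x ∈ Ideal.span {π ^ (r - 1)}, ψ x ≠ 1) (hr : r = 2 * l) (hl : 0 < l) (Δ s : R) :
    IsInertia (congr (Ideal.span {π ^ l}))
      (unitsAdjoin (companion Δ s) ⊔ congr (Ideal.span {π ^ l})) (psiFun ψ (companion Δ s)) where
  comm := congr_comm (h.span_sq hr)
  le := le_sup_right
  stab _ hg := h.mem_sup_of_dvd hl (dvd_of_dvd_comm_companion (h.dvd_of_stab hψ hr hg))

theorem isInertia_diag (h : IsChain R π r q)
    (hψ : ∃ x ∈ Ideal.span {π ^ (r - 1)}, ψ x ≠ 1) (hr : r = 2 * l) {a d : R}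
    (hu : IsUnit (a - d)) :
    IsInertia (congr (Ideal.span {π ^ l})) (diagMod (Ideal.span {π ^ l}))
      (psiFun ψ !![a, 0; 0, d]) where
  comm := congr_comm (h.span_sq hr)
  le _ hg := by
    have := mem_congr.1 hg
    exact ⟨by simpa using this 0 1, by simpa using this 1 0⟩
  stab g hg := by
    have h1 := h.dvd_of_stab hψ hr hg
    have h01 := h1 0 1
    have h10 := h1 1 0
    simp [Matrix.mul_apply, Matrix.vecMul, dotProduct, Fin.sum_univ_two] at h01 h10
    constructor
    · rw [Ideal.mem_span_singleton, ← hu.dvd_mul_right, ← dvd_neg]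
      convert h01 using 1; ring
    · rw [Ideal.mem_span_singleton, ← hu.dvd_mul_right]
      convert h10 using 1; ring

end IsChain

/-! ### The representations induced from the stabilizers -/

variable {I : Ideal R} (hI : I * I = ⊥) {ψ : AddChar R ℂ}

theorem coe_psiHom (β : Matrix (Fin 2) (Fin 2) R) (n : congr I) :
    (psiHom hI ψ β n : ℂ) = psiFun ψ β n := rfl

theorem thetaPsi_apply {β : Matrix (Fin 2) (Fin 2) R} {θ : unitsAdjoin β →* ℂˣ}
    (hθ : Agrees hI ψ β θ) (g : (unitsAdjoin β ⊔ congr I : Subgroup (GL (Fin 2) R)))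
    (s : unitsAdjoin β) (x : congr I) (h : (s : GL (Fin 2) R) * x = g) :
    thetaPsi hI ψ β θ hθ g = θ s * psiHom hI ψ β x :=
  glue_apply _ _ _ _ _ _ g s x h

theorem extends_thetaPsi {β : Matrix (Fin 2) (Fin 2) R} {θ : unitsAdjoin β →* ℂˣ}
    (hθ : Agrees hI ψ β θ) :
    Extends (congr I) (unitsAdjoin β ⊔ congr I) (psiFun ψ β) (thetaPsi hI ψ β θ hθ) := by
  intro n hn hT
  rw [thetaPsi_apply hI hθ _ 1 ⟨n, hn⟩ (one_mul _), map_one, one_mul, coe_psiHom]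

section Eigen

variable {V : Type*} [AddCommGroup V] [Module ℂ V] {ρ : Representation ℂ (GL (Fin 2) R) V}

theorem thetaPsi_eigen {β : Matrix (Fin 2) (Fin 2) R} {θ : unitsAdjoin β →* ℂˣ}
    (hθ : Agrees hI ψ β θ) {v : V} :
    (∀ t : (unitsAdjoin β ⊔ congr I : Subgroup (GL (Fin 2) R)),
      ρ t v = (thetaPsi hI ψ β θ hθ t : ℂ) • v) ↔
    v ∈ eig ρ (congr I) (psiFun ψ β) ∧ ∀ s : unitsAdjoin β, ρ s v = (θ s : ℂ) • v := by
  constructor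
  · intro h
    refine ⟨(extends_thetaPsi hI hθ).mem_eig le_sup_right h, fun s => ?_⟩
    rw [h ⟨s, Subgroup.mem_sup_left s.2⟩, thetaPsi_apply hI hθ _ s 1 (mul_one _), map_one, mul_one]
  · rintro ⟨h1, h2⟩ t
    obtain ⟨s, hs, x, hx, h⟩ := Subgroup.mem_sup_of_normal_right.1 t.2
    rw [thetaPsi_apply hI hθ t ⟨s, hs⟩ ⟨x, hx⟩ h, ← h, map_mul, Module.End.mul_apply, h1 x hx,
      map_smul, h2 ⟨s, hs⟩, smul_smul, mul_comm, Units.val_mul, coe_psiHom]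

theorem agrees_of_eigen {β : Matrix (Fin 2) (Fin 2) R} {θ : unitsAdjoin β →* ℂˣ} {v : V}
    (hv0 : v ≠ 0) (hv : v ∈ eig ρ (congr I) (psiFun ψ β))
    (h : ∀ s : unitsAdjoin β, ρ s v = (θ s : ℂ) • v) : Agrees hI ψ β θ := by
  intro g hS hK
  apply Units.ext
  refine smul_left_injective ℂ hv0 ?_
  change (θ ⟨g, hS⟩ : ℂ) • v = psiFun ψ β g • v
  rw [← hv g hK, ← h ⟨g, hS⟩]

theorem psiFun_conj_of_mem {β : Matrix (Fin 2) (Fin 2) R} {s : GL (Fin 2) R}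
    (hs : s ∈ unitsAdjoin β) (n : GL (Fin 2) R) : psiFun ψ β (s⁻¹ * n * s) = psiFun ψ β n := by
  rw [psiFun_conj, ← (commute_of_mem hs).eq, mul_assoc, Units.mul_inv, mul_one]

end Eigen

namespace IsChain

variable {π : R} {r q l : ℕ} {V : Type*} [AddCommGroup V] [Module ℂ V]
  {ρ : Representation ℂ (GL (Fin 2) R) V}

theorem isIrreducible_piRep (h : IsChain R π r q)
    (hψ : ∃ x ∈ Ideal.span {π ^ (r - 1)}, ψ x ≠ 1) (hr : r = 2 * l) (hl : 0 < l) {Δ s : R}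
    (hI : Ideal.span {π ^ l} * Ideal.span {π ^ l} = ⊥)
    {θ : unitsAdjoin (companion Δ s) →* ℂˣ} (hθ : Agrees hI ψ (companion Δ s) θ) :
    (piRep hI ψ (companion Δ s) θ hθ).IsIrreducible := by
  have := h.finite
  exact isIrreducible_indChar (h.isInertia_companion hψ hr hl Δ s) (extends_thetaPsi hI hθ)

theorem equivalent_piRep (h : IsChain R π r q)
    (hψ : ∃ x ∈ Ideal.span {π ^ (r - 1)}, ψ x ≠ 1) (hr : r = 2 * l) (hl : 0 < l) {Δ s : R}
    (hI : Ideal.span {π ^ l} * Ideal.span {π ^ l} = ⊥)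
    {θ : unitsAdjoin (companion Δ s) →* ℂˣ} (hθ : Agrees hI ψ (companion Δ s) θ)
    (hρ : ρ.IsIrreducible) {v : V} (hv0 : v ≠ 0)
    (hv : v ∈ eig ρ (congr (Ideal.span {π ^ l})) (psiFun ψ (companion Δ s)))
    (hv' : ∀ s : unitsAdjoin (companion Δ s), ρ s v = (θ s : ℂ) • v) :
    Equivalent ρ (piRep hI ψ (companion Δ s) θ hθ) := by
  have := h.finite
  exact equivalent_indChar (h.isInertia_companion hψ hr hl Δ s) (extends_thetaPsi hI hθ) hρ hv0
    ((thetaPsi_eigen hI hθ).2 ⟨hv, hv'⟩)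

theorem exists_equivalent_piRep [FiniteDimensional ℂ V] (h : IsChain R π r q)
    (hψ : ∃ x ∈ Ideal.span {π ^ (r - 1)}, ψ x ≠ 1) (hr : r = 2 * l) (hl : 0 < l) {Δ s : R}
    (hI : Ideal.span {π ^ l} * Ideal.span {π ^ l} = ⊥)
    (hρ : ρ.IsIrreducible) (ho : Occurs (Ideal.span {π ^ l}) ψ (companion Δ s) ρ) :
    ∃ θ, ∃ hθ : Agrees hI ψ (companion Δ s) θ,
      Equivalent ρ (piRep hI ψ (companion Δ s) θ hθ) := by
  obtain ⟨v, hv0, hv⟩ := ho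
  obtain ⟨w, hw, hw0, θ, hθ⟩ := exists_eigenvector_sup (unitsAdjoin_comm (companion Δ s))
    (fun s hs n _ => psiFun_conj_of_mem hs n) hv hv0
  have ha := agrees_of_eigen hI hw0 hw hθ
  exact ⟨θ, ha, h.equivalent_piRep hψ hr hl hI ha hρ hw0 hw hθ⟩

theorem occurs_piRep {β : Matrix (Fin 2) (Fin 2) R} (hI : I * I = ⊥)
    {θ : unitsAdjoin β →* ℂˣ} (hθ : Agrees hI ψ β θ) : Occurs I ψ β (piRep hI ψ β θ hθ) :=
  occurs_iff.2 ⟨_, ((thetaPsi_eigen hI hθ).1 (indChar_indGen _ _)).1, indGen_ne_zero _ _⟩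

/-- The character `θ` can be read off from the representation `π(θ, β)`. -/
theorem theta_unique (h : IsChain R π r q)
    (hψ : ∃ x ∈ Ideal.span {π ^ (r - 1)}, ψ x ≠ 1) (hr : r = 2 * l) (hl : 0 < l) {Δ s : R}
    (hI : Ideal.span {π ^ l} * Ideal.span {π ^ l} = ⊥)
    {θ θ' : unitsAdjoin (companion Δ s) →* ℂˣ} (hθ : Agrees hI ψ (companion Δ s) θ)
    (hθ' : Agrees hI ψ (companion Δ s) θ')
    (he : Equivalent (piRep hI ψ (companion Δ s) θ hθ) (piRep hI ψ (companion Δ s) θ' hθ')) :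
    θ = θ' := by
  have := h.finite
  obtain ⟨e⟩ := he.symm
  have hin := h.isInertia_companion hψ hr hl Δ s
  have hv' : ∀ t : (unitsAdjoin (companion Δ s) ⊔ congr (Ideal.span {π ^ l}) : Subgroup _),
      piRep hI ψ (companion Δ s) θ hθ t (e (indGen _ (thetaPsi hI ψ (companion Δ s) θ' hθ'))) =
        (thetaPsi hI ψ (companion Δ s) θ' hθ' t : ℂ) • e (indGen _ _) := fun t => by
    rw [← Equivalent.apply, indChar_indGen]
    exact e.toLinearEquiv.map_smul _ _
  have h1 := extension_unique hin (extends_thetaPsi hI hθ) (extends_thetaPsi hI hθ')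
    (finrank_indChar hin (extends_thetaPsi hI hθ)) (indGen_ne_zero _ _)
    (Equivalent.ne_zero e (indGen_ne_zero _ _)) (indChar_indGen _ _) hv'
  ext x
  have h2 := congrArg (fun Θ => (Θ ⟨x, Subgroup.mem_sup_left x.2⟩ : ℂˣ)) h1
  rw [thetaPsi_apply hI hθ _ x 1 (mul_one _), thetaPsi_apply hI hθ' _ x 1 (mul_one _), map_one,
    mul_one, mul_one] at h2
  rw [h2]

end IsChain

end Companion

/-! ### Quadratic polynomials over a finite field -/

section FiniteField

variable {k : Type*} [Field k]

/-- `X² - s X + Δ` has two distinct roots in `k`. -/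
def SplitType (Δ s : k) : Prop := ∃ x y, x ≠ y ∧ Δ = x * y ∧ s = x + y

/-- `X² - s X + Δ` has a double root in `k`. -/
def DoubleType (Δ s : k) : Prop := ∃ x, Δ = x * x ∧ s = x + x

/-- `X² - s X + Δ` has no root in `k`. -/
def IrredType (Δ s : k) : Prop := ∀ x, x ^ 2 - s * x + Δ ≠ 0

theorem irredType_iff {Δ s : k} : IrredType Δ s ↔ ¬ SplitType Δ s ∧ ¬ DoubleType Δ s := by
  constructor
  · intro h
    refine ⟨fun ⟨x, y, _, h1, h2⟩ => h x ?_, fun ⟨x, h1, h2⟩ => h x ?_⟩ <;> rw [h1, h2] <;> ring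
  · rintro ⟨h1, h2⟩ x hx
    by_cases hd : x = s - x
    · exact h2 ⟨x, by linear_combination hx - x * hd, by linear_combination -hd⟩
    · exact h1 ⟨x, s - x, hd, by linear_combination hx, by ring⟩

theorem not_split_and_double {Δ s : k} : ¬ (SplitType Δ s ∧ DoubleType Δ s) := by
  rintro ⟨⟨x, y, hxy, h1, h2⟩, z, h3, h4⟩
  refine hxy (sub_eq_zero.1 (pow_eq_zero_iff two_ne_zero |>.1
    (show (x - y) ^ 2 = 0 from ?_)))
  linear_combination (x + y + z + z) * (h4 - h2) + 4 * (h1 - h3)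

variable {q : ℕ}

theorem card_ne_zero [Finite k] (hq : Nat.card k = q) : Nat.card {x : k // x ≠ 0} = q - 1 := by
  classical
  have := Fintype.ofFinite k
  rw [Nat.card_eq_fintype_card, Fintype.card_subtype_compl, ← hq, Nat.card_eq_fintype_card]
  simp

/-- The values of `x² + s x y + Δ y²` are the determinants of the elements `x + y β` of `k[β]`,
`β = (0 1; -Δ s)`, so that this and the next two lemmas count the units of `k[β]`. -/
theorem card_form_split [Finite k] (hq : Nat.card k = q) {Δ s : k} (h : SplitType Δ s) :
    Nat.card {p : k × k // p.1 ^ 2 + s * p.1 * p.2 + Δ * p.2 ^ 2 ≠ 0} = (q - 1) * (q - 1) := by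
  obtain ⟨x, y, hxy, rfl, rfl⟩ := h
  have hxy' : x - y ≠ 0 := sub_ne_zero.2 hxy
  have hf : ∀ a b : k, a ^ 2 + (x + y) * a * b + x * y * b ^ 2 = (a + x * b) * (a + y * b) :=
    fun a b => by ring
  let e : {p : k × k // p.1 ^ 2 + (x + y) * p.1 * p.2 + x * y * p.2 ^ 2 ≠ 0} ≃
      {z : k // z ≠ 0} × {z : k // z ≠ 0} :=
    { toFun := fun p => (⟨p.1.1 + x * p.1.2, fun h => p.2 (by rw [hf, h, zero_mul])⟩,
        ⟨p.1.1 + y * p.1.2, fun h => p.2 (by rw [hf, h, mul_zero])⟩)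
      invFun := fun z => ⟨(z.1.1 - x * ((z.1.1 - z.2.1) / (x - y)), (z.1.1 - z.2.1) / (x - y)), by
        rw [hf]
        refine mul_ne_zero ?_ ?_
        · simpa using z.1.2
        · convert z.2.2 using 1
          field_simp
          ring⟩
      left_inv := fun p => by
        apply Subtype.ext
        apply Prod.ext <;> simp only <;> field_simp <;> ring
      right_inv := fun z => by
        apply Prod.ext <;> apply Subtype.ext <;> simp only <;> field_simp <;> ring }
  rw [Nat.card_congr e, Nat.card_prod, card_ne_zero hq]

theorem card_form_double [Finite k] (hq : Nat.card k = q) {Δ s : k} (h : DoubleType Δ s) :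
    Nat.card {p : k × k // p.1 ^ 2 + s * p.1 * p.2 + Δ * p.2 ^ 2 ≠ 0} = (q - 1) * q := by
  obtain ⟨x, rfl, rfl⟩ := h
  have hf : ∀ a b : k, a ^ 2 + (x + x) * a * b + x * x * b ^ 2 = (a + x * b) * (a + x * b) :=
    fun a b => by ring
  let e : {p : k × k // p.1 ^ 2 + (x + x) * p.1 * p.2 + x * x * p.2 ^ 2 ≠ 0} ≃
      {z : k // z ≠ 0} × k :=
    { toFun := fun p => (⟨p.1.1 + x * p.1.2, fun h => p.2 (by rw [hf, h, zero_mul])⟩, p.1.2)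
      invFun := fun z => ⟨(z.1.1 - x * z.2, z.2), by
        rw [hf]
        refine mul_ne_zero ?_ ?_ <;> simpa using z.1.2⟩
      left_inv := fun p => by simp
      right_inv := fun z => by simp }
  rw [Nat.card_congr e, Nat.card_prod, card_ne_zero hq, hq]

theorem card_form_irred [Finite k] (hq : Nat.card k = q) {Δ s : k} (h : IrredType Δ s) :
    Nat.card {p : k × k // p.1 ^ 2 + s * p.1 * p.2 + Δ * p.2 ^ 2 ≠ 0} = q * q - 1 := by
  classical
  have := Fintype.ofFinite k
  have hf : ∀ p : k × k, p.1 ^ 2 + s * p.1 * p.2 + Δ * p.2 ^ 2 ≠ 0 ↔ ¬ p = 0 := by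
    rintro ⟨a, b⟩
    refine not_congr ⟨fun h0 => ?_, fun h0 => by simp [Prod.mk_eq_zero.1 h0]⟩
    simp only at h0
    by_cases hb : b = 0
    · rw [hb] at h0
      have : a = 0 := by simpa using h0
      rw [this, hb]; rfl
    · refine absurd ?_ (h (-a / b))
      field_simp
      linear_combination h0
  rw [Nat.card_congr (Equiv.subtypeEquivRight hf), Nat.card_eq_fintype_card,
    Fintype.card_subtype_compl]
  simp [← hq, Nat.card_eq_fintype_card]

theorem two_mul_card_splitType [Finite k] (hq : Nat.card k = q) :
    2 * Nat.card {p : k × k // SplitType p.1 p.2} = q * (q - 1) := by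
  classical
  have := Fintype.ofFinite k
  let f : {z : Sym2 k // ¬ z.IsDiag} → {p : k × k // SplitType p.1 p.2} := fun z =>
    ⟨(Sym2.lift ⟨fun x y => x * y, mul_comm⟩ z.1, Sym2.lift ⟨fun x y => x + y, add_comm⟩ z.1), by
      obtain ⟨z, hz⟩ := z
      induction z using Sym2.inductionOn with
      | hf x y => exact ⟨x, y, by simpa using hz, rfl, rfl⟩⟩
  have hf : Function.Bijective f := by
    constructor
    · rintro ⟨z, hz⟩ ⟨w, hw⟩ h
      apply Subtype.ext
      induction z using Sym2.inductionOn with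
      | hf x y =>
      induction w using Sym2.inductionOn with
      | hf x' y' =>
      have h1 : x * y = x' * y' := congrArg (fun p => p.1.1) h
      have h2 : x + y = x' + y' := congrArg (fun p => p.1.2) h
      have h3 : (x - x') * (x - y') = 0 := by linear_combination x * h2 - h1
      rw [Sym2.eq_iff]
      rcases mul_eq_zero.1 h3 with h4 | h4
      · left; exact ⟨by linear_combination h4, by linear_combination h2 - h4⟩
      · right; exact ⟨by linear_combination h4, by linear_combination h2 - h4⟩
    · rintro ⟨⟨Δ, s⟩, x, y, hxy, h1, h2⟩
      simp only at h1 h2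
      subst h1 h2
      exact ⟨⟨s(x, y), by simpa using hxy⟩, rfl⟩
  rw [← Nat.card_congr (Equiv.ofBijective f hf), Nat.card_eq_fintype_card,
    Sym2.card_subtype_not_diag, ← hq, Nat.card_eq_fintype_card, Nat.choose_two_right,
    Nat.mul_div_cancel' (Nat.even_mul_pred_self _).two_dvd]

theorem card_doubleType (hq : Nat.card k = q) :
    Nat.card {p : k × k // DoubleType p.1 p.2} = q := by
  rw [← hq]
  refine (Nat.card_congr (Equiv.ofBijective
    (fun x : k => (⟨(x * x, x + x), x, rfl, rfl⟩ : {p : k × k // DoubleType p.1 p.2}))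
    ⟨fun x y h => ?_, ?_⟩)).symm
  · have h1 : x * x = y * y := congrArg (fun p => p.1.1) h
    have h2 : x + x = y + y := congrArg (fun p => p.1.2) h
    refine sub_eq_zero.1 (pow_eq_zero_iff two_ne_zero |>.1 (show (x - y) ^ 2 = 0 from ?_))
    linear_combination y * h2 * (-1) + h1
  · rintro ⟨⟨Δ, s⟩, x, h1, h2⟩
    simp only at h1 h2
    subst h1 h2
    exact ⟨x, rfl⟩

theorem two_mul_card_irredType [Finite k] (hq : Nat.card k = q) :
    2 * Nat.card {p : k × k // IrredType p.1 p.2} = q * (q - 1) := by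
  classical
  have := Fintype.ofFinite k
  have h1 := two_mul_card_splitType hq
  have h2 := card_doubleType hq
  have h3 : Nat.card {p : k × k // IrredType p.1 p.2} +
      (Nat.card {p : k × k // SplitType p.1 p.2} + Nat.card {p : k × k // DoubleType p.1 p.2}) =
      q * q := by
    simp only [Nat.card_eq_fintype_card]
    rw [← Fintype.card_subtype_or_disjoint, ← Fintype.card_congr (Equiv.subtypeEquivRight
      (fun p : k × k => show ¬ IrredType p.1 p.2 ↔ SplitType p.1 p.2 ∨ DoubleType p.1 p.2 by
        rw [irredType_iff]; tauto)), Fintype.card_subtype_compl,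
      Nat.add_sub_cancel' (Fintype.card_subtype_le _), Fintype.card_prod, ← hq,
      Nat.card_eq_fintype_card]
    exact Pi.disjoint_iff.2 fun p => Prop.disjoint_iff.2 not_split_and_double
  have hq0 : 0 < q := by rw [← hq]; exact Nat.card_pos
  obtain ⟨m, rfl⟩ : ∃ m, q = m + 1 := ⟨q - 1, by omega⟩
  simp only [Nat.add_sub_cancel] at *
  nlinarith

end FiniteField

/-! ### Orders of the groups and numbers of extensions -/

section Counting

/-- In finite abelian groups, the size of the preimage of a set under a surjective homomorphism. -/
theorem card_preimage_mul {A B : Type*} [AddCommGroup A] [AddCommGroup B] [Finite A] (f : A →+ B)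
    (hf : Function.Surjective f) (P : B → Prop) :
    Nat.card {a // P (f a)} * Nat.card B = Nat.card A * Nat.card {b // P b} := by
  have h1 := card_subtype_comp f hf P
  have h2 := card_subtype_comp f hf (fun _ => True)
  rw [Nat.card_congr (Equiv.subtypeUnivEquiv (fun _ => trivial)),
    Nat.card_congr (Equiv.subtypeUnivEquiv (fun _ => trivial))] at h2
  rw [h1, h2]
  ring

theorem card_mul_relIndex {G : Type*} [Group G] {H K : Subgroup G} (h : H ≤ K) :
    Nat.card H * H.relIndex K = Nat.card K := by
  rw [← Subgroup.relIndex_bot_left, ← Subgroup.relIndex_bot_left,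
    Subgroup.relIndex_mul_relIndex _ _ _ bot_le h]

theorem card_matrix_two (K : Type*) [Finite K] :
    Nat.card (Matrix (Fin 2) (Fin 2) K) = Nat.card K ^ 4 := by
  change Nat.card (Fin 2 → Fin 2 → K) = _
  rw [Nat.card_fun, Nat.card_fun, Nat.card_fin, ← pow_mul]

/-- The number of extensions of a character from a subgroup of a finite abelian group. -/
theorem card_extensions {S : Type*} [CommGroup S] [Finite S] (H : Subgroup S) (c : H →* ℂˣ) :
    Nat.card {θ : S →* ℂˣ // ∀ x : H, θ x = c x} = H.index := by
  have hne : NeZero (Monoid.exponent S) := ⟨Monoid.exponent_ne_zero_of_finite⟩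
  obtain ⟨θ₀, hθ₀⟩ := MonoidHom.domRestrict_surjective ℂ H c
  have h0 : ∀ x : H, θ₀ x = c x := fun x => DFunLike.congr_fun hθ₀ x
  rw [Subgroup.index, ← CommGroup.card_domRestrictHom_ker ℂ H]
  refine Nat.card_congr
    { toFun := fun θ => ⟨θ₀⁻¹ * θ.1, ?_⟩
      invFun := fun θ => ⟨θ₀ * θ.1, ?_⟩
      left_inv := fun θ => by simp
      right_inv := fun θ => by simp }
  · refine MonoidHom.mem_ker.2 (MonoidHom.ext fun x => ?_)
    change (θ₀ x)⁻¹ * θ.1 x = 1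
    rw [h0, θ.2, inv_mul_cancel]
  · intro x
    have : θ.1 x = 1 := DFunLike.congr_fun (MonoidHom.mem_ker.1 θ.2) x
    rw [MonoidHom.mul_apply, this, mul_one, h0]

variable {R : Type*} [CommRing R] {k : Type*} [Field k]

/-- The homomorphism `f` is the projection onto the residue field of a ring with maximal ideal
generated by `π`. -/
structure IsResidue (π : R) (f : R →+* k) : Prop where
  surjective : Function.Surjective f
  eq_zero_iff : ∀ x, f x = 0 ↔ π ∣ x

namespace IsChain

variable {π : R} {r q l : ℕ} {f : R →+* k}

theorem card_k (h : IsChain R π r q) (hf : IsResidue π f) : Nat.card k = q := by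
  have hk : Ideal.span {π} = RingHom.ker f := by
    ext x
    rw [Ideal.mem_span_singleton, RingHom.mem_ker, hf.eq_zero_iff]
  rw [← h.card_residue, hk]
  exact (Nat.card_congr (RingHom.quotientKerEquivOfSurjective hf.surjective).toEquiv).symm

theorem finite_k (h : IsChain R π r q) (hf : IsResidue π f) : Finite k := by
  have := h.finite
  exact Finite.of_surjective f hf.surjective

theorem one_lt_q (h : IsChain R π r q) (hf : IsResidue π f) : 1 < q := by
  have := h.finite_k hf
  rw [← h.card_k hf]
  exact Finite.one_lt_card

theorem isUnit_iff_ne_zero (h : IsChain R π r q) (hf : IsResidue π f) {x : R} :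
    IsUnit x ↔ f x ≠ 0 := by
  rw [h.isUnit_iff, Ne, hf.eq_zero_iff]

theorem card_GL (h : IsChain R π r q) (hf : IsResidue π f) :
    Nat.card (GL (Fin 2) R) * q ^ 4 = q ^ (4 * r) * ((q ^ 2 - 1) * (q ^ 2 - q)) := by
  classical
  have := h.finite
  have := h.finite_k hf
  have := Fintype.ofFinite k
  let F : Matrix (Fin 2) (Fin 2) R →+ Matrix (Fin 2) (Fin 2) k :=
    (f.mapMatrix : Matrix (Fin 2) (Fin 2) R →+* _)
  have hF : Function.Surjective F := fun M => by
    choose g hg using hf.surjective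
    exact ⟨M.map g, by ext i j; exact hg _⟩
  have e1 : GL (Fin 2) R ≃ {M : Matrix (Fin 2) (Fin 2) R // IsUnit (F M).det} :=
    { toFun := fun g => ⟨g.1, by
        have : (F g.1).det = f g.1.det := (RingHom.map_det f g.1).symm
        rw [this]
        exact (isUnit_det_coe g).map f⟩
      invFun := fun M => Matrix.nonsingInvUnit M.1 (by
        have : (F M.1).det = f M.1.det := (RingHom.map_det f M.1).symm
        rw [h.isUnit_iff_ne_zero hf, ← this]
        exact M.2.ne_zero)
      left_inv := fun g => Units.ext rfl
      right_inv := fun M => rfl }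
  have e2 : GL (Fin 2) k ≃ {M : Matrix (Fin 2) (Fin 2) k // IsUnit M.det} :=
    { toFun := fun g => ⟨g.1, isUnit_det_coe g⟩
      invFun := fun M => Matrix.nonsingInvUnit M.1 M.2
      left_inv := fun g => Units.ext rfl
      right_inv := fun M => rfl }
  have h1 := card_preimage_mul F hF (fun M => IsUnit M.det)
  have h2 := Matrix.card_GL_field (𝔽 := k) 2
  rw [← Nat.card_congr e1, ← Nat.card_congr e2, h2, card_matrix_two, card_matrix_two,
    h.card_eq, h.card_k hf,
    Fin.prod_univ_two, ← Nat.card_eq_fintype_card, h.card_k hf] at h1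
  rw [h1, ← pow_mul, mul_comm r 4]
  simp

variable {Δ s : R} {u : ℕ}

theorem card_unitsAdjoin (h : IsChain R π r q) (hf : IsResidue π f)
    (hu : Nat.card {p : k × k // p.1 ^ 2 + f s * p.1 * p.2 + f Δ * p.2 ^ 2 ≠ 0} = u) :
    Nat.card (unitsAdjoin (companion Δ s)) * q ^ 2 = q ^ (2 * r) * u := by
  have := h.finite
  let F : R × R →+ k × k := (f : R →+ k).prodMap (f : R →+ k)
  have hF : Function.Surjective F := hf.surjective.prodMap hf.surjective
  have hFu : ∀ p : R × R, (F p).1 ^ 2 + f s * (F p).1 * (F p).2 + f Δ * (F p).2 ^ 2 ≠ 0 ↔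
      IsUnit (p.1 ^ 2 + s * p.1 * p.2 + Δ * p.2 ^ 2) := fun p => by
    rw [h.isUnit_iff_ne_zero hf]
    simp [F]
  have e : unitsAdjoin (companion Δ s) ≃ {p : R × R //
      (F p).1 ^ 2 + f s * (F p).1 * (F p).2 + f Δ * (F p).2 ^ 2 ≠ 0} :=
    { toFun := fun g => ⟨(g.1.1 0 0, g.1.1 0 1), by
        rw [hFu, ← det_quadMat, ← eq_quadMat_of_mem g.2]
        exact isUnit_det_coe _⟩
      invFun := fun p => ⟨quadUnit ((hFu p.1).1 p.2), quadUnit_mem _⟩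
      left_inv := fun g => Subtype.ext (Units.ext (eq_quadMat_of_mem g.2).symm)
      right_inv := fun p => by
        apply Subtype.ext
        simp [coe_quadUnit, quadMat] }
  have h1 := card_preimage_mul F hF
    (fun p => p.1 ^ 2 + f s * p.1 * p.2 + f Δ * p.2 ^ 2 ≠ 0)
  rw [← Nat.card_congr e, hu, Nat.card_prod, Nat.card_prod, h.card_eq, h.card_k hf] at h1
  rw [pow_two q, h1, two_mul r, pow_add]

theorem card_unitsAdjoin_inf (h : IsChain R π r q) (hr : r = 2 * l) :
    Nat.card (congr (Ideal.span {π ^ l}) ⊓ unitsAdjoin (companion Δ s) : Subgroup _) = q ^ r := by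
  have := h.finite
  have ha := h.pow_mul_pow (j := l) hr.le
  have hsq : ∀ x ∈ Ideal.span {π ^ l}, ∀ y ∈ Ideal.span {π ^ l}, x * y = 0 := by
    intro x hx y hy
    have := Ideal.mul_mem_mul hx hy
    rwa [h.span_sq hr, Ideal.mem_bot] at this
  have hu : ∀ p : Ideal.span {π ^ l} × Ideal.span {π ^ l}, IsUnit
      ((1 + (p.1 : R)) ^ 2 + s * (1 + p.1) * p.2 + Δ * (p.2 : R) ^ 2) := fun p => by
    have h1 := hsq _ p.1.2 _ p.1.2
    have h2 := hsq _ p.1.2 _ p.2.2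
    have h3 := hsq _ p.2.2 _ p.2.2
    refine IsUnit.of_mul_eq_one (1 - (2 * (p.1 : R) + s * p.2)) ?_
    linear_combination (-3 - 2 * (p.1 : R) - s * p.2) * h1 +
      (-3 * s - 2 * s * p.1 - s ^ 2 * p.2 - 2 * Δ * p.2) * h2 +
      (-s ^ 2 + Δ - Δ * s * p.2) * h3
  have e : (congr (Ideal.span {π ^ l}) ⊓ unitsAdjoin (companion Δ s) : Subgroup _) ≃
      Ideal.span {π ^ l} × Ideal.span {π ^ l} :=
    { toFun := fun g => (⟨g.1.1 0 0 - 1, by simpa using mem_congr.1 g.2.1 0 0⟩,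
        ⟨g.1.1 0 1, by simpa using mem_congr.1 g.2.1 0 1⟩)
      invFun := fun p => ⟨quadUnit (hu p), by
        refine ⟨mem_congr.2 fun i j => ?_, quadUnit_mem _⟩
        rw [coe_quadUnit]
        fin_cases i <;> fin_cases j
        · simp [quadMat]
        · simp [quadMat]
        · simpa [quadMat] using Ideal.mul_mem_left _ _ p.2.2
        · simpa [quadMat, add_sub_right_comm] using
            Ideal.add_mem _ p.1.2 (Ideal.mul_mem_left _ _ p.2.2)⟩
      left_inv := fun g => Subtype.ext (Units.ext (by
        rw [coe_quadUnit, eq_quadMat_of_mem g.2.2]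
        simp [quadMat]))
      right_inv := fun p => by
        apply Prod.ext <;> apply Subtype.ext <;> simp [coe_quadUnit, quadMat] }
  rw [Nat.card_congr e, Nat.card_prod, h.card_span (by omega), ← pow_add]
  congr 1
  omega

theorem card_congr (h : IsChain R π r q) (hr : r = 2 * l) :
    Nat.card (congr (Ideal.span {π ^ l})) = q ^ (2 * r) := by
  have := h.finite
  have ha := h.pow_mul_pow (j := l) hr.le
  have e : congr (Ideal.span {π ^ l}) ≃ (Fin 2 → Fin 2 → Ideal.span {π ^ l}) :=
    { toFun := fun g i j => ⟨(g.1.1 - 1) i j, mem_congr.1 g.2 i j⟩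
      invFun := fun X => ⟨oneAdd ha (Matrix.of fun i j =>
          (Ideal.mem_span_singleton.1 (X i j).2).choose), oneAdd_mem ha _⟩
      left_inv := fun g => by
        apply Subtype.ext
        apply Units.ext
        rw [coe_oneAdd, ← eq_sub_iff_add_eq']
        ext i j
        exact (Ideal.mem_span_singleton.1 (mem_congr.1 g.2 i j)).choose_spec.symm
      right_inv := fun X => by
        funext i j
        apply Subtype.ext
        change ((1 + π ^ l • Matrix.of _ : Matrix (Fin 2) (Fin 2) R) - 1) i j = X i j
        rw [add_sub_cancel_left]
        exact (Ideal.mem_span_singleton.1 (X i j).2).choose_spec.symm }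
  rw [Nat.card_congr e, Nat.card_fun, Nat.card_fun, h.card_span (by omega), Nat.card_fin,
    ← pow_mul, ← pow_mul]
  congr 1
  omega

variable {ψ : AddChar R ℂ}

theorem card_agrees (h : IsChain R π r q) (hI : Ideal.span {π ^ l} * Ideal.span {π ^ l} = ⊥) :
    Nat.card {θ // Agrees hI ψ (companion Δ s) θ} =
      (congr (Ideal.span {π ^ l})).relIndex (unitsAdjoin (companion Δ s)) := by
  have := h.finite
  let S := unitsAdjoin (companion Δ s)
  let _ : CommGroup S :=
    { (inferInstance : Group S) with
      mul_comm := fun x y => Subtype.ext (unitsAdjoin_comm _ x.1 x.2 y.1 y.2) }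
  let H : Subgroup S := (congr (Ideal.span {π ^ l})).subgroupOf S
  let c : H →* ℂˣ := (psiHom hI ψ (companion Δ s)).comp
    { toFun := fun x => ⟨x.1.1, x.2⟩
      map_one' := rfl
      map_mul' := fun _ _ => rfl }
  rw [Subgroup.relIndex, ← card_extensions H c]
  refine Nat.card_congr (Equiv.subtypeEquivRight fun θ => ?_)
  exact ⟨fun hθ x => hθ x.1.1 x.1.2 x.2, fun hθ g hS hK => hθ ⟨⟨g, hS⟩, hK⟩⟩

/-- The number of characters `θ` of `R[β]ˣ` which coincide with `ψ_β`. -/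
theorem card_agrees_mul (h : IsChain R π r q) (hf : IsResidue π f) (hr : r = 2 * l)
    (hI : Ideal.span {π ^ l} * Ideal.span {π ^ l} = ⊥)
    (hu : Nat.card {p : k × k // p.1 ^ 2 + f s * p.1 * p.2 + f Δ * p.2 ^ 2 ≠ 0} = u) :
    Nat.card {θ // Agrees hI ψ (companion Δ s) θ} * q ^ 2 = q ^ r * u := by
  have h2 := h.card_unitsAdjoin hf hu (Δ := Δ) (s := s)
  have h3 := h.card_unitsAdjoin_inf hr (Δ := Δ) (s := s)
  have h4 : Nat.card (congr (Ideal.span {π ^ l}) ⊓ unitsAdjoin (companion Δ s) : Subgroup _) *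
      (congr (Ideal.span {π ^ l})).relIndex (unitsAdjoin (companion Δ s)) =
      Nat.card (unitsAdjoin (companion Δ s)) := by
    rw [← Subgroup.inf_relIndex_right, card_mul_relIndex inf_le_right]
  have hq : 0 < q := (Nat.zero_lt_one.trans (h.one_lt_q hf))
  rw [h.card_agrees hI]
  rw [← h4, h3] at h2
  refine Nat.eq_of_mul_eq_mul_left (pow_pos hq r) ?_
  rw [← mul_assoc, h2, ← mul_assoc, ← pow_add, two_mul]

/-- The index of the stabilizer of `ψ_β`. -/
theorem index_mul (h : IsChain R π r q) (hf : IsResidue π f) (hr : r = 2 * l) (hl : 0 < l)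
    (hu : Nat.card {p : k × k // p.1 ^ 2 + f s * p.1 * p.2 + f Δ * p.2 ^ 2 ≠ 0} = u) :
    (unitsAdjoin (companion Δ s) ⊔ congr (Ideal.span {π ^ l})).index * u =
      q ^ (r - 2) * ((q ^ 2 - 1) * (q ^ 2 - q)) := by
  have := h.finite
  have hI := h.span_sq hr
  have hq : 0 < q := (Nat.zero_lt_one.trans (h.one_lt_q hf))
  let ψ : AddChar R ℂ := 1
  have h1 := h.card_agrees_mul (ψ := ψ) hf hr hI hu
  rw [h.card_agrees hI, ← Subgroup.relIndex_sup_right] at h1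
  have h2 := card_mul_relIndex (le_sup_right : congr (Ideal.span {π ^ l}) ≤
    unitsAdjoin (companion Δ s) ⊔ congr (Ideal.span {π ^ l}))
  have h3 := (unitsAdjoin (companion Δ s) ⊔ congr (Ideal.span {π ^ l})).card_mul_index
  have h4 := h.card_GL hf
  rw [← h3, ← h2, h.card_congr hr] at h4
  obtain ⟨m, rfl⟩ : ∃ m, r = m + 2 := ⟨r - 2, by omega⟩
  rw [Nat.add_sub_cancel]
  refine Nat.eq_of_mul_eq_mul_left (pow_pos hq (2 * (m + 2) + (m + 2) + 2)) ?_
  calc _ = q ^ (2 * (m + 2)) * (q ^ (m + 2) * u) *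
        (unitsAdjoin (companion Δ s) ⊔ congr (Ideal.span {π ^ l})).index * q ^ 2 := by ring
    _ = q ^ (4 * (m + 2)) * ((q ^ 2 - 1) * (q ^ 2 - q)) := by
      rw [← h1, ← h4]; ring
    _ = _ := by ring

end IsChain

end Counting

/-! ### Families of representations with prescribed reduction of the characteristic polynomial -/

section Types

variable {R : Type*} [CommRing R] {k : Type*} [Field k]

/-- The common hypotheses: `R` is a finite chain ring of even length `r = 2 l`, with maximal ideal
generated by `π` and residue map `f : R → k`, and `ψ` is a primitive additive character of `R`. -/
structure IsSetup (π : R) (r l q : ℕ) (ψ : AddChar R ℂ) (f : R →+* k) : Prop where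
  chain : IsChain R π r q
  psi : ∃ x ∈ Ideal.span {π ^ (r - 1)}, ψ x ≠ 1
  even : r = 2 * l
  pos : 0 < l
  residue : IsResidue π f

/-- An irreducible representation contains some `ψ_β` with `β = (0 1; -Δ s)` where the reduction
of `(Δ, s)` satisfies `D`. -/
def OccursType (I : Ideal R) (ψ : AddChar R ℂ) (f : R →+* k) (D : k → k → Prop)
    (V : FDRep ℂ (GL (Fin 2) R)) : Prop :=
  Representation.IsIrreducible V.ρ ∧ ∃ Δ s, D (f Δ) (f s) ∧ Occurs I ψ (companion Δ s) V.ρ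

theorem OccursType.of_equivalent {I : Ideal R} {ψ : AddChar R ℂ} {f : R →+* k} {D : k → k → Prop}
    {V V' : FDRep ℂ (GL (Fin 2) R)} (h : OccursType I ψ f D V) (e : Equivalent V.ρ V'.ρ) :
    OccursType I ψ f D V' := by
  obtain ⟨hV, Δ, s, hD, ho⟩ := h
  exact ⟨e.isIrreducible hV, Δ, s, hD, ho.of_equivalent e⟩

namespace IsSetup

variable {π : R} {r l q : ℕ} {ψ : AddChar R ℂ} {f : R →+* k}

theorem le (h : IsSetup π r l q ψ f) : l ≤ r := by have := h.even; omega

theorem sub_eq (h : IsSetup π r l q ψ f) : r - l = l := by have := h.even; omega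

theorem span_sq (h : IsSetup π r l q ψ f) : Ideal.span {π ^ l} * Ideal.span {π ^ l} = ⊥ :=
  h.chain.span_sq h.even

theorem dvd_of_pow_dvd (h : IsSetup π r l q ψ f) {x : R} (hx : π ^ l ∣ x) : π ∣ x :=
  (dvd_pow_self π h.pos.ne').trans hx

theorem map_eq (h : IsSetup π r l q ψ f) {x y : R} (hx : π ∣ x - y) : f x = f y := by
  rw [← sub_eq_zero, ← map_sub, h.residue.eq_zero_iff]
  exact hx

theorem occurs_of_dvd (h : IsSetup π r l q ψ f) {β β' : Matrix (Fin 2) (Fin 2) R} {V : Type*}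
    [AddCommGroup V] [Module ℂ V] {ρ : Representation ℂ (GL (Fin 2) R) V}
    (ho : Occurs (Ideal.span {π ^ l}) ψ β ρ) (hd : ∀ i j, π ^ l ∣ β i j - β' i j) :
    Occurs (Ideal.span {π ^ l}) ψ β' ρ :=
  h.chain.occurs_of_dvd h.psi h.le h.even.le ho (by rwa [h.sub_eq])

theorem occurs_companion_of_dvd (h : IsSetup π r l q ψ f) {Δ s Δ' s' : R} {V : Type*}
    [AddCommGroup V] [Module ℂ V] {ρ : Representation ℂ (GL (Fin 2) R) V}
    (ho : Occurs (Ideal.span {π ^ l}) ψ (companion Δ s) ρ) (h1 : π ^ l ∣ Δ' - Δ)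
    (h2 : π ^ l ∣ s' - s) : Occurs (Ideal.span {π ^ l}) ψ (companion Δ' s') ρ := by
  refine h.occurs_of_dvd ho fun i j => ?_
  fin_cases i <;> fin_cases j
  · simp [companion]
  · simp [companion]
  · simpa [companion, add_comm, ← sub_eq_add_neg] using h1
  · simpa [companion] using (dvd_sub_comm.1 h2)

/-- The determinant and the trace of `β` modulo `π ^ l` are determined by the representation. -/
theorem dvd_of_occurs (h : IsSetup π r l q ψ f) {β β' : Matrix (Fin 2) (Fin 2) R} {V : Type*}
    [AddCommGroup V] [Module ℂ V] {ρ : Representation ℂ (GL (Fin 2) R) V} (hρ : ρ.IsIrreducible)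
    (ho : Occurs (Ideal.span {π ^ l}) ψ β ρ) (ho' : Occurs (Ideal.span {π ^ l}) ψ β' ρ) :
    π ^ l ∣ trace β' - trace β ∧ π ^ l ∣ det β' - det β := by
  obtain ⟨g, hg⟩ := h.chain.dvd_conj_of_occurs h.psi h.le h.even.le hρ ho ho'
  rw [h.sub_eq] at hg
  have := dvd_trace_det hg
  rwa [trace_conj, det_conj] at this

theorem occurs_companion_iff (h : IsSetup π r l q ψ f) {M : Matrix (Fin 2) (Fin 2) R} {V : Type*}
    [AddCommGroup V] [Module ℂ V] {ρ : Representation ℂ (GL (Fin 2) R) V}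
    (hM : ¬ (π ∣ M 0 1 ∧ π ∣ M 1 0 ∧ π ∣ M 0 0 - M 1 1)) :
    Occurs (Ideal.span {π ^ l}) ψ (companion (det M) (trace M)) ρ ↔
      Occurs (Ideal.span {π ^ l}) ψ M ρ := by
  obtain ⟨g, hg⟩ := exists_conj_companion (h.chain.exists_cyclic hM)
  constructor
  · intro ho
    have := ho.conj g⁻¹
    rw [← hg, inv_inv, ← mul_assoc, ← mul_assoc, Units.inv_mul, one_mul, mul_assoc, Units.inv_mul,
      mul_one] at this
    exact this
  · intro ho
    rw [← hg]
    exact ho.conj g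

theorem finrank_mul (h : IsSetup π r l q ψ f) {D : k → k → Prop} {u : ℕ}
    (hu : ∀ Δ s, D Δ s → Nat.card {p : k × k // p.1 ^ 2 + s * p.1 * p.2 + Δ * p.2 ^ 2 ≠ 0} = u)
    {V : FDRep ℂ (GL (Fin 2) R)} (hV : OccursType (Ideal.span {π ^ l}) ψ f D V) :
    Module.finrank ℂ V * u = q ^ (r - 2) * ((q ^ 2 - 1) * (q ^ 2 - q)) := by
  have := h.chain.finite
  obtain ⟨hρ, Δ, s, hD, ho⟩ := hV
  obtain ⟨θ, hθ, he⟩ := h.chain.exists_equivalent_piRep h.psi h.even h.pos h.span_sq hρ ho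
  have h1 : Module.finrank ℂ V = _ := he.finrank_eq
  rw [h1, finrank_indChar (h.chain.isInertia_companion h.psi h.even h.pos Δ s)
    (extends_thetaPsi h.span_sq hθ), h.chain.index_mul h.residue h.even h.pos (hu _ _ hD)]

theorem card_quotient (h : IsSetup π r l q ψ f) : Nat.card (R ⧸ Ideal.span {π ^ l}) = q ^ l := by
  have h1 := (Ideal.span {π ^ l}).toAddSubgroup.card_eq_card_quotient_mul_card_addSubgroup
  have h2 : Nat.card (Ideal.span {π ^ l}).toAddSubgroup = q ^ l := by
    rw [← h.sub_eq]
    nth_rw 1 [h.sub_eq]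
    exact h.chain.card_span h.le
  rw [h2, h.chain.card_eq, h.even, two_mul, pow_add] at h1
  have hq : 0 < q := Nat.zero_lt_one.trans (h.chain.one_lt_q h.residue)
  exact (Nat.eq_of_mul_eq_mul_right (pow_pos hq l) h1).symm

/-- The irreducible representations containing some `ψ_β`, `β = (0 1; -Δ s)`, are parametrized by
`Δ` and `s` modulo `π ^ l` and by the extensions of `ψ_β` to its stabilizer. -/
theorem numIso_occursType (h : IsSetup π r l q ψ f) {D : k → k → Prop} {u : ℕ}
    (hu : ∀ Δ s, D Δ s → Nat.card {p : k × k // p.1 ^ 2 + s * p.1 * p.2 + Δ * p.2 ^ 2 ≠ 0} = u) :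
    numIso (OccursType (Ideal.span {π ^ l}) ψ f D) * q ^ 4 =
        q ^ (2 * r) * Nat.card {p : k × k // D p.1 p.2} * u ∧
      ((Quotient.mk (isIsomorphicSetoid (FDRep ℂ (GL (Fin 2) R)))) ''
        {V | OccursType (Ideal.span {π ^ l}) ψ f D V}).Finite := by
  classical
  have := h.chain.finite
  have hI := h.span_sq
  have hq : 0 < q := Nat.zero_lt_one.trans (h.chain.one_lt_q h.residue)
  let I : Ideal R := Ideal.span {π ^ l}
  have : Finite (R ⧸ I) := Quotient.finite _
  let g : R ⧸ I →+* k := Ideal.Quotient.lift I f fun a ha => by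
    rw [h.residue.eq_zero_iff]
    exact h.dvd_of_pow_dvd (Ideal.mem_span_singleton.1 ha)
  have hg : ∀ c : R ⧸ I, f c.out = g c := fun c => by
    conv_rhs => rw [← Ideal.Quotient.mk_out c]
    rfl
  let C := {c : (R ⧸ I) × (R ⧸ I) // D (g c.1) (g c.2)}
  let X := Σ c : C, {θ // Agrees hI ψ (companion c.1.1.out c.1.2.out) θ}
  have hfinθ : ∀ c : C, Finite {θ // Agrees hI ψ (companion c.1.1.out c.1.2.out) θ} := fun c => by
    refine Nat.finite_of_card_ne_zero ?_
    rw [h.chain.card_agrees hI]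
    exact Subgroup.index_ne_zero_of_finite
  let Rel : FDRep ℂ (GL (Fin 2) R) → X → Prop := fun V x =>
    Equivalent V.ρ (piRep hI ψ (companion x.1.1.1.out x.1.1.2.out) x.2.1 x.2.2)
  obtain ⟨h1, h2⟩ : numIso (OccursType I ψ f D) = Nat.card X ∧
      ((Quotient.mk (isIsomorphicSetoid (FDRep ℂ (GL (Fin 2) R)))) ''
        {V | OccursType I ψ f D V}).Finite := by
    refine numIso_eq_card Rel ?_ ?_ ?_ ?_ ?_
    · intro V
      constructor
      · rintro ⟨hρ, Δ, s, hD, ho⟩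
        have hout : ∀ x : R, π ^ l ∣ (Ideal.Quotient.mk I x).out - x := fun x => by
          rw [← Ideal.mem_span_singleton, ← Ideal.Quotient.eq, Ideal.Quotient.mk_out]
        have ho' := h.occurs_companion_of_dvd ho (hout Δ) (hout s)
        obtain ⟨θ, hθ, he⟩ := h.chain.exists_equivalent_piRep h.psi h.even h.pos hI hρ ho'
        exact ⟨⟨⟨(Ideal.Quotient.mk I Δ, Ideal.Quotient.mk I s), hD⟩, θ, hθ⟩, he⟩
      · rintro ⟨⟨c, θ, hθ⟩, he⟩
        refine ⟨he.symm.isIrreducible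
          (h.chain.isIrreducible_piRep h.psi h.even h.pos hI hθ), _, _, ?_,
          (IsChain.occurs_piRep hI hθ).of_equivalent he.symm⟩
        rw [hg, hg]
        exact c.2
    · intro V V' x hx hx'
      exact hx.trans hx'.symm
    · intro V V' x hx e
      exact e.symm.trans hx
    · rintro V ⟨c, θ, hθ⟩ ⟨c', θ', hθ'⟩ hx hx'
      have hirr := hx.symm.isIrreducible (h.chain.isIrreducible_piRep h.psi h.even h.pos hI hθ)
      have hd := h.dvd_of_occurs hirr ((IsChain.occurs_piRep hI hθ).of_equivalent hx.symm)
        ((IsChain.occurs_piRep hI hθ').of_equivalent hx'.symm)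
      rw [trace_companion, trace_companion, det_companion, det_companion] at hd
      have hcc : c = c' := by
        apply Subtype.ext
        apply Prod.ext
        · rw [← Ideal.Quotient.mk_out c.1.1, ← Ideal.Quotient.mk_out c'.1.1, eq_comm,
            Ideal.Quotient.eq]
          exact Ideal.mem_span_singleton.2 hd.2
        · rw [← Ideal.Quotient.mk_out c.1.2, ← Ideal.Quotient.mk_out c'.1.2, eq_comm,
            Ideal.Quotient.eq]
          exact Ideal.mem_span_singleton.2 hd.1
      subst hcc
      have := h.chain.theta_unique h.psi h.even h.pos hI hθ hθ' (hx.symm.trans hx')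
      subst this
      rfl
    · rintro ⟨c, θ, hθ⟩
      exact exists_fdRep _
  refine ⟨?_, h2⟩
  have hcard : ∀ c : C, Nat.card {θ // Agrees hI ψ (companion c.1.1.out c.1.2.out) θ} * q ^ 2 =
      q ^ r * u := fun c =>
    h.chain.card_agrees_mul h.residue h.even hI (by rw [hg, hg]; exact hu _ _ c.2)
  have hC : Nat.card C * q ^ 2 = q ^ r * Nat.card {p : k × k // D p.1 p.2} := by
    let F : (R ⧸ I) × (R ⧸ I) →+ k × k := (g : R ⧸ I →+ k).prodMap (g : R ⧸ I →+ k)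
    have hgs : Function.Surjective g := Ideal.Quotient.lift_surjective_of_surjective _ _
      h.residue.surjective
    have := card_preimage_mul F (hgs.prodMap hgs) (fun p => D p.1 p.2)
    rw [Nat.card_prod, Nat.card_prod, h.chain.card_k h.residue, h.card_quotient, ← pow_two q,
      ← pow_add, ← two_mul l, ← h.even] at this
    exact this
  have hX : Nat.card X * q ^ 2 = Nat.card C * (q ^ r * u) := by
    have := Fintype.ofFinite C
    rw [Nat.card_sigma, Finset.sum_mul, Finset.sum_congr rfl (fun c _ => hcard c),
      Finset.sum_const, Finset.card_univ, smul_eq_mul, Nat.card_eq_fintype_card]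
  rw [h1]
  calc Nat.card X * q ^ 4 = Nat.card X * q ^ 2 * q ^ 2 := by ring
    _ = Nat.card C * q ^ 2 * (q ^ r * u) := by rw [hX]; ring
    _ = _ := by rw [hC]; ring

theorem not_occursType_and (h : IsSetup π r l q ψ f) {D D' : k → k → Prop}
    (hD : ∀ Δ s, ¬ (D Δ s ∧ D' Δ s)) (V : FDRep ℂ (GL (Fin 2) R)) :
    ¬ (OccursType (Ideal.span {π ^ l}) ψ f D V ∧ OccursType (Ideal.span {π ^ l}) ψ f D' V) := by
  rintro ⟨⟨hρ, Δ, s, h1, ho⟩, -, Δ', s', h2, ho'⟩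
  have hd := h.dvd_of_occurs hρ ho' ho
  rw [trace_companion, trace_companion, det_companion, det_companion] at hd
  rw [← h.map_eq (h.dvd_of_pow_dvd hd.1), ← h.map_eq (h.dvd_of_pow_dvd hd.2)] at h2
  exact hD _ _ ⟨h1, h2⟩

variable {V : Type*} [AddCommGroup V] [Module ℂ V] {ρ : Representation ℂ (GL (Fin 2) R) V}

theorem exists_split (h : IsSetup π r l q ψ f) {Δ s : R} (hD : SplitType (f Δ) (f s)) :
    ∃ a d, f a ≠ f d ∧ Δ = a * d ∧ s = a + d := by
  obtain ⟨x, y, hxy, h1, h2⟩ := hD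
  obtain ⟨a₀, rfl⟩ := h.residue.surjective x
  obtain ⟨a, ha, ha'⟩ := exists_root_of_dvd h.chain.pow_eq (x := a₀) (s := s) (n := Δ) (by
    rw [← h.residue.eq_zero_iff]
    simp only [map_add, map_sub, map_pow, map_mul, h1, h2]
    ring) (by
    rw [h.chain.isUnit_iff_ne_zero h.residue]
    simp only [map_sub, map_mul, map_ofNat, h2]
    intro h0
    exact hxy (by linear_combination h0))
  have hfa : f a₀ = f a := by
    rw [← sub_eq_zero, ← map_sub]
    exact (ha.map f).eq_zero
  refine ⟨a, s - a, fun h0 => hxy ?_, by linear_combination ha', by ring⟩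
  rw [map_sub, h2, ← hfa] at h0
  linear_combination h0

theorem occurs_split_iff (h : IsSetup π r l q ψ f) :
    (∃ a d, f a ≠ f d ∧ Occurs (Ideal.span {π ^ l}) ψ !![a, 0; 0, d] ρ) ↔
      ∃ Δ s, SplitType (f Δ) (f s) ∧ Occurs (Ideal.span {π ^ l}) ψ (companion Δ s) ρ := by
  have key : ∀ a d, f a ≠ f d → (Occurs (Ideal.span {π ^ l}) ψ (companion (a * d) (a + d)) ρ ↔
      Occurs (Ideal.span {π ^ l}) ψ !![a, 0; 0, d] ρ) := fun a d had => by
    rw [← h.occurs_companion_iff (M := !![a, 0; 0, d])]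
    · simp [det_fin_two, trace_fin_two]
    · rintro ⟨-, -, h3⟩
      exact had (h.map_eq h3)
  constructor
  · rintro ⟨a, d, had, ho⟩
    exact ⟨a * d, a + d, ⟨f a, f d, had, map_mul f a d, map_add f a d⟩, (key a d had).2 ho⟩
  · rintro ⟨Δ, s, hD, ho⟩
    obtain ⟨a, d, had, rfl, rfl⟩ := h.exists_split hD
    exact ⟨a, d, had, (key a d had).1 ho⟩

theorem occurs_double_iff (h : IsSetup π r l q ψ f) :
    (∃ a b c d, π ∣ b ∧ π ∣ c ∧ π ∣ a - d ∧
      Occurs (Ideal.span {π ^ l}) ψ !![a, 1 + b; c, d] ρ) ↔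
      ∃ Δ s, DoubleType (f Δ) (f s) ∧ Occurs (Ideal.span {π ^ l}) ψ (companion Δ s) ρ := by
  have hns : ∀ a b c d, π ∣ b → ¬ (π ∣ (!![a, 1 + b; c, d] : Matrix (Fin 2) (Fin 2) R) 0 1 ∧
      π ∣ (!![a, 1 + b; c, d] : Matrix (Fin 2) (Fin 2) R) 1 0 ∧
      π ∣ (!![a, 1 + b; c, d] : Matrix (Fin 2) (Fin 2) R) 0 0 -
        (!![a, 1 + b; c, d] : Matrix (Fin 2) (Fin 2) R) 1 1) := by
    rintro a b c d hb ⟨h1, -, -⟩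
    exact h.chain.not_dvd_isUnit (h.chain.isUnit_add isUnit_one hb) h1
  constructor
  · rintro ⟨a, b, c, d, hb, hc, had, ho⟩
    refine ⟨_, _, ?_, (h.occurs_companion_iff (hns a b c d hb)).2 ho⟩
    have h1 := (h.residue.eq_zero_iff _).2 hc
    have h2 := h.map_eq had
    refine ⟨f a, ?_, ?_⟩
    · rw [det_fin_two_of, map_sub, map_mul, map_mul, h1, h2, mul_zero, sub_zero]
    · rw [trace_fin_two_of, map_add, h2]
  · rintro ⟨Δ, s, ⟨x, h1, h2⟩, ho⟩
    obtain ⟨x, rfl⟩ := h.residue.surjective x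
    refine ⟨x, 0, x * (s - x) - Δ, s - x, dvd_zero _, ?_, ?_, ?_⟩
    · rw [← h.residue.eq_zero_iff]
      simp only [map_sub, map_mul, h1, h2]
      ring
    · rw [← h.residue.eq_zero_iff]
      simp only [map_sub, h2]
      ring
    · rw [← h.occurs_companion_iff (hns _ _ _ _ (dvd_zero _))]
      rw [det_fin_two_of, trace_fin_two_of]
      convert ho using 2 <;> ring

end IsSetup

end Types

/-! ### Principal split representations -/

section Principal

variable {R : Type*} [CommRing R]

/-- The unit `1 + a x`, where `a² = 0`. -/
def unitOneAdd {a : R} (ha : a * a = 0) (x : R) : Rˣ where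
  val := 1 + a * x
  inv := 1 - a * x
  val_inv := by linear_combination (-x * x) * ha
  inv_val := by linear_combination (-x * x) * ha

theorem coe_unitOneAdd {a : R} (ha : a * a = 0) (x : R) : (unitOneAdd ha x : R) = 1 + a * x := rfl

/-- The diagonal matrices in `GL₂(R)`. -/
def diagHom : Rˣ × Rˣ →* GL (Fin 2) R where
  toFun u := ⟨!![(u.1 : R), 0; 0, u.2], !![((u.1⁻¹ : Rˣ) : R), 0; 0, ((u.2⁻¹ : Rˣ) : R)],
    by simp [Matrix.one_fin_two], by simp [Matrix.one_fin_two]⟩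
  map_one' := Units.ext (by simp [Matrix.one_fin_two])
  map_mul' u v := Units.ext (by simp)

theorem coe_diagHom (u : Rˣ × Rˣ) :
    (diagHom u : Matrix (Fin 2) (Fin 2) R) = !![(u.1 : R), 0; 0, u.2] := rfl

theorem diagHom_mem (I : Ideal R) (u : Rˣ × Rˣ) : diagHom u ∈ diagMod I :=
  ⟨I.zero_mem, I.zero_mem⟩

theorem boxChar_diagHom {I : Ideal R} (hI : I * I = ⊥) (μ μ' : Rˣ →* ℂˣ) (u : Rˣ × Rˣ) :
    boxChar hI μ μ' ⟨diagHom u, diagHom_mem I u⟩ = μ u.1 * μ' u.2 := by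
  have h0 : diagEntry hI 0 ⟨diagHom u, diagHom_mem I u⟩ = u.1 := Units.ext rfl
  have h1 : diagEntry hI 1 ⟨diagHom u, diagHom_mem I u⟩ = u.2 := Units.ext rfl
  rw [boxChar, MonoidHom.mul_apply, MonoidHom.comp_apply, MonoidHom.comp_apply, h0, h1]

theorem boxChar_injective {I : Ideal R} (hI : I * I = ⊥) {μ μ' ν ν' : Rˣ →* ℂˣ}
    (h : boxChar hI μ μ' = boxChar hI ν ν') : μ = ν ∧ μ' = ν' := by
  constructor
  · ext u : 1
    have := boxChar_diagHom hI μ μ' (u, 1)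
    rw [h, boxChar_diagHom] at this
    simpa using this.symm
  · ext u : 1
    have := boxChar_diagHom hI μ μ' (1, u)
    rw [h, boxChar_diagHom] at this
    simpa using this.symm

/-- A matrix which is diagonal modulo `I` is the product of a diagonal matrix and an element of the
congruence subgroup. -/
theorem exists_diagHom_mul {I : Ideal R} (hI : I * I = ⊥) (t : diagMod I) :
    ∃ n ∈ congr I, (t : GL (Fin 2) R) = diagHom (diagEntry hI 0 t, diagEntry hI 1 t) * n := by
  refine ⟨(diagHom (diagEntry hI 0 t, diagEntry hI 1 t))⁻¹ * t, inv_mul_mem_congr fun i j => ?_,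
    by group⟩
  have h0 : (t : GL (Fin 2) R).1 0 0 - diagEntry hI 0 t = 0 := sub_self _
  have h1 : (t : GL (Fin 2) R).1 1 1 - diagEntry hI 1 t = 0 := sub_self _
  obtain ⟨h2, h3⟩ := t.2
  rw [coe_diagHom]
  fin_cases i <;> fin_cases j <;> simp [h0, h1, h2, h3]

/-- The permutation matrix `(0 1; 1 0)`. -/
def swapMat : GL (Fin 2) R :=
  ⟨!![0, 1; 1, 0], !![0, 1; 1, 0], by simp [Matrix.one_fin_two], by simp [Matrix.one_fin_two]⟩

theorem swapMat_conj {I : Ideal R} (hI : I * I = ⊥) (μ μ' : Rˣ →* ℂˣ) (t : diagMod I) :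
    ∃ ht : swapMat⁻¹ * (t : GL (Fin 2) R) * swapMat ∈ diagMod I,
      boxChar hI μ μ' ⟨_, ht⟩ = boxChar hI μ' μ t := by
  have hc : ((swapMat⁻¹ * (t : GL (Fin 2) R) * swapMat : GL (Fin 2) R) : Matrix (Fin 2) (Fin 2) R) =
      !![(t : GL (Fin 2) R).1 1 1, (t : GL (Fin 2) R).1 1 0;
        (t : GL (Fin 2) R).1 0 1, (t : GL (Fin 2) R).1 0 0] := by
    change (!![0, 1; 1, 0] : Matrix (Fin 2) (Fin 2) R) * (t : GL (Fin 2) R).1 * !![0, 1; 1, 0] = _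
    ext i j
    simp only [Matrix.mul_apply, Fin.sum_univ_two]
    fin_cases i <;> fin_cases j <;> simp
  refine ⟨⟨?_, ?_⟩, ?_⟩
  · rw [hc]; exact t.2.2
  · rw [hc]; exact t.2.1
  · rw [boxChar, boxChar, MonoidHom.mul_apply, MonoidHom.mul_apply, mul_comm]
    congr 1
    · refine congrArg μ' (Units.ext ?_)
      change (swapMat⁻¹ * (t : GL (Fin 2) R) * swapMat).1 1 1 = (t : GL (Fin 2) R).1 0 0
      rw [hc]; rfl
    · refine congrArg μ (Units.ext ?_)
      change (swapMat⁻¹ * (t : GL (Fin 2) R) * swapMat).1 0 0 = (t : GL (Fin 2) R).1 1 1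
      rw [hc]; rfl

/-- The character `μ` of `Rˣ` is `1 + π^l x ↦ ψ(π^l a x)` on `1 + π^l R`. -/
def HasShift (π : R) (l : ℕ) (ψ : AddChar R ℂ) (μ : Rˣ →* ℂˣ) (a : R) : Prop :=
  ∀ (x : R) (u : Rˣ), (u : R) = 1 + π ^ l * x → (μ u : ℂ) = ψ (π ^ l * (a * x))

variable {k : Type*} [Field k] {π : R} {r l q : ℕ} {ψ : AddChar R ℂ} {f : R →+* k}

namespace IsSetup

theorem sq_eq (h : IsSetup π r l q ψ f) : π ^ l * π ^ l = 0 := h.chain.pow_mul_pow h.even.le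

theorem exists_hasShift (h : IsSetup π r l q ψ f) (μ : Rˣ →* ℂˣ) : ∃ a, HasShift π l ψ μ a := by
  have ha := h.sq_eq
  let φ : AddChar R ℂ :=
    { toFun := fun x => μ (unitOneAdd ha x)
      map_zero_eq_one' := by
        have : unitOneAdd ha 0 = 1 := Units.ext (by simp [coe_unitOneAdd])
        simp [this]
      map_add_eq_mul' := fun x y => by
        have : unitOneAdd ha (x + y) = unitOneAdd ha x * unitOneAdd ha y := Units.ext (by
          simp only [coe_unitOneAdd, Units.val_mul]
          linear_combination (-x * y) * ha)
        rw [this, map_mul, Units.val_mul] }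
  obtain ⟨a, hφ⟩ := h.chain.exists_addChar_eq_pow h.psi h.le φ (fun x => by
    have : unitOneAdd ha (π ^ l * x) = 1 := Units.ext (by
      simp [coe_unitOneAdd, ← mul_assoc, ha])
    change (μ (unitOneAdd ha (π ^ l * x)) : ℂ) = 1
    rw [this, map_one, Units.val_one])
  refine ⟨a, fun x u hu => ?_⟩
  have hu' : u = unitOneAdd ha x := Units.ext hu
  have := hφ x
  rw [h.sub_eq] at this
  rw [hu', ← this]
  rfl

theorem pow_pred (h : IsSetup π r l q ψ f) : π ^ (r - 1) = π ^ l * π ^ (l - 1) := by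
  have h1 := h.even
  have h2 := h.pos
  rw [← pow_add]
  congr 1
  omega

theorem dvd_of_psi (h : IsSetup π r l q ψ f) {c : R} (hc : ∀ x, ψ (π ^ (r - 1) * (c * x)) = 1) :
    π ∣ c := by
  have h1 : π ^ (r - 1) * c = 0 := h.chain.eq_zero_of_psi h.psi fun x => by
    rw [mul_assoc, hc]
  rwa [h.chain.mul_eq_zero_iff (Nat.sub_le r 1), Nat.sub_sub_self h.chain.pos, pow_one] at h1

theorem psi_eq_one (h : IsSetup π r l q ψ f) {c : R} (hc : π ∣ c) (x : R) :
    ψ (π ^ (r - 1) * (c * x)) = 1 := by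
  have h1 : π ^ (r - 1) * c = 0 := by
    rwa [h.chain.mul_eq_zero_iff (Nat.sub_le r 1), Nat.sub_sub_self h.chain.pos, pow_one]
  rw [← mul_assoc, h1, zero_mul, AddChar.map_zero_eq_one]

/-- Regularity of a pair of characters, in terms of the orbit of the representation. -/
theorem regular_iff (h : IsSetup π r l q ψ f) {μ μ' : Rˣ →* ℂˣ} {a d : R}
    (ha : HasShift π l ψ μ a) (hd : HasShift π l ψ μ' d) :
    (∃ u : Rˣ, (u : R) - 1 ∈ Ideal.span {π ^ (r - 1)} ∧ (μ * μ'⁻¹) u ≠ 1) ↔ f a ≠ f d := by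
  have key : ∀ (x : R) (u : Rˣ), (u : R) = 1 + π ^ (r - 1) * x →
      (((μ * μ'⁻¹) u : ℂˣ) : ℂ) = ψ (π ^ (r - 1) * ((a - d) * x)) := fun x u hu => by
    rw [h.pow_pred, mul_assoc] at hu
    rw [MonoidHom.mul_apply, MonoidHom.inv_apply, Units.val_mul, Units.val_inv_eq_inv_val,
      ha _ u hu, hd _ u hu, ← AddChar.map_neg_eq_inv, ← AddChar.map_add_eq_mul, h.pow_pred]
    congr 1
    ring
  have hiff : f a ≠ f d ↔ ¬ π ∣ a - d := by
    rw [← h.residue.eq_zero_iff, map_sub, sub_eq_zero]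
  rw [hiff]
  constructor
  · rintro ⟨u, hu, hne⟩ hdvd
    obtain ⟨x, hx⟩ := Ideal.mem_span_singleton.1 hu
    refine hne (Units.ext ?_)
    rw [key x u (by rw [← hx]; ring), h.psi_eq_one hdvd, Units.val_one]
  · intro hnd
    by_contra! hall
    refine hnd (h.dvd_of_psi fun x => ?_)
    have h0 : π ^ l * (π ^ (l - 1) * x) = π ^ (r - 1) * x := by rw [h.pow_pred, mul_assoc]
    have hu : (unitOneAdd h.sq_eq (π ^ (l - 1) * x) : R) = 1 + π ^ (r - 1) * x := by
      rw [coe_unitOneAdd, h0]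
    rw [← key x _ hu, hall _ ?_, Units.val_one]
    rw [hu, add_sub_cancel_left]
    exact Ideal.mul_mem_right _ _ (Ideal.mem_span_singleton_self _)

theorem isUnit_sub (h : IsSetup π r l q ψ f) {a d : R} (had : f a ≠ f d) : IsUnit (a - d) := by
  rw [h.chain.isUnit_iff_ne_zero h.residue, map_sub]
  exact sub_ne_zero.2 had

theorem extends_boxChar (h : IsSetup π r l q ψ f)
    (hI : Ideal.span {π ^ l} * Ideal.span {π ^ l} = ⊥) {μ μ' : Rˣ →* ℂˣ} {a d : R}
    (ha : HasShift π l ψ μ a) (hd : HasShift π l ψ μ' d) :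
    Extends (congr (Ideal.span {π ^ l})) (diagMod (Ideal.span {π ^ l})) (psiFun ψ !![a, 0; 0, d])
      (boxChar hI μ μ') := by
  intro n hn hT
  obtain ⟨X, rfl⟩ := exists_eq_oneAdd h.sq_eq hn
  rw [psiFun_oneAdd, boxChar, MonoidHom.mul_apply, Units.val_mul, MonoidHom.comp_apply,
    MonoidHom.comp_apply, ha (X 0 0), hd (X 1 1), ← AddChar.map_add_eq_mul]
  · congr 1
    simp [trace_fin_two, Matrix.vecMul, dotProduct]
    ring
  · change (oneAdd h.sq_eq X : Matrix (Fin 2) (Fin 2) R) 1 1 = _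
    simp [coe_oneAdd]
  · change (oneAdd h.sq_eq X : Matrix (Fin 2) (Fin 2) R) 0 0 = _
    simp [coe_oneAdd]

theorem isIrreducible_principalRep (h : IsSetup π r l q ψ f)
    (hI : Ideal.span {π ^ l} * Ideal.span {π ^ l} = ⊥) {μ μ' : Rˣ →* ℂˣ} {a d : R}
    (ha : HasShift π l ψ μ a) (hd : HasShift π l ψ μ' d) (had : f a ≠ f d) :
    (principalRep hI μ μ').IsIrreducible := by
  have := h.chain.finite
  exact isIrreducible_indChar (h.chain.isInertia_diag h.psi h.even (h.isUnit_sub had))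
    (h.extends_boxChar hI ha hd)

theorem occurs_principalRep (h : IsSetup π r l q ψ f)
    (hI : Ideal.span {π ^ l} * Ideal.span {π ^ l} = ⊥) {μ μ' : Rˣ →* ℂˣ} {a d : R}
    (ha : HasShift π l ψ μ a) (hd : HasShift π l ψ μ' d) (had : f a ≠ f d) :
    Occurs (Ideal.span {π ^ l}) ψ !![a, 0; 0, d] (principalRep hI μ μ') :=
  occurs_iff.2 ⟨_, (h.extends_boxChar hI ha hd).mem_eig
    (h.chain.isInertia_diag h.psi h.even (h.isUnit_sub had)).le
    (indChar_indGen _ _), indGen_ne_zero _ _⟩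

theorem equivalent_principalRep_swap (h : IsSetup π r l q ψ f)
    (hI : Ideal.span {π ^ l} * Ideal.span {π ^ l} = ⊥) {μ μ' : Rˣ →* ℂˣ} {a d : R}
    (ha : HasShift π l ψ μ a) (hd : HasShift π l ψ μ' d) (had : f a ≠ f d) :
    Equivalent (principalRep hI μ μ') (principalRep hI μ' μ) := by
  have := h.chain.finite
  refine equivalent_indChar (h.chain.isInertia_diag h.psi h.even (h.isUnit_sub had.symm))
    (h.extends_boxChar hI hd ha) (h.isIrreducible_principalRep hI ha hd had)
    (v := principalRep hI μ μ' swapMat (indGen _ _)) ?_ ?_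
  · intro h0
    refine indGen_ne_zero (diagMod (Ideal.span {π ^ l})) (boxChar hI μ μ') ?_
    rw [← (principalRep hI μ μ').inv_self_apply swapMat (indGen _ _), h0, map_zero]
  · intro t
    obtain ⟨ht, hb⟩ := swapMat_conj hI μ μ' t
    have h1 := indChar_indGen _ (boxChar hI μ μ') ⟨_, ht⟩
    rw [hb] at h1
    rw [← map_smul, ← h1, ← Module.End.mul_apply, ← Module.End.mul_apply, ← map_mul, ← map_mul]
    congr 2
    group

/-- Every irreducible representation containing `ψ_β` with `β` diagonal, and regular modulo the
maximal ideal, is of the form `Π_{μ,μ'}`. -/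
theorem exists_equivalent_principalRep (h : IsSetup π r l q ψ f)
    (hI : Ideal.span {π ^ l} * Ideal.span {π ^ l} = ⊥) {V : Type*} [AddCommGroup V] [Module ℂ V]
    [FiniteDimensional ℂ V] {ρ : Representation ℂ (GL (Fin 2) R) V} (hρ : ρ.IsIrreducible)
    {a d : R} (had : f a ≠ f d) (ho : Occurs (Ideal.span {π ^ l}) ψ !![a, 0; 0, d] ρ) :
    ∃ μ μ', HasShift π l ψ μ a ∧ HasShift π l ψ μ' d ∧ Equivalent ρ (principalRep hI μ μ') := by
  have := h.chain.finite
  obtain ⟨v, hv, hv0⟩ := occurs_iff.1 ho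
  obtain ⟨w, hw, hw0, θ, hθ⟩ := exists_eigenvector_sup (S := (diagHom (R := R)).range) (by
    rintro _ ⟨x, rfl⟩ _ ⟨y, rfl⟩
    rw [← map_mul, mul_comm, map_mul]) (by
    rintro _ ⟨x, rfl⟩ n -
    rw [psiFun_conj]
    congr 1
    rw [mul_assoc, ← map_inv, coe_diagHom, coe_diagHom]
    ext i j
    fin_cases i <;> fin_cases j <;> simp [Matrix.mul_apply, Fin.sum_univ_two]
    · rw [mul_left_comm]; simp
    · rw [mul_left_comm]; simp) hv hv0
  let θ' : Rˣ × Rˣ →* ℂˣ := θ.comp diagHom.rangeRestrict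
  have hθ' : ∀ u, ρ (diagHom u) w = (θ' u : ℂ) • w := fun u => hθ (diagHom.rangeRestrict u)
  have hone : ∀ (x y : R) (u : Rˣ × Rˣ), (u.1 : R) = 1 + π ^ l * x → (u.2 : R) = 1 + π ^ l * y →
      (θ' u : ℂ) = ψ (π ^ l * (a * x + d * y)) := fun x y u hx hy => by
    have he : diagHom u = oneAdd h.sq_eq !![x, 0; 0, y] := Units.ext (by
      rw [coe_diagHom, coe_oneAdd, hx, hy]
      simp [Matrix.one_fin_two])
    have h1 := hθ' u
    rw [he, hw _ (oneAdd_mem _ _), psiFun_oneAdd] at h1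
    have h2 := smul_left_injective ℂ hw0 h1
    rw [← h2]
    simp [trace_fin_two]
  have ha : HasShift π l ψ (θ'.comp (MonoidHom.inl Rˣ Rˣ)) a := fun x u hu => by
    have := hone x 0 (u, 1) hu (by simp)
    rwa [mul_zero, add_zero] at this
  have hd : HasShift π l ψ (θ'.comp (MonoidHom.inr Rˣ Rˣ)) d := fun x u hu => by
    have := hone 0 x (1, u) (by simp) hu
    rwa [mul_zero, zero_add] at this
  refine ⟨_, _, ha, hd, ?_⟩
  refine equivalent_indChar (h.chain.isInertia_diag h.psi h.even (h.isUnit_sub had))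
    (h.extends_boxChar hI ha hd) hρ hw0 fun t => ?_
  obtain ⟨n, hn, ht⟩ := exists_diagHom_mul hI t
  have hnT : n ∈ diagMod (Ideal.span {π ^ l}) :=
    (h.chain.isInertia_diag h.psi h.even (h.isUnit_sub had)).le hn
  have ht' : t = ⟨diagHom (diagEntry hI 0 t, diagEntry hI 1 t), diagHom_mem _ _⟩ * ⟨n, hnT⟩ :=
    Subtype.ext ht
  have hb : boxChar hI (θ'.comp (MonoidHom.inl Rˣ Rˣ)) (θ'.comp (MonoidHom.inr Rˣ Rˣ)) t =
      θ' (diagEntry hI 0 t, diagEntry hI 1 t) *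
        boxChar hI (θ'.comp (MonoidHom.inl Rˣ Rˣ)) (θ'.comp (MonoidHom.inr Rˣ Rˣ)) ⟨n, hnT⟩ := by
    conv_lhs => rw [ht']
    rw [map_mul, boxChar_diagHom]
    congr 1
    change θ' (_, 1) * θ' (1, _) = _
    rw [← map_mul]
    simp
  rw [hb, Units.val_mul, h.extends_boxChar hI ha hd n hn hnT, ht, map_mul, Module.End.mul_apply,
    hw n hn, map_smul, hθ', smul_smul, mul_comm]

theorem principalRep_injective (h : IsSetup π r l q ψ f)
    (hI : Ideal.span {π ^ l} * Ideal.span {π ^ l} = ⊥) {μ₁ μ₁' μ₂ μ₂' : Rˣ →* ℂˣ} {a₁ d₁ a₂ d₂ : R}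
    (ha₁ : HasShift π l ψ μ₁ a₁) (hd₁ : HasShift π l ψ μ₁' d₁) (had₁ : f a₁ ≠ f d₁)
    (ha₂ : HasShift π l ψ μ₂ a₂) (hd₂ : HasShift π l ψ μ₂' d₂)
    (ha : π ^ l ∣ a₂ - a₁) (hd : π ^ l ∣ d₂ - d₁)
    (e : Equivalent (principalRep hI μ₁ μ₁') (principalRep hI μ₂ μ₂')) :
    μ₁ = μ₂ ∧ μ₁' = μ₂' := by
  have := h.chain.finite
  have hin := h.chain.isInertia_diag h.psi h.even (h.isUnit_sub had₁)
  have hext₁ := h.extends_boxChar hI ha₁ hd₁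
  have hext₂ : Extends (congr (Ideal.span {π ^ l})) (diagMod (Ideal.span {π ^ l}))
      (psiFun ψ !![a₁, 0; 0, d₁]) (boxChar hI μ₂ μ₂') := fun n hn hT => by
    rw [h.extends_boxChar hI ha₂ hd₂ n hn hT]
    refine (h.chain.psiFun_eq_iff h.psi h.le h.even.le).2 (fun i j => ?_) n hn
    rw [h.sub_eq]
    fin_cases i <;> fin_cases j <;> simp [ha, hd]
  obtain ⟨e⟩ := e.symm
  refine boxChar_injective hI (extension_unique hin hext₁ hext₂ (finrank_indChar hin hext₁)
    (indGen_ne_zero _ _) (v' := e (indGen _ _)) (Equivalent.ne_zero e (indGen_ne_zero _ _))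
    (indChar_indGen _ _) fun t => ?_)
  rw [← Equivalent.apply e, indChar_indGen]
  exact e.toLinearEquiv.map_smul _ _

theorem equivalent_principalRep_iff (h : IsSetup π r l q ψ f)
    (hI : Ideal.span {π ^ l} * Ideal.span {π ^ l} = ⊥) {μ₁ μ₁' μ₂ μ₂' : Rˣ →* ℂˣ} {a₁ d₁ a₂ d₂ : R}
    (ha₁ : HasShift π l ψ μ₁ a₁) (hd₁ : HasShift π l ψ μ₁' d₁) (had₁ : f a₁ ≠ f d₁)
    (ha₂ : HasShift π l ψ μ₂ a₂) (hd₂ : HasShift π l ψ μ₂' d₂) (had₂ : f a₂ ≠ f d₂) :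
    Equivalent (principalRep hI μ₁ μ₁') (principalRep hI μ₂ μ₂') ↔
      (μ₁ = μ₂ ∧ μ₁' = μ₂') ∨ (μ₁ = μ₂' ∧ μ₁' = μ₂) := by
  constructor
  · intro e
    obtain ⟨ht, hn⟩ := h.dvd_of_occurs (h.isIrreducible_principalRep hI ha₁ hd₁ had₁)
      (h.occurs_principalRep hI ha₁ hd₁ had₁)
      ((h.occurs_principalRep hI ha₂ hd₂ had₂).of_equivalent e.symm)
    rw [trace_fin_two_of, trace_fin_two_of] at ht
    rw [det_fin_two_of, det_fin_two_of, mul_zero, sub_zero, sub_zero] at hn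
    have hmul : π ^ l ∣ (a₂ - a₁) * (d₂ - a₁) := by
      have := dvd_sub hn (ht.mul_left a₁)
      convert this using 1; ring
    by_cases hu : IsUnit (d₂ - a₁)
    · left
      have h1 : π ^ l ∣ a₂ - a₁ := by
        obtain ⟨u, hu⟩ := hu
        rwa [← hu, Units.dvd_mul_right] at hmul
      refine h.principalRep_injective hI ha₁ hd₁ had₁ ha₂ hd₂ h1 ?_ e
      have := dvd_sub ht h1
      convert this using 1; ring
    · right
      have h0 : IsUnit (a₂ - a₁) := by
        rw [h.chain.isUnit_iff_ne_zero h.residue] at hu ⊢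
        rw [map_sub, ne_eq, not_not, sub_eq_zero] at hu
        rw [map_sub, ← hu]
        exact sub_ne_zero.2 had₂
      have h1 : π ^ l ∣ d₂ - a₁ := by
        obtain ⟨u, hu⟩ := h0
        rw [mul_comm] at hmul
        rwa [← hu, Units.dvd_mul_right] at hmul
      refine h.principalRep_injective hI ha₁ hd₁ had₁ hd₂ ha₂ h1 ?_
        (e.trans (h.equivalent_principalRep_swap hI ha₂ hd₂ had₂))
      have := dvd_sub ht h1
      convert this using 1; ring
  · rintro (⟨rfl, rfl⟩ | ⟨rfl, rfl⟩)
    · exact ⟨Representation.Equiv.refl _⟩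
    · exact h.equivalent_principalRep_swap hI ha₁ hd₁ had₁

end IsSetup

end Principal

/-! ### Quadratic extensions of finite chain rings -/

section QuadExt

/-- Over a quadratic extension of a finite field, every quadratic polynomial has a root. -/
theorem exists_root_of_finrank_eq_two {k K : Type*} [Field k] [Field K] [Algebra k K] [Finite K]
    (hK : Module.finrank k K = 2) (Δ s : k) :
    ∃ x : K, x ^ 2 - algebraMap k K s * x + algebraMap k K Δ = 0 := by
  have : Finite k := Finite.of_injective _ (algebraMap k K).injective
  let P : Polynomial k := Polynomial.X ^ 2 - Polynomial.C s * Polynomial.X + Polynomial.C Δ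
  have hP : P.natDegree = 2 := by simp only [P]; compute_degree!
  by_cases hirr : Irreducible P
  · have : Fact (Irreducible P) := ⟨hirr⟩
    have hfr : Module.finrank k (AdjoinRoot P) = 2 := by
      rw [(AdjoinRoot.powerBasis hirr.ne_zero).finrank, AdjoinRoot.powerBasis_dim, hP]
    have : FiniteDimensional k (AdjoinRoot P) := FiniteDimensional.of_finrank_pos (by omega)
    obtain ⟨φ⟩ := FiniteField.nonempty_algHom_of_finrank_dvd (F := k) (K := AdjoinRoot P) (L := K)
      (by rw [hfr, hK])
    refine ⟨φ (AdjoinRoot.root P), ?_⟩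
    have h0 : Polynomial.aeval (AdjoinRoot.root P) P = 0 := by
      rw [AdjoinRoot.aeval_eq, AdjoinRoot.mk_self]
    have h1 := congrArg φ h0
    rw [map_zero, ← Polynomial.aeval_algHom_apply] at h1
    generalize φ (AdjoinRoot.root P) = x at h1
    simpa [P] using h1
  · have hm : P.Monic := by simp only [P]; monicity!
    rw [hm.irreducible_iff_roots_eq_zero_of_degree_le_three (by omega) (by omega),
      Multiset.eq_zero_iff_forall_notMem] at hirr
    push Not at hirr
    obtain ⟨x, hx⟩ := hirr
    refine ⟨algebraMap k K x, ?_⟩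
    have h0 : x ^ 2 - s * x + Δ = 0 := by simpa [P] using (Polynomial.mem_roots'.1 hx).2
    rw [← map_pow, ← map_mul, ← map_sub, ← map_add, h0, map_zero]

variable {R S : Type*} [CommRing R] [CommRing S]

/-- `ι : R → S` is an unramified quadratic extension, with non-trivial automorphism `σ`, of a chain
ring `R` with maximal ideal `(π)`. -/
structure IsQuadExt (π : R) (ι : R →+* S) (σ : S →+* S) : Prop where
  injective : Function.Injective ι
  map_map : ∀ x, σ (ι x) = ι x
  involutive : ∀ z, σ (σ z) = z
  fixed : ∀ z, σ z = z → ∃ x, ι x = z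
  exists_unit : ∃ ω, IsUnit (ω - σ ω)
  isUnit_or : ∀ z, IsUnit z ∨ ι π ∣ z

namespace IsQuadExt

variable {π : R} {ι : R →+* S} {σ : S →+* S}

theorem exists_trace (e : IsQuadExt π ι σ) (z : S) : ∃ t, ι t = z + σ z :=
  e.fixed _ (by rw [map_add, e.involutive, add_comm])

theorem exists_norm (e : IsQuadExt π ι σ) (z : S) : ∃ n, ι n = z * σ z :=
  e.fixed _ (by rw [map_mul, e.involutive, mul_comm])

theorem dvd_sigma (e : IsQuadExt π ι σ) {x : R} {z : S} (h : ι x ∣ z) : ι x ∣ σ z := by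
  obtain ⟨w, rfl⟩ := h
  rw [map_mul, e.map_map]
  exact dvd_mul_right _ _

theorem exists_basis (e : IsQuadExt π ι σ) {τ : S} (hτ : IsUnit (τ - σ τ)) (z : S) :
    ∃ a b, z = ι a + ι b * τ := by
  obtain ⟨u, hu⟩ := hτ
  have hσu : σ u = -u := by rw [hu, map_sub, e.involutive, neg_sub]
  have hσu' : σ ((u⁻¹ : Sˣ) : S) = -((u⁻¹ : Sˣ) : S) := by
    have h1 : σ u * σ ((u⁻¹ : Sˣ) : S) = 1 := by rw [← map_mul, Units.mul_inv, map_one]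
    rw [hσu] at h1
    have h2 := u.inv_mul
    linear_combination -((u⁻¹ : Sˣ) : S) * h1 - σ ((u⁻¹ : Sˣ) : S) * h2
  obtain ⟨b, hb⟩ := e.fixed ((z - σ z) * ((u⁻¹ : Sˣ) : S)) (by
    rw [map_mul, map_sub, e.involutive, hσu']; ring)
  have hb' : ι b * (τ - σ τ) = z - σ z := by rw [hb, ← hu, mul_assoc, Units.inv_mul, mul_one]
  obtain ⟨a, ha⟩ := e.fixed (z - ι b * τ) (by
    rw [map_sub, map_mul, e.map_map]; linear_combination hb')
  exact ⟨a, b, by rw [ha]; ring⟩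

theorem basis_unique (e : IsQuadExt π ι σ) {τ : S} (hτ : IsUnit (τ - σ τ)) {a b : R}
    (h : ι a + ι b * τ = 0) : a = 0 ∧ b = 0 := by
  have h1 := congrArg σ h
  simp only [map_add, map_mul, e.map_map, map_zero] at h1
  have h2 : (τ - σ τ) * ι b = 0 := by linear_combination h - h1
  have h3 : ι b = 0 := by rwa [hτ.mul_right_eq_zero] at h2
  rw [h3, zero_mul, add_zero] at h
  exact ⟨e.injective (by rw [h, map_zero]), e.injective (by rw [h3, map_zero])⟩

/-- An element of `R` divides `ι a + ι b τ` if and only if it divides `a` and `b`. -/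
theorem dvd_basis (e : IsQuadExt π ι σ) {τ : S} (hτ : IsUnit (τ - σ τ)) {a b c : R}
    (h : ι c ∣ ι a + ι b * τ) : c ∣ a ∧ c ∣ b := by
  obtain ⟨w, hw⟩ := h
  obtain ⟨x, y, rfl⟩ := e.exists_basis hτ w
  have := e.basis_unique hτ (a := a - c * x) (b := b - c * y) (by
    simp only [map_sub, map_mul]; linear_combination hw)
  exact ⟨⟨x, sub_eq_zero.1 this.1⟩, ⟨y, sub_eq_zero.1 this.2⟩⟩

theorem dvd_of_map_dvd (e : IsQuadExt π ι σ) {x y : R} (h : ι x ∣ ι y) : x ∣ y := by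
  obtain ⟨ω, hω⟩ := e.exists_unit
  exact (e.dvd_basis hω (a := y) (b := 0) (by simpa using h)).1

variable {r q : ℕ}

theorem not_dvd_isUnit (e : IsQuadExt π ι σ) (h : IsChain R π r q) {z : S} (hz : IsUnit z) :
    ¬ ι π ∣ z := fun hd => by
  have := e.dvd_of_map_dvd (x := π) (y := 1) (by
    rw [map_one]; exact (isUnit_of_dvd_unit hd hz).dvd)
  exact h.not_isUnit (isUnit_of_dvd_one this)

theorem isUnit_map_iff (e : IsQuadExt π ι σ) (h : IsChain R π r q) {x : R} :
    IsUnit (ι x) ↔ IsUnit x := by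
  refine ⟨fun hx => ?_, fun hx => hx.map ι⟩
  rw [h.isUnit_iff]
  exact fun hd => e.not_dvd_isUnit h hx (_root_.map_dvd ι hd)

theorem isUnit_of_dvd_sub (e : IsQuadExt π ι σ) (h : IsChain R π r q) {z w : S} (hz : IsUnit z)
    (hd : ι π ∣ z - w) : IsUnit w :=
  (e.isUnit_or w).resolve_right fun hw => e.not_dvd_isUnit h hz ((dvd_sub_left hw).1 hd)

theorem pow_mul_eq_zero (e : IsQuadExt π ι σ) (h : IsChain R π r q) {i : ℕ} (hi : i ≤ r) {z : S}
    (hz : ι (π ^ i) * z = 0) : ι (π ^ (r - i)) ∣ z := by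
  obtain ⟨ω, hω⟩ := e.exists_unit
  obtain ⟨a, b, rfl⟩ := e.exists_basis hω z
  have := e.basis_unique hω (a := π ^ i * a) (b := π ^ i * b) (by
    simp only [map_mul]; linear_combination hz)
  rw [h.mul_eq_zero_iff hi, h.mul_eq_zero_iff hi] at this
  exact dvd_add (_root_.map_dvd ι this.1) ((_root_.map_dvd ι this.2).mul_right _)

variable {k : Type*} [Field k] {f : R →+* k}

/-- Every quadratic polynomial over the residue field of `R` has a root in that of `S`. -/
theorem exists_dvd_quadratic (e : IsQuadExt π ι σ) (h : IsChain R π r q) (hf : IsResidue π f)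
    (Δ s : R) : ∃ x, ι π ∣ x ^ 2 - ι s * x + ι Δ := by
  have := h.finite
  have := h.finite_k hf
  obtain ⟨ω, hω⟩ := e.exists_unit
  have hmem : ∀ z : S, z ∈ Ideal.span {ι π} ↔ ι π ∣ z := fun z => Ideal.mem_span_singleton
  have hmax : (Ideal.span {ι π}).IsMaximal := by
    refine Ideal.isMaximal_iff.2 ⟨fun h1 => ?_, fun J x hJ hx hxJ => ?_⟩
    · exact e.not_dvd_isUnit h isUnit_one ((hmem _).1 h1)
    · rw [hmem] at hx
      exact (Ideal.eq_top_iff_one J).1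
        (Ideal.eq_top_of_isUnit_mem J hxJ ((e.isUnit_or x).resolve_right hx))
  let K := S ⧸ Ideal.span {ι π}
  let _ : Field K := Ideal.Quotient.field _
  let mkK : S →+* K := Ideal.Quotient.mk _
  have hmk : ∀ z, mkK z = 0 ↔ ι π ∣ z := fun z => by rw [← hmem, ← Ideal.Quotient.eq_zero_iff_mem]
  let j : k →+* K := (f.liftOfSurjective hf.surjective) ⟨mkK.comp ι, fun x hx => by
    rw [RingHom.mem_ker, hf.eq_zero_iff] at hx
    rw [RingHom.mem_ker, RingHom.comp_apply, hmk]
    exact _root_.map_dvd ι hx⟩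
  have hj : ∀ x, j (f x) = mkK (ι x) := fun x =>
    RingHom.liftOfRightInverse_comp_apply f _ _ _ x
  let _ : Algebra k K := j.toAlgebra
  have hfin : Finite S := by
    refine Finite.of_surjective (fun p : R × R => ι p.1 + ι p.2 * ω) fun z => ?_
    obtain ⟨a, b, rfl⟩ := e.exists_basis hω z
    exact ⟨(a, b), rfl⟩
  have : Finite K := Quotient.finite _
  have hrank : Module.finrank k K = 2 := by
    let b : Fin 2 → K := ![1, mkK ω]
    have hli : LinearIndependent k b := by
      rw [LinearIndependent.pair_iff]
      intro x y hxy
      obtain ⟨x, rfl⟩ := hf.surjective x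
      obtain ⟨y, rfl⟩ := hf.surjective y
      rw [Algebra.smul_def, Algebra.smul_def, RingHom.algebraMap_toAlgebra, hj, hj, mul_one,
        ← map_mul, ← map_add, hmk] at hxy
      exact (e.dvd_basis hω hxy).imp (hf.eq_zero_iff _).2 (hf.eq_zero_iff _).2
    have hsp : ⊤ ≤ Submodule.span k (Set.range b) := by
      intro z _
      obtain ⟨z, rfl⟩ := Ideal.Quotient.mk_surjective z
      obtain ⟨x, y, rfl⟩ := e.exists_basis hω z
      rw [Matrix.range_cons, Matrix.range_cons, Matrix.range_empty, Set.union_empty,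
        Set.singleton_union, Submodule.mem_span_pair]
      refine ⟨f x, f y, ?_⟩
      rw [Algebra.smul_def, Algebra.smul_def, RingHom.algebraMap_toAlgebra, hj, hj, mul_one,
        ← map_mul, ← map_add]
    rw [Module.finrank_eq_card_basis (Module.Basis.mk hli hsp), Fintype.card_fin]
  obtain ⟨x, hx⟩ := exists_root_of_finrank_eq_two hrank (f Δ) (f s)
  obtain ⟨x, rfl⟩ := Ideal.Quotient.mk_surjective x
  refine ⟨x, (hmk _).1 ?_⟩
  rw [RingHom.algebraMap_toAlgebra, hj, hj] at hx
  rw [map_add, map_sub, map_mul, map_pow]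
  exact hx

theorem isUnit_of_isNilpotent_sub {x y : S} (hx : IsUnit (x - σ x))
    (hn : IsNilpotent (x - y)) : IsUnit (y - σ y) := by
  have h1 : IsNilpotent (σ (x - y) - (x - y)) :=
    (Commute.all _ _).isNilpotent_sub (hn.map σ) hn
  have h2 := h1.isUnit_add_right_of_commute hx (Commute.all _ _)
  convert h2 using 1
  rw [map_sub]
  ring

/-- An elliptic quadratic polynomial has a root `τ`, with `τ - σ(τ)` a unit. -/
theorem exists_elliptic (e : IsQuadExt π ι σ) (h : IsChain R π r q) (hf : IsResidue π f)
    {Δ s : R} (hirr : IrredType (f Δ) (f s)) :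
    ∃ τ, ι s = τ + σ τ ∧ ι Δ = τ * σ τ ∧ IsUnit (τ - σ τ) := by
  obtain ⟨ω, hω⟩ := e.exists_unit
  obtain ⟨x, hx⟩ := e.exists_dvd_quadratic h hf Δ s
  have hunit : IsUnit (x - σ x) := by
    refine (e.isUnit_or _).resolve_right fun hd => ?_
    -- otherwise `x` is congruent to an element of `R`
    obtain ⟨a, b, rfl⟩ := e.exists_basis hω x
    have hb : ι π ∣ ι b := by
      rw [map_add, map_mul, e.map_map, e.map_map, add_sub_add_left_eq_sub, ← mul_sub] at hd
      obtain ⟨u, hu⟩ := hω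
      rwa [← hu, Units.dvd_mul_right] at hd
    have h1 : ι π ∣ ι (a ^ 2 - s * a + Δ) := by
      have h2 : ι π ∣ ι b * (ω * (2 * ι a + ι b * ω - ι s)) := hb.mul_right _
      have := dvd_sub hx h2
      convert this using 1
      simp only [map_add, map_sub, map_mul, map_pow]
      ring
    refine hirr (f a) ?_
    rw [← map_pow, ← map_mul, ← map_sub, ← map_add, hf.eq_zero_iff]
    exact e.dvd_of_map_dvd h1
  have hsum : ι π ∣ x + σ x - ι s := by
    have h1 := dvd_sub hx (e.dvd_sigma hx)
    simp only [map_add, map_sub, map_mul, map_pow, e.map_map] at h1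
    have h2 : ι π ∣ (x + σ x - ι s) * (x - σ x) := by
      convert h1 using 1; ring
    obtain ⟨u, hu⟩ := hunit
    rwa [← hu, Units.dvd_mul_right] at h2
  have hder : IsUnit (2 * x - ι s) := by
    refine e.isUnit_of_dvd_sub h hunit ?_
    rw [dvd_sub_comm]
    convert hsum using 1
    ring
  obtain ⟨τ, hn, hτ⟩ := exists_root_of_dvd (π := ι π) (r := r)
    (by rw [← map_pow, h.pow_eq, map_zero]) hx hder
  have hτu := isUnit_of_isNilpotent_sub hunit hn
  have hτσ := congrArg σ hτ
  simp only [map_add, map_sub, map_mul, map_pow, e.map_map, map_zero] at hτσ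
  have h1 : (τ - σ τ) * (τ + σ τ - ι s) = 0 := by linear_combination hτ - hτσ
  rw [hτu.mul_right_eq_zero, sub_eq_zero] at h1
  refine ⟨τ, h1.symm, ?_, hτu⟩
  linear_combination hτ - τ * h1

/-- The polynomial of an element `τ` with `τ - σ(τ)` a unit is elliptic. -/
theorem irredType (e : IsQuadExt π ι σ) (h : IsChain R π r q) (hf : IsResidue π f) {τ : S}
    {n t : R} (ht : ι t = τ + σ τ) (hn : ι n = τ * σ τ) (hτ : IsUnit (τ - σ τ)) :
    IrredType (f n) (f t) := by
  intro x hx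
  obtain ⟨x, rfl⟩ := hf.surjective x
  rw [← map_pow, ← map_mul, ← map_sub, ← map_add, hf.eq_zero_iff] at hx
  have h1 : ι (x ^ 2 - t * x + n) = (ι x - τ) * σ (ι x - τ) := by
    simp only [map_add, map_sub, map_mul, map_pow, e.map_map, ht, hn]
    ring
  have h2 : IsUnit (ι x - τ) := by
    refine (e.isUnit_or _).resolve_right fun hd => e.not_dvd_isUnit h hτ ?_
    have := dvd_sub (e.dvd_sigma hd) hd
    convert this using 1
    rw [map_sub, e.map_map]
    ring
  refine h.not_dvd_isUnit ((e.isUnit_map_iff h).1 ?_) hx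
  rw [h1]
  exact h2.mul (h2.map σ)

end IsQuadExt

end QuadExt

/-! ### Cuspidal representations -/

section Cuspidal

variable {R S : Type*} [CommRing R] [CommRing S] {k : Type*} [Field k] {π : R} {r l q : ℕ}
  {ψ : AddChar R ℂ} {f : R →+* k} {ι : R →+* S} {σ : S →+* S}

theorem coe_quadHom {τ : S} {n t : R} (ht : ι t = τ + σ τ) (hn : ι n = τ * σ τ)
    (g : unitsAdjoin (companion n t)) :
    (quadHom ι σ ht hn g : S) = ι (g.1.1 0 0) + ι (g.1.1 0 1) * τ := rfl

/-- The character `z ↦ ν(z) ν'(σ(z))` of `Sˣ`. -/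
def normChar (σ : S →+* S) (ν ν' : Sˣ →* ℂˣ) : Sˣ →* ℂˣ :=
  ν * ν'.comp (Units.map (σ : S →* S))

theorem normChar_apply (ν ν' : Sˣ →* ℂˣ) (u : Sˣ) :
    normChar σ ν ν' u = ν u * ν' (Units.map (σ : S →* S) u) := rfl

theorem quadChar_eq {τ : S} {n t : R} (ht : ι t = τ + σ τ) (hn : ι n = τ * σ τ)
    (ν ν' : Sˣ →* ℂˣ) :
    quadChar ι σ ht hn ν ν' = (normChar σ ν ν').comp (quadHom ι σ ht hn) := rfl

/-- The character `χ` of `Sˣ` is `1 + π^l z ↦ ψ(π^l Tr(τ z))` on `1 + π^l S`. -/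
def HasShiftE (π : R) (l : ℕ) (ψ : AddChar R ℂ) (ι : R →+* S) (σ : S →+* S) (χ : Sˣ →* ℂˣ)
    (τ : S) : Prop :=
  ∀ (z : S) (u : Sˣ) (c : R), (u : S) = 1 + ι (π ^ l) * z → ι c = τ * z + σ (τ * z) →
    (χ u : ℂ) = ψ (π ^ l * c)

/-- In the elliptic case, `a + bβ ↦ a + bτ` is an isomorphism from `R[β]ˣ` to `Sˣ`. -/
theorem quadHom_bijective (e : IsQuadExt π ι σ) (h : IsChain R π r q) {τ : S} {n t : R}
    (ht : ι t = τ + σ τ) (hn : ι n = τ * σ τ) (hτ : IsUnit (τ - σ τ)) :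
    Function.Bijective (quadHom ι σ ht hn) := by
  constructor
  · intro g g' hg
    have h1 := congrArg Units.val hg
    rw [coe_quadHom, coe_quadHom] at h1
    obtain ⟨h2, h3⟩ := e.basis_unique hτ (a := g.1.1 0 0 - g'.1.1 0 0)
      (b := g.1.1 0 1 - g'.1.1 0 1) (by simp only [map_sub]; linear_combination h1)
    refine Subtype.ext (Units.ext ?_)
    rw [eq_quadMat_of_mem g.2, eq_quadMat_of_mem g'.2, sub_eq_zero.1 h2, sub_eq_zero.1 h3]
  · intro u
    obtain ⟨x, y, hu⟩ := e.exists_basis hτ (u : S)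
    have hdet : IsUnit (x ^ 2 + t * x * y + n * y ^ 2) := by
      rw [← e.isUnit_map_iff h]
      have h1 : ι (x ^ 2 + t * x * y + n * y ^ 2) = u * σ u := by
        rw [hu]
        simp only [map_add, map_mul, map_pow, e.map_map, ht, hn]
        ring
      rw [h1]
      exact u.isUnit.mul (u.isUnit.map σ)
    refine ⟨⟨quadUnit hdet, quadUnit_mem hdet⟩, Units.ext ?_⟩
    rw [hu, coe_quadHom]
    simp [coe_quadUnit, quadMat]

namespace IsSetup

theorem sq_eqE (h : IsSetup π r l q ψ f) (ι : R →+* S) : ι (π ^ l) * ι (π ^ l) = 0 := by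
  rw [← map_mul, h.sq_eq, map_zero]

/-- Every character of `1 + π^l S` comes from an element of `S`, by the non-degeneracy of the trace
form. -/
theorem exists_hasShiftE (h : IsSetup π r l q ψ f) (e : IsQuadExt π ι σ) (χ : Sˣ →* ℂˣ) :
    ∃ τ, HasShiftE π l ψ ι σ χ τ := by
  have ha := h.sq_eqE ι
  have hone : ∀ z w, unitOneAdd ha (z + w) = unitOneAdd ha z * unitOneAdd ha w := fun z w =>
    Units.ext (by
      simp only [coe_unitOneAdd, Units.val_mul]
      linear_combination (-z * w) * ha)
  have key : ∀ w : S, ∃ c : R, ∀ x : R,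
      (χ (unitOneAdd ha (ι x * w)) : ℂ) = ψ (π ^ l * (c * x)) := by
    intro w
    let φ : AddChar R ℂ :=
      { toFun := fun x => χ (unitOneAdd ha (ι x * w))
        map_zero_eq_one' := by
          have : unitOneAdd ha (ι 0 * w) = 1 := Units.ext (by simp [coe_unitOneAdd])
          simp only [this, map_one, Units.val_one]
        map_add_eq_mul' := fun x y => by
          rw [map_add, add_mul, hone, map_mul, Units.val_mul] }
    obtain ⟨c, hφ⟩ := h.chain.exists_addChar_eq_pow h.psi h.le φ (fun x => by
      have : unitOneAdd ha (ι (π ^ l * x) * w) = 1 := Units.ext (by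
        rw [coe_unitOneAdd, map_mul, Units.val_one]
        linear_combination (ι x * w) * ha)
      change (χ (unitOneAdd ha (ι (π ^ l * x) * w)) : ℂ) = 1
      rw [this, map_one, Units.val_one])
    refine ⟨c, fun x => ?_⟩
    have := hφ x
    rwa [h.sub_eq] at this
  obtain ⟨ω, hω⟩ := e.exists_unit
  obtain ⟨a, ha1⟩ := key 1
  obtain ⟨b, hb1⟩ := key ω
  -- the element `τ` with `Tr(τ) = a` and `Tr(τ ω) = b`
  obtain ⟨u, hu⟩ := hω
  have hσu : σ u = -u := by rw [hu, map_sub, e.involutive, neg_sub]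
  obtain ⟨τ, hτ⟩ : ∃ τ : S, τ * u = ι b - ι a * σ ω :=
    ⟨(ι b - ι a * σ ω) * ((u⁻¹ : Sˣ) : S), by rw [mul_assoc, Units.inv_mul, mul_one]⟩
  have hστ : σ τ * u = -(ι b - ι a * ω) := by
    have := congrArg σ hτ
    simp only [map_mul, map_sub, e.map_map, e.involutive, hσu] at this
    linear_combination -this
  have hcancel : ∀ x y : S, x * u = y * u → x = y := fun x y hxy => u.isUnit.mul_right_cancel hxy
  have h1 : τ + σ τ = ι a := hcancel _ _ (by linear_combination hτ + hστ - ι a * hu)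
  have h2 : τ * ω + σ τ * σ ω = ι b :=
    hcancel _ _ (by linear_combination ω * hτ + σ ω * hστ - ι b * hu)
  refine ⟨τ, fun z v c hv hc => ?_⟩
  obtain ⟨x, y, rfl⟩ := e.exists_basis ⟨u, hu⟩ z
  have hv' : v = unitOneAdd ha (ι x * 1) * unitOneAdd ha (ι y * ω) := by
    rw [← hone, mul_one]
    exact Units.ext hv
  have hc' : c = a * x + b * y := e.injective (by
    rw [hc]
    simp only [map_add, map_mul, e.map_map]
    linear_combination ι x * h1 + ι y * h2)
  rw [hv', map_mul, Units.val_mul, ha1, hb1, ← AddChar.map_add_eq_mul, hc']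
  congr 1
  ring

/-- Regularity of a pair of characters, in terms of the orbit of the representation. -/
theorem regularE_iff (h : IsSetup π r l q ψ f) (e : IsQuadExt π ι σ) {ν ν' : Sˣ →* ℂˣ} {τ : S}
    (hs : HasShiftE π l ψ ι σ (normChar σ ν ν') τ) :
    (∃ (z : S) (u : Sˣ), σ z = -z ∧ (u : S) = 1 + ι π ^ (r - 1) * z ∧ (ν * ν'⁻¹) u ≠ 1) ↔
      IsUnit (τ - σ τ) := by
  have hpow : ι π ^ (r - 1) = ι (π ^ l) * ι (π ^ (l - 1)) := by
    rw [← map_pow, h.pow_pred, map_mul]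
  have hsq : ι π ^ (r - 1) * ι π ^ (r - 1) = 0 := by
    rw [hpow]; linear_combination (ι (π ^ (l - 1)) * ι (π ^ (l - 1))) * h.sq_eqE ι
  have key : ∀ (z : S) (u : Sˣ) (c : R), σ z = -z → (u : S) = 1 + ι π ^ (r - 1) * z →
      ι c = (τ - σ τ) * z → (((ν * ν'⁻¹) u : ℂˣ) : ℂ) = ψ (π ^ (r - 1) * c) := by
    intro z u c hz hu hc
    have h1 : u⁻¹ = Units.map (σ : S →* S) u := by
      rw [inv_eq_iff_mul_eq_one]
      refine Units.ext ?_
      change (u : S) * σ u = 1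
      rw [hu, map_add, map_mul, map_pow, e.map_map, map_one, hz]
      linear_combination (-z * z) * hsq
    rw [MonoidHom.mul_apply, MonoidHom.inv_apply, ← map_inv, h1, ← normChar_apply,
      hs (ι (π ^ (l - 1)) * z) u (π ^ (l - 1) * c) (by rw [hu, hpow, mul_assoc]), h.pow_pred,
      mul_assoc]
    rw [map_mul, hc, map_mul, map_mul, e.map_map, hz]
    ring
  constructor
  · rintro ⟨z, u, hz, hu, hne⟩
    refine (e.isUnit_or _).resolve_right fun hd => hne (Units.ext ?_)
    obtain ⟨c, hc⟩ := e.fixed ((τ - σ τ) * z) (by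
      rw [map_mul, map_sub, e.involutive, hz]; ring)
    have hdc : π ∣ c := e.dvd_of_map_dvd (by rw [hc]; exact hd.mul_right _)
    have := h.psi_eq_one hdc 1
    rw [mul_one] at this
    rw [key z u c hz hu hc, this, Units.val_one]
  · rintro ⟨v, hv⟩
    obtain ⟨x, hx, hx1⟩ := h.psi
    obtain ⟨c, rfl⟩ := Ideal.mem_span_singleton.1 hx
    have hσv : σ v = -v := by rw [hv, map_sub, e.involutive, neg_sub]
    have hσv' : σ ((v⁻¹ : Sˣ) : S) = -((v⁻¹ : Sˣ) : S) := by
      have h1 : σ v * σ ((v⁻¹ : Sˣ) : S) = 1 := by rw [← map_mul, Units.mul_inv, map_one]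
      rw [hσv] at h1
      have h2 := v.inv_mul
      linear_combination -((v⁻¹ : Sˣ) : S) * h1 - σ ((v⁻¹ : Sˣ) : S) * h2
    have hz : σ (ι c * ((v⁻¹ : Sˣ) : S)) = -(ι c * ((v⁻¹ : Sˣ) : S)) := by
      rw [map_mul, e.map_map, hσv', mul_neg]
    refine ⟨_, unitOneAdd hsq (ι c * ((v⁻¹ : Sˣ) : S)), hz, rfl, fun h1 => hx1 ?_⟩
    rw [← key _ (unitOneAdd hsq (ι c * ((v⁻¹ : Sˣ) : S))) c hz rfl, h1, Units.val_one]
    rw [← hv, mul_left_comm, Units.mul_inv, mul_one]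

/-- `θ_{ν,ν'}` coincides with `ψ_{β(τ)}` if and only if `τ` belongs to `(ν, ν')`. -/
theorem agrees_quadChar_iff (h : IsSetup π r l q ψ f) (e : IsQuadExt π ι σ)
    (hI : Ideal.span {π ^ l} * Ideal.span {π ^ l} = ⊥) {ν ν' : Sˣ →* ℂˣ} {τ : S} {n t : R}
    (ht : ι t = τ + σ τ) (hn : ι n = τ * σ τ) (hτ : IsUnit (τ - σ τ)) :
    Agrees hI ψ (companion n t) (quadChar ι σ ht hn ν ν') ↔
      HasShiftE π l ψ ι σ (normChar σ ν ν') τ := by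
  have htr : ∀ a b : R, trace (companion n t * quadMat n t a b) = a * t + b * (t ^ 2 - 2 * n) := by
    intro a b
    simp [companion, quadMat, trace_fin_two]
    ring
  have hTr : ∀ a b : R, ι (a * t + b * (t ^ 2 - 2 * n)) =
      τ * (ι a + ι b * τ) + σ (τ * (ι a + ι b * τ)) := by
    intro a b
    simp only [map_add, map_mul, map_sub, map_pow, e.map_map, ht, hn, map_ofNat]
    ring
  have hone : ∀ a b : R, (oneAdd h.sq_eq (quadMat n t a b) : Matrix (Fin 2) (Fin 2) R) =
      quadMat n t (1 + π ^ l * a) (π ^ l * b) := by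
    intro a b
    rw [coe_oneAdd]
    ext i j
    fin_cases i <;> fin_cases j <;> simp [quadMat] <;> ring
  have hmem : ∀ a b : R, oneAdd h.sq_eq (quadMat n t a b) ∈ unitsAdjoin (companion n t) :=
    fun a b => mem_unitsAdjoin_iff.2 (by rw [hone]; exact commute_quadMat _ _ _ _)
  have hquad : ∀ a b : R, (quadHom ι σ ht hn ⟨_, hmem a b⟩ : S) =
      1 + ι (π ^ l) * (ι a + ι b * τ) := by
    intro a b
    rw [coe_quadHom]
    change ι ((oneAdd h.sq_eq (quadMat n t a b) : Matrix (Fin 2) (Fin 2) R) 0 0) +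
      ι ((oneAdd h.sq_eq (quadMat n t a b) : Matrix (Fin 2) (Fin 2) R) 0 1) * τ = _
    rw [hone]
    simp [quadMat]
    ring
  have hpsi : ∀ a b : R, psiFun ψ (companion n t) (oneAdd h.sq_eq (quadMat n t a b)) =
      ψ (π ^ l * (a * t + b * (t ^ 2 - 2 * n))) := fun a b => by rw [psiFun_oneAdd, htr]
  constructor
  · intro hag z u c hu hc
    obtain ⟨a, b, rfl⟩ := e.exists_basis hτ z
    have hu' : u = quadHom ι σ ht hn ⟨_, hmem a b⟩ := Units.ext (by rw [hu, hquad])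
    have hc' : c = a * t + b * (t ^ 2 - 2 * n) := e.injective (by rw [hc, hTr])
    rw [hu', hc', ← hpsi]
    exact congrArg Units.val (hag _ (hmem a b) (oneAdd_mem _ _))
  · intro hs g hS hK
    have hd : ∀ i j, π ^ l ∣ ((g : Matrix (Fin 2) (Fin 2) R) - 1) i j := fun i j =>
      Ideal.mem_span_singleton.1 (mem_congr.1 hK i j)
    obtain ⟨a, ha⟩ := hd 0 0
    obtain ⟨b, hb⟩ := hd 0 1
    have hg : g = oneAdd h.sq_eq (quadMat n t a b) := Units.ext (by
      rw [hone, eq_quadMat_of_mem hS]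
      congr 1
      · rw [← ha]; simp
      · rw [← hb]; simp)
    subst hg
    refine Units.ext ?_
    change (normChar σ ν ν' (quadHom ι σ ht hn ⟨_, hmem a b⟩) : ℂ) =
      psiFun ψ (companion n t) (oneAdd h.sq_eq (quadMat n t a b))
    rw [hpsi]
    exact hs _ _ _ (hquad a b) (hTr a b)

/-- The element `τ` belonging to a character is unique modulo `π^l`. -/
theorem dvd_of_hasShiftE (h : IsSetup π r l q ψ f) (e : IsQuadExt π ι σ) {χ : Sˣ →* ℂˣ} {τ₁ τ₂ : S}
    (h₁ : HasShiftE π l ψ ι σ χ τ₁) (h₂ : HasShiftE π l ψ ι σ χ τ₂) :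
    ι (π ^ l) ∣ τ₂ - τ₁ := by
  have key : ∀ z, ι (π ^ l) * ((τ₂ - τ₁) * z + σ ((τ₂ - τ₁) * z)) = 0 := by
    intro z
    obtain ⟨c, hc⟩ := e.exists_trace ((τ₂ - τ₁) * z)
    rw [← hc, ← map_mul]
    convert map_zero ι
    refine h.chain.eq_zero_of_psi h.psi fun x => ?_
    obtain ⟨c₁, hc₁⟩ := e.exists_trace (τ₁ * (z * ι x))
    obtain ⟨c₂, hc₂⟩ := e.exists_trace (τ₂ * (z * ι x))
    have h3 := h₁ _ (unitOneAdd (h.sq_eqE ι) (z * ι x)) c₁ rfl hc₁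
    rw [h₂ _ (unitOneAdd (h.sq_eqE ι) (z * ι x)) c₂ rfl hc₂] at h3
    have h4 : π ^ l * c * x = π ^ l * c₂ - π ^ l * c₁ := by
      have : c * x = c₂ - c₁ := e.injective (by
        rw [map_mul, map_sub, hc, hc₁, hc₂]
        simp only [map_mul, map_sub, e.map_map]
        ring)
      rw [mul_assoc, this, mul_sub]
    rw [h4, AddChar.map_sub_eq_div, h3, div_self]
    intro h0
    have h5 := AddChar.map_add_eq_mul ψ (π ^ l * c₁) (-(π ^ l * c₁))
    rw [add_neg_cancel, AddChar.map_zero_eq_one, h0, zero_mul] at h5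
    exact one_ne_zero h5
  obtain ⟨ω, u, hu⟩ := e.exists_unit
  have h1 := key 1
  have h2 := key ω
  simp only [mul_one, map_mul] at h1 h2
  have h3 : ι (π ^ l) * (τ₂ - τ₁) * u = 0 := by
    rw [hu]
    linear_combination h2 - σ ω * h1
  have h4 := e.pow_mul_eq_zero h.chain h.le (u.isUnit.mul_left_eq_zero.1 h3)
  rwa [h.sub_eq] at h4

/-- Up to isomorphism, `π(θ_{ν,ν'}, β(τ))` does not depend on the choice of `τ`. -/
theorem equivalent_of_hasShiftE (h : IsSetup π r l q ψ f) (e : IsQuadExt π ι σ)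
    (hI : Ideal.span {π ^ l} * Ideal.span {π ^ l} = ⊥) {ν ν' : Sˣ →* ℂˣ} {τ₁ τ₂ : S}
    {n₁ t₁ n₂ t₂ : R} (ht₁ : ι t₁ = τ₁ + σ τ₁) (hn₁ : ι n₁ = τ₁ * σ τ₁)
    (ht₂ : ι t₂ = τ₂ + σ τ₂) (hn₂ : ι n₂ = τ₂ * σ τ₂)
    (hτ₁ : IsUnit (τ₁ - σ τ₁)) (hτ₂ : IsUnit (τ₂ - σ τ₂))
    (h₁ : Agrees hI ψ (companion n₁ t₁) (quadChar ι σ ht₁ hn₁ ν ν'))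
    (h₂ : Agrees hI ψ (companion n₂ t₂) (quadChar ι σ ht₂ hn₂ ν ν')) :
    Equivalent (piRep hI ψ (companion n₁ t₁) (quadChar ι σ ht₁ hn₁ ν ν') h₁)
      (piRep hI ψ (companion n₂ t₂) (quadChar ι σ ht₂ hn₂ ν ν') h₂) := by
  obtain ⟨w, hw⟩ := h.dvd_of_hasShiftE e ((h.agrees_quadChar_iff e hI ht₁ hn₁ hτ₁).1 h₁)
    ((h.agrees_quadChar_iff e hI ht₂ hn₂ hτ₂).1 h₂)
  obtain ⟨a, b, rfl⟩ := e.exists_basis hτ₁ w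
  have hτ₂' : τ₂ = ι (π ^ l * a) + ι (1 + π ^ l * b) * τ₁ := by
    simp only [map_add, map_mul, map_one] at hw ⊢
    linear_combination hw
  have ht : t₂ = 2 * (π ^ l * a) + (1 + π ^ l * b) * t₁ := e.injective (by
    rw [ht₂, hτ₂']
    simp only [map_add, map_mul, e.map_map, map_ofNat, ht₁]
    ring)
  have hn : n₂ = (π ^ l * a) ^ 2 + (π ^ l * a) * (1 + π ^ l * b) * t₁ +
      (1 + π ^ l * b) ^ 2 * n₁ := e.injective (by
    rw [hn₂, hτ₂']
    simp only [map_add, map_mul, map_pow, e.map_map, ht₁, hn₁]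
    ring)
  -- `β(τ₂)` is conjugate to an element of `R[β(τ₁)]` that is congruent to `β(τ₁)`
  let M : Matrix (Fin 2) (Fin 2) R := quadMat n₁ t₁ (π ^ l * a) (1 + π ^ l * b)
  have hunit : IsUnit (1 + π ^ l * b) := (unitOneAdd h.sq_eq b).isUnit
  let A : Matrix (Fin 2) (Fin 2) R := !![1, 0; π ^ l * a, 1 + π ^ l * b]
  have hA : IsUnit A.det := by simpa [A, det_fin_two] using hunit
  let g : GL (Fin 2) R := Matrix.nonsingInvUnit A hA
  have hgM : (g : Matrix (Fin 2) (Fin 2) R) * M = companion n₂ t₂ * g := by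
    change A * M = companion n₂ t₂ * A
    rw [ht, hn]
    ext i j
    fin_cases i <;> fin_cases j <;> simp [A, M, quadMat, companion] <;> ring
  have hconj : (g : Matrix (Fin 2) (Fin 2) R) * M * ((g⁻¹ : GL (Fin 2) R) : Matrix _ _ R) =
      companion n₂ t₂ := by rw [hgM, mul_assoc, Units.mul_inv, mul_one]
  have hdvd : ∀ i j, π ^ l ∣ companion n₁ t₁ i j - M i j := by
    intro i j
    fin_cases i <;> fin_cases j
    · simp [companion, M, quadMat]
    · simp [companion, M, quadMat]
    · exact ⟨n₁ * b, by simp [companion, M, quadMat]; ring⟩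
    · exact ⟨-a - t₁ * b, by simp [companion, M, quadMat]; ring⟩
  have hmem : ∀ s ∈ unitsAdjoin (companion n₂ t₂), g⁻¹ * s * g ∈ unitsAdjoin (companion n₁ t₁) ∧
      (g⁻¹ * s * g).1 = quadMat n₁ t₁ (s.1 0 0 + s.1 0 1 * (π ^ l * a))
        (s.1 0 1 * (1 + π ^ l * b)) := by
    intro s hs
    have h1 : (s : Matrix (Fin 2) (Fin 2) R) * g = g * quadMat n₁ t₁
        (s.1 0 0 + s.1 0 1 * (π ^ l * a)) (s.1 0 1 * (1 + π ^ l * b)) := by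
      have h2 : (s : Matrix (Fin 2) (Fin 2) R) = s.1 0 0 • 1 + s.1 0 1 • companion n₂ t₂ := by
        conv_lhs => rw [eq_quadMat_of_mem hs]
        ext i j
        fin_cases i <;> fin_cases j <;> simp [quadMat, companion] <;> ring
      have h3 : quadMat n₁ t₁ (s.1 0 0 + s.1 0 1 * (π ^ l * a)) (s.1 0 1 * (1 + π ^ l * b)) =
          s.1 0 0 • 1 + s.1 0 1 • M := by
        ext i j
        fin_cases i <;> fin_cases j <;> simp [quadMat, M] <;> ring
      rw [h3, mul_add, mul_smul_comm, mul_smul_comm, hgM, mul_one]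
      conv_lhs => rw [h2]
      rw [add_mul, smul_mul_assoc, smul_mul_assoc, one_mul]
    have h4 : (g⁻¹ * s * g).1 = quadMat n₁ t₁ (s.1 0 0 + s.1 0 1 * (π ^ l * a))
        (s.1 0 1 * (1 + π ^ l * b)) := by
      rw [mul_assoc, Units.val_mul, Units.val_mul, h1, ← mul_assoc, Units.inv_mul, one_mul]
    refine ⟨mem_unitsAdjoin_iff.2 ?_, h4⟩
    rw [h4]
    exact commute_quadMat _ _ _ _
  let ρ := piRep hI ψ (companion n₁ t₁) (quadChar ι σ ht₁ hn₁ ν ν') h₁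
  obtain ⟨hv1, hv2⟩ := (thetaPsi_eigen (ρ := ρ) hI h₁).1 (indChar_indGen _ _)
  have hv0 := indGen_ne_zero (unitsAdjoin (companion n₁ t₁) ⊔ congr (Ideal.span {π ^ l}))
    (thetaPsi hI ψ (companion n₁ t₁) (quadChar ι σ ht₁ hn₁ ν ν') h₁)
  generalize indGen (unitsAdjoin (companion n₁ t₁) ⊔ congr (Ideal.span {π ^ l}))
    (thetaPsi hI ψ (companion n₁ t₁) (quadChar ι σ ht₁ hn₁ ν ν') h₁) = v at hv0 hv1 hv2
  refine h.chain.equivalent_piRep h.psi h.even h.pos hI h₂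
    (h.chain.isIrreducible_piRep h.psi h.even h.pos hI h₁) (v := ρ g v) ?_ ?_ ?_
  · intro h0
    exact hv0 (by rw [← ρ.inv_self_apply g v, h0, map_zero])
  · have hv3 : v ∈ eig ρ (congr (Ideal.span {π ^ l})) (psiFun ψ M) := fun n hn => by
      rw [hv1 n hn, (h.chain.psiFun_eq_iff h.psi h.le h.even.le).2 (by rwa [h.sub_eq]) n hn]
    intro n hn
    rw [map_mem_eig ρ _ _ g hv3 n hn]
    change psiFun ψ M (g⁻¹ * n * g) • ρ g v = _
    rw [psiFun_conj, hconj]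
  · intro s
    obtain ⟨hm, hm'⟩ := hmem s s.2
    have h5 : ρ s (ρ g v) = ρ g (ρ (g⁻¹ * s * g) v) := by
      rw [← Module.End.mul_apply, ← Module.End.mul_apply, ← map_mul, ← map_mul]
      congr 2
      group
    have h6 : quadChar ι σ ht₁ hn₁ ν ν' ⟨_, hm⟩ = quadChar ι σ ht₂ hn₂ ν ν' s := by
      rw [quadChar_eq, quadChar_eq, MonoidHom.comp_apply, MonoidHom.comp_apply]
      refine congrArg _ (Units.ext ?_)
      rw [coe_quadHom, coe_quadHom]
      change ι ((g⁻¹ * (s : GL (Fin 2) R) * g).1 0 0) +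
        ι ((g⁻¹ * (s : GL (Fin 2) R) * g).1 0 1) * τ₁ = _
      rw [hm', hτ₂']
      simp [quadMat]
      ring
    change ρ s (ρ g v) = _
    rw [h5, hv2 ⟨_, hm⟩, map_smul, h6]

/-- Every irreducible representation with an elliptic orbit is of the form `𝒞_{ν,ν'}`. -/
theorem exists_equivalent_quadChar (h : IsSetup π r l q ψ f) (e : IsQuadExt π ι σ)
    (hI : Ideal.span {π ^ l} * Ideal.span {π ^ l} = ⊥) {V : Type*} [AddCommGroup V] [Module ℂ V]
    [FiniteDimensional ℂ V] {ρ : Representation ℂ (GL (Fin 2) R) V} (hρ : ρ.IsIrreducible)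
    {Δ s : R} (hirr : IrredType (f Δ) (f s))
    (ho : Occurs (Ideal.span {π ^ l}) ψ (companion Δ s) ρ) :
    ∃ (ν ν' : Sˣ →* ℂˣ) (τ : S) (ht : ι s = τ + σ τ) (hn : ι Δ = τ * σ τ),
      IsUnit (τ - σ τ) ∧ ∃ hθ : Agrees hI ψ (companion Δ s) (quadChar ι σ ht hn ν ν'),
        Equivalent ρ (piRep hI ψ (companion Δ s) (quadChar ι σ ht hn ν ν') hθ) := by
  obtain ⟨τ, ht, hn, hτ⟩ := e.exists_elliptic h.chain h.residue hirr
  obtain ⟨θ, hθ, he⟩ := h.chain.exists_equivalent_piRep h.psi h.even h.pos hI hρ ho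
  let E := MulEquiv.ofBijective _ (quadHom_bijective e h.chain ht hn hτ)
  have hq : quadChar ι σ ht hn (θ.comp E.symm.toMonoidHom) 1 = θ := by
    ext g : 1
    change θ (E.symm (E g)) * 1 = θ g
    rw [E.symm_apply_apply, mul_one]
  refine ⟨θ.comp E.symm.toMonoidHom, 1, τ, ht, hn, hτ, ?_⟩
  rw [hq]
  exact ⟨hθ, he⟩

end IsSetup

end Cuspidal

/-! ### Twists and non-principal split representations -/

section Twist

variable {R : Type*} [CommRing R] {k : Type*} [Field k] {π : R} {r l q : ℕ}
  {ψ : AddChar R ℂ} {f : R →+* k}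

theorem HasShift.inv {μ : Rˣ →* ℂˣ} {a : R} (hμ : HasShift π l ψ μ a) :
    HasShift π l ψ μ⁻¹ (-a) := fun x u hu => by
  rw [MonoidHom.inv_apply, Units.val_inv_eq_inv_val, hμ x u hu, ← AddChar.map_neg_eq_inv]
  congr 1
  ring

namespace IsSetup

variable {V : Type*} [AddCommGroup V] [Module ℂ V] {ρ : Representation ℂ (GL (Fin 2) R) V}

theorem occurs_twist (h : IsSetup π r l q ψ f) {χ : Rˣ →* ℂˣ} {a : R} (hχ : HasShift π l ψ χ a)
    {β : Matrix (Fin 2) (Fin 2) R} (ho : Occurs (Ideal.span {π ^ l}) ψ β ρ) :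
    Occurs (Ideal.span {π ^ l}) ψ (β + a • 1) (twist (χ.comp GeneralLinearGroup.det) ρ) := by
  obtain ⟨v, hv0, hv⟩ := ho
  refine ⟨v, hv0, fun g hg => ?_⟩
  obtain ⟨X, rfl⟩ := exists_eq_oneAdd h.sq_eq hg
  rw [twist_apply, hv _ hg, smul_smul, MonoidHom.comp_apply,
    hχ (trace X) _ (det_oneAdd h.sq_eq X), psiFun_oneAdd, psiFun_oneAdd,
    ← AddChar.map_add_eq_mul]
  congr 2
  simp only [add_mul, smul_mul_assoc, one_mul, trace_add, trace_smul, smul_eq_mul]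
  ring

theorem occurs_companion_twist (h : IsSetup π r l q ψ f) {χ : Rˣ →* ℂˣ} {a : R}
    (hχ : HasShift π l ψ χ a) {Δ s : R} (ho : Occurs (Ideal.span {π ^ l}) ψ (companion Δ s) ρ) :
    Occurs (Ideal.span {π ^ l}) ψ (companion (Δ + a * s + a ^ 2) (s + 2 * a))
      (twist (χ.comp GeneralLinearGroup.det) ρ) := by
  have h1 := h.occurs_twist hχ ho
  rw [← h.occurs_companion_iff] at h1
  · convert h1 using 2
    · simp [companion, det_fin_two]; ring
    · simp [companion, trace_fin_two]; ring
  · rintro ⟨h2, -, -⟩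
    refine h.chain.not_dvd_isUnit isUnit_one ?_
    simpa [companion] using h2

/-- The representation is recovered, up to a twist, from any point of the shifted orbit. -/
theorem exists_equivalent_twist (h : IsSetup π r l q ψ f)
    (hI : Ideal.span {π ^ l} * Ideal.span {π ^ l} = ⊥) [FiniteDimensional ℂ V]
    (hρ : ρ.IsIrreducible) {χ : Rˣ →* ℂˣ} {a : R} (hχ : HasShift π l ψ χ a) {Δ s Δ' s' : R}
    (ho : Occurs (Ideal.span {π ^ l}) ψ (companion Δ s) ρ)
    (hΔ : π ^ l ∣ Δ' - (Δ - a * s + a ^ 2)) (hs : π ^ l ∣ s' - (s - 2 * a)) :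
    ∃ θ, ∃ hθ : Agrees hI ψ (companion Δ' s') θ,
      Equivalent ρ (twist (χ.comp GeneralLinearGroup.det)
        (piRep hI ψ (companion Δ' s') θ hθ)) := by
  have h1 := h.occurs_companion_twist hχ.inv ho
  have h2 : χ⁻¹.comp GeneralLinearGroup.det =
      (χ.comp (GeneralLinearGroup.det (n := Fin 2)))⁻¹ := rfl
  obtain ⟨θ, hθ, e⟩ := h.chain.exists_equivalent_piRep h.psi h.even h.pos hI
    (isIrreducible_twist (χ⁻¹.comp GeneralLinearGroup.det) hρ)
    (h.occurs_companion_of_dvd h1 (Δ' := Δ') (s' := s') (by convert hΔ using 1; ring)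
      (by convert hs using 1; ring))
  refine ⟨θ, hθ, ?_⟩
  have h3 := e.twist (χ.comp GeneralLinearGroup.det)
  rwa [h2, twist_inv_twist] at h3

/-- The twists of the representations with nilpotent orbit are non-principal split. -/
theorem occurs_double_of_twist (h : IsSetup π r l q ψ f)
    (hI : Ideal.span {π ^ l} * Ideal.span {π ^ l} = ⊥) (χ : Rˣ →* ℂˣ) {Δ s : R}
    (hΔ : π ∣ Δ) (hs : π ∣ s) {θ : unitsAdjoin (companion Δ s) →* ℂˣ}
    (hθ : Agrees hI ψ (companion Δ s) θ)
    (e : Equivalent ρ (twist (χ.comp GeneralLinearGroup.det)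
        (piRep hI ψ (companion Δ s) θ hθ))) :
    ρ.IsIrreducible ∧ ∃ Δ s, DoubleType (f Δ) (f s) ∧
      Occurs (Ideal.span {π ^ l}) ψ (companion Δ s) ρ := by
  obtain ⟨a, ha⟩ := h.exists_hasShift χ
  refine ⟨e.symm.isIrreducible (isIrreducible_twist _
    (h.chain.isIrreducible_piRep h.psi h.even h.pos hI hθ)), _, _, ⟨f a, ?_, ?_⟩,
    (h.occurs_companion_twist ha (IsChain.occurs_piRep hI hθ)).of_equivalent e.symm⟩
  · rw [map_add, map_add, map_mul, map_pow, (h.residue.eq_zero_iff _).2 hΔ,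
      (h.residue.eq_zero_iff _).2 hs]
    ring
  · rw [map_add, map_mul, (h.residue.eq_zero_iff _).2 hs, map_ofNat]
    ring

/-- A representation with double root `f a` becomes nilpotent after a twist by a character with
shift congruent to `a`. -/
theorem dvd_of_doubleType (h : IsSetup π r l q ψ f) {Δ s a : R} (hΔ : f Δ = f a * f a)
    (hs : f s = f a + f a) : π ∣ Δ - a * s + a ^ 2 ∧ π ∣ s - 2 * a := by
  rw [← h.residue.eq_zero_iff, ← h.residue.eq_zero_iff]
  constructor
  · rw [map_add, map_sub, map_mul, map_pow, hΔ, hs]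
    ring
  · rw [map_sub, map_mul, map_ofNat, hs]
    ring

end IsSetup

end Twist

/-! ### Representations that factorize, up to a twist, at a lower level -/

section Scalar

variable {R : Type*} [CommRing R] {k : Type*} [Field k] {π : R} {r l q : ℕ}
  {ψ : AddChar R ℂ} {f : R →+* k} {V : Type*} [AddCommGroup V] [Module ℂ V]
  {ρ : Representation ℂ (GL (Fin 2) R) V}

theorem congr_mono {I J : Ideal R} (hIJ : I ≤ J) : congr I ≤ congr J := fun g hg => by
  rw [mem_congr] at hg ⊢
  exact fun i j => hIJ (hg i j)

namespace IsSetup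

theorem span_pred_le (h : IsSetup π r l q ψ f) : Ideal.span {π ^ (r - 1)} ≤ Ideal.span {π ^ l} := by
  rw [Ideal.span_singleton_le_span_singleton, h.pow_pred]
  exact dvd_mul_right _ _

theorem le_two_mul_pred (h : IsSetup π r l q ψ f) : r ≤ 2 * (r - 1) := by
  have := h.even
  have := h.pos
  omega

/-- If the last congruence subgroup acts by scalars, the orbit is scalar modulo `π`. -/
theorem dvd_of_scalar (h : IsSetup π r l q ψ f) {β : Matrix (Fin 2) (Fin 2) R}
    (ho : Occurs (Ideal.span {π ^ l}) ψ β ρ)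
    (hsc : ∀ g ∈ congr (Ideal.span {π ^ (r - 1)}), ∃ c : ℂ, ∀ v, ρ g v = c • v) :
    π ∣ β 0 1 ∧ π ∣ β 1 0 ∧ π ∣ β 0 0 - β 1 1 := by
  obtain ⟨v, hv0, hv⟩ := ho
  have key : ∀ (g : GL (Fin 2) R) (i j : Fin 2),
      π ∣ ((g : Matrix (Fin 2) (Fin 2) R) * β - β * g) i j := by
    intro g i j
    refine dvd_comm_of_dvd_conj g (fun i j => ?_) i j
    have h1 := (h.chain.psiFun_eq_iff h.psi (Nat.sub_le r 1) h.le_two_mul_pred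
      (β := (g : Matrix (Fin 2) (Fin 2) R) * β * ((g⁻¹ : GL (Fin 2) R) : Matrix (Fin 2) (Fin 2) R))
      (β' := β)).1 (fun n hn => ?_) i j
    · rwa [Nat.sub_sub_self h.chain.pos, pow_one] at h1
    · rw [← psiFun_conj]
      have hn' : g⁻¹ * n * g ∈ congr (Ideal.span {π ^ (r - 1)}) := by
        simpa using Subgroup.Normal.conj_mem inferInstance n hn g⁻¹
      obtain ⟨c, hc⟩ := hsc n hn
      have h2 : ρ (g⁻¹ * n * g) v = c • v := by
        rw [map_mul, map_mul, Module.End.mul_apply, Module.End.mul_apply, hc, map_smul,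
          ρ.inv_self_apply]
      rw [hv _ (congr_mono h.span_pred_le hn')] at h2
      have h3 := hc v
      rw [hv _ (congr_mono h.span_pred_le hn)] at h3
      exact smul_left_injective ℂ hv0 (h2.trans h3.symm)
  let u : GL (Fin 2) R := ⟨!![1, 1; 0, 1], !![1, -1; 0, 1], by simp [Matrix.one_fin_two],
    by simp [Matrix.one_fin_two]⟩
  let w : GL (Fin 2) R := ⟨!![1, 0; 1, 1], !![1, 0; -1, 1], by simp [Matrix.one_fin_two],
    by simp [Matrix.one_fin_two]⟩
  have h1 := key u 0 0
  have h2 := key u 0 1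
  have h3 := key w 0 0
  simp only [Matrix.sub_apply, Matrix.mul_apply, Fin.sum_univ_two] at h1 h2 h3
  simp [u] at h1 h2
  simp [w] at h3
  refine ⟨h3, h1, ?_⟩
  rw [dvd_sub_comm]
  convert h2 using 1
  ring

/-- Every character of `1 + π^(r-1) R` extends to `Rˣ`. -/
theorem exists_char (h : IsSetup π r l q ψ f) (a : R) :
    ∃ μ : Rˣ →* ℂˣ, ∀ u : Rˣ, (u : R) - 1 ∈ Ideal.span {π ^ (r - 1)} →
      (μ u : ℂ) = ψ (a * (u - 1)) := by
  have := h.chain.finite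
  let H : Subgroup Rˣ := (Units.map
    (Ideal.Quotient.mk (Ideal.span {π ^ (r - 1)}) : R →* R ⧸ Ideal.span {π ^ (r - 1)})).ker
  have hH : ∀ u : Rˣ, u ∈ H ↔ (u : R) - 1 ∈ Ideal.span {π ^ (r - 1)} := fun u => by
    rw [MonoidHom.mem_ker, Units.ext_iff, ← Ideal.Quotient.eq]
    rfl
  let c : H →* ℂˣ := MonoidHom.toHomUnits
    { toFun := fun u => ψ (a * ((u : Rˣ) - 1))
      map_one' := by simp
      map_mul' := fun u v => by
        have h0 : (((u : Rˣ) : R) - 1) * (((v : Rˣ) : R) - 1) = 0 := by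
          obtain ⟨x, hx⟩ := Ideal.mem_span_singleton.1 ((hH u).1 u.2)
          obtain ⟨y, hy⟩ := Ideal.mem_span_singleton.1 ((hH v).1 v.2)
          rw [hx, hy]
          linear_combination x * y * h.chain.pow_mul_pow h.le_two_mul_pred
        rw [← AddChar.map_add_eq_mul]
        congr 1
        simp only [Subgroup.coe_mul, Units.val_mul]
        linear_combination a * h0 }
  have hne : NeZero (Monoid.exponent Rˣ) := ⟨Monoid.exponent_ne_zero_of_finite⟩
  obtain ⟨μ, hμ⟩ := MonoidHom.domRestrict_surjective ℂ H c
  exact ⟨μ, fun u hu => congrArg Units.val (DFunLike.congr_fun hμ ⟨u, (hH u).2 hu⟩)⟩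

/-- If the orbit is scalar modulo `π`, the last congruence subgroup acts by scalars. -/
theorem scalar_of_dvd (h : IsSetup π r l q ψ f) (hρ : ρ.IsIrreducible)
    {β : Matrix (Fin 2) (Fin 2) R} (ho : Occurs (Ideal.span {π ^ l}) ψ β ρ)
    (hβ : π ∣ β 0 1 ∧ π ∣ β 1 0 ∧ π ∣ β 0 0 - β 1 1) :
    ∀ g ∈ congr (Ideal.span {π ^ (r - 1)}), ∀ v,
      ρ g v = ψ (β 0 0 * ((GeneralLinearGroup.det g : Rˣ) - 1)) • v := by
  have ha := h.chain.pow_mul_pow h.le_two_mul_pred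
  obtain ⟨v, hv0, hv⟩ := ho
  have hsc : ∀ g ∈ congr (Ideal.span {π ^ (r - 1)}),
      psiFun ψ β g = ψ (β 0 0 * ((GeneralLinearGroup.det g : Rˣ) - 1)) := by
    intro g hg
    have h1 := (h.chain.psiFun_eq_iff h.psi (Nat.sub_le r 1) h.le_two_mul_pred
      (β := β) (β' := β 0 0 • 1)).2 (fun i j => ?_) g hg
    · obtain ⟨X, rfl⟩ := exists_eq_oneAdd ha hg
      rw [h1, psiFun_oneAdd, det_oneAdd, smul_mul_assoc, one_mul, trace_smul, smul_eq_mul]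
      congr 1
      ring
    · rw [Nat.sub_sub_self h.chain.pos, pow_one]
      obtain ⟨h1, h2, h3⟩ := hβ
      rw [dvd_sub_comm] at h3
      fin_cases i <;> fin_cases j <;> simp [h1, h2, h3]
  intro g hg w
  have hstab : ∀ g, ∀ w ∈ eig ρ (congr (Ideal.span {π ^ (r - 1)})) (psiFun ψ β),
      ρ g w ∈ eig ρ (congr (Ideal.span {π ^ (r - 1)})) (psiFun ψ β) := fun g w hw n hn => by
    have hn' : g⁻¹ * n * g ∈ congr (Ideal.span {π ^ (r - 1)}) := by
      simpa using Subgroup.Normal.conj_mem inferInstance n hn g⁻¹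
    have hdet : GeneralLinearGroup.det (g⁻¹ * n * g) = GeneralLinearGroup.det n := by
      rw [map_mul, map_mul, map_inv, mul_comm, mul_inv_cancel_left]
    rw [map_mem_eig ρ _ _ g hw n hn]
    change psiFun ψ β (g⁻¹ * n * g) • ρ g w = _
    rw [hsc _ hn', hsc n hn, hdet]
  have htop := eq_top_of_irreducible hρ _ hstab
    (v := v) (fun n hn => hv n (congr_mono h.span_pred_le hn)) hv0
  have hw : w ∈ eig ρ (congr (Ideal.span {π ^ (r - 1)})) (psiFun ψ β) :=
    htop ▸ Submodule.mem_top
  rw [hw g hg, hsc g hg]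

end IsSetup

end Scalar

/-! ### Strongly primitive representations -/

section Primitive

variable {A : Type*} [CommRing A] {ϖ : A}

theorem not_isUnit_mk (hn : ¬ IsUnit ϖ) {k : ℕ} (hk : 0 < k) {x : A} (hd : ϖ ∣ x) :
    ¬ IsUnit (Ideal.Quotient.mk (Ideal.span {ϖ ^ k}) x) := fun hx => by
  have h1 : IsUnit (Ideal.Quotient.mk (Ideal.span {ϖ ^ k}) (ϖ ^ k)) := by
    rw [map_pow]
    exact (isUnit_of_dvd_unit (map_dvd _ hd) hx).pow k
  rw [Ideal.Quotient.eq_zero_iff_mem.2 (Ideal.mem_span_singleton_self _), isUnit_zero_iff] at h1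
  have h2 : Ideal.Quotient.mk (Ideal.span {ϖ ^ k}) 1 = 0 := by rw [map_one, h1]
  rw [Ideal.Quotient.eq_zero_iff_mem, Ideal.mem_span_singleton] at h2
  exact hn (isUnit_of_dvd_one ((dvd_pow_self ϖ hk.ne').trans h2))

theorem proj_surjective (hA : ∀ x : A, IsUnit x ∨ ϖ ∣ x) (hn : ¬ IsUnit ϖ) {k : ℕ} (hk : 0 < k) :
    Function.Surjective (proj ϖ k) := by
  intro g
  choose X hX using fun i j => Ideal.Quotient.mk_surjective
    ((g : Matrix (Fin 2) (Fin 2) (Trunc ϖ k)) i j)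
  have hXg : (Ideal.Quotient.mk (Ideal.span {ϖ ^ k})).mapMatrix (Matrix.of X) = g := by
    ext i j
    exact hX i j
  have hdet : IsUnit (Matrix.of X).det := by
    refine (hA _).resolve_right fun hd => not_isUnit_mk hn hk hd ?_
    rw [RingHom.map_det, hXg]
    exact isUnit_det_coe g
  exact ⟨Matrix.nonsingInvUnit _ hdet, Units.ext hXg⟩

theorem mem_ker_proj {k : ℕ} {g : GL (Fin 2) A} :
    g ∈ (proj ϖ k).ker ↔ ∀ i j, ϖ ^ k ∣ ((g : Matrix (Fin 2) (Fin 2) A) - 1) i j := by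
  simp only [← Ideal.mem_span_singleton]
  exact mem_congr

theorem coe_proj_sub_one {r : ℕ} (g : GL (Fin 2) A) (i j : Fin 2) :
    ((proj ϖ r g : Matrix (Fin 2) (Fin 2) (Trunc ϖ r)) - 1) i j =
      Ideal.Quotient.mk _ (((g : Matrix (Fin 2) (Fin 2) A) - 1) i j) := by
  rw [Matrix.sub_apply, Matrix.sub_apply, map_sub]
  congr 1
  by_cases h : i = j <;> simp [Matrix.one_apply, h]

/-- The kernel of the projection to `GL₂(A_k)` is the preimage of a congruence subgroup of
`GL₂(A_r)`. -/
theorem mem_ker_proj_iff {k r : ℕ} (hk : k ≤ r) {g : GL (Fin 2) A} :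
    g ∈ (proj ϖ k).ker ↔
      proj ϖ r g ∈ congr (Ideal.span {Ideal.Quotient.mk (Ideal.span {ϖ ^ r}) ϖ ^ k}) := by
  rw [mem_ker_proj, mem_congr]
  refine forall_congr' fun i => forall_congr' fun j => ?_
  rw [coe_proj_sub_one, Ideal.mem_span_singleton, ← map_pow]
  refine ⟨fun h => map_dvd _ h, fun ⟨y, hy⟩ => ?_⟩
  obtain ⟨y, rfl⟩ := Ideal.Quotient.mk_surjective y
  rw [← map_mul, Ideal.Quotient.eq, Ideal.mem_span_singleton] at hy
  exact (dvd_sub_left (dvd_mul_right _ _)).1 ((pow_dvd_pow ϖ hk).trans hy)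

variable {V : Type*} [AddCommGroup V] [Module ℂ V]

theorem factors_iff {k : ℕ} (hs : Function.Surjective (proj ϖ k))
    {ρ : Representation ℂ (GL (Fin 2) A) V} :
    Factors ϖ k ρ ↔ ∀ g ∈ (proj ϖ k).ker, ρ g = 1 := by
  constructor
  · rintro ⟨ρ', rfl⟩ g hg
    rw [MonoidHom.comp_apply, MonoidHom.mem_ker.1 hg, map_one]
  · intro h
    let ρ₀ : GL (Fin 2) A →* (V →ₗ[ℂ] V)ˣ := MonoidHom.toHomUnits ρ
    let ρ₁ := (proj ϖ k).liftOfSurjective hs ⟨ρ₀, fun g hg => Units.ext (h g hg)⟩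
    refine ⟨(Units.coeHom _).comp ρ₁, MonoidHom.ext fun g => ?_⟩
    have h1 : ρ₁ (proj ϖ k g) = ρ₀ g := MonoidHom.liftOfRightInverse_comp_apply _ _ _ _ g
    change ρ g = ((ρ₁ (proj ϖ k g) : (V →ₗ[ℂ] V)ˣ) : V →ₗ[ℂ] V)
    rw [h1]
    rfl

theorem twist_one {G : Type*} [Group G] (ρ : Representation ℂ G V) : twist 1 ρ = ρ := by
  ext g v
  simp [twist_apply]

variable {r l q : ℕ} {ψ : AddChar (Trunc ϖ r) ℂ} {k : Type*} [Field k] {f : Trunc ϖ r →+* k}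

/-- A representation is strongly primitive if and only if its orbit is not scalar modulo the
maximal ideal: the sublevel drops exactly when the last congruence subgroup acts by scalars. -/
theorem IsSetup.stronglyPrimitive_iff (h : IsSetup (Ideal.Quotient.mk _ ϖ) r l q ψ f)
    (hA : ∀ x : A, IsUnit x ∨ ϖ ∣ x) (V : FDRep ℂ (GL (Fin 2) (Trunc ϖ r))) :
    StronglyPrimitive ϖ r V ↔ Representation.IsIrreducible V.ρ ∧
      ∃ β : Matrix (Fin 2) (Fin 2) (Trunc ϖ r),
        Occurs (Ideal.span {Ideal.Quotient.mk _ ϖ ^ l}) ψ β V.ρ ∧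
        ¬ (Ideal.Quotient.mk _ ϖ ∣ β 0 1 ∧ Ideal.Quotient.mk _ ϖ ∣ β 1 0 ∧
          Ideal.Quotient.mk _ ϖ ∣ β 0 0 - β 1 1) := by
  have hr := h.chain.pos
  have hr2 : 0 < r - 1 := by
    have := h.even
    have := h.pos
    omega
  have hn : ¬ IsUnit ϖ := fun hu => h.chain.not_isUnit (hu.map _)
  have hself : Factors ϖ r (MonoidHom.comp V.ρ (proj ϖ r)) := ⟨V.ρ, rfl⟩
  have hself' : r ∈ {k | 0 < k ∧ ∃ χ : GL (Fin 2) A →* ℂˣ, SmoothChar ϖ χ ∧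
      Factors ϖ k (twist χ (MonoidHom.comp V.ρ (proj ϖ r)))} :=
    ⟨hr, 1, ⟨0, fun _ _ => rfl⟩, by rw [twist_one]; exact hself⟩
  constructor
  · rintro ⟨hρ, -, hsub⟩
    refine ⟨hρ, ?_⟩
    obtain ⟨β, ho⟩ := h.chain.exists_occurs h.psi h.le h.even.le hρ
    refine ⟨β, ho, fun hβ => ?_⟩
    obtain ⟨μ, hμ⟩ := h.exists_char (β 0 0)
    have hsc := h.scalar_of_dvd hρ ho hβ
    -- twisting by the inverse of `μ ∘ det` lowers the level
    let χ : GL (Fin 2) A →* ℂˣ := (μ⁻¹.comp GeneralLinearGroup.det).comp (proj ϖ r)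
    have hmem : r - 1 ∈ {k | 0 < k ∧ ∃ χ : GL (Fin 2) A →* ℂˣ, SmoothChar ϖ χ ∧
        Factors ϖ k (twist χ (MonoidHom.comp V.ρ (proj ϖ r)))} := by
      refine ⟨hr2, χ, ⟨r, fun g hg => ?_⟩, (factors_iff (proj_surjective hA hn hr2)).2
        fun g hg => ?_⟩
      · rw [MonoidHom.comp_apply, MonoidHom.mem_ker.1 hg, map_one]
      · rw [mem_ker_proj_iff (Nat.sub_le r 1)] at hg
        have hdet : ((GeneralLinearGroup.det (proj ϖ r g) : (Trunc ϖ r)ˣ) : Trunc ϖ r) - 1 ∈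
            Ideal.span {Ideal.Quotient.mk (Ideal.span {ϖ ^ r}) ϖ ^ (r - 1)} := by
          obtain ⟨X, hX⟩ := exists_eq_oneAdd (h.chain.pow_mul_pow h.le_two_mul_pred) hg
          rw [hX, det_oneAdd, add_sub_cancel_left]
          exact Ideal.mul_mem_right _ _ (Ideal.mem_span_singleton_self _)
        ext v
        change ((μ (GeneralLinearGroup.det (proj ϖ r g)))⁻¹ : ℂˣ) • V.ρ (proj ϖ r g) v = v
        have h1 := hsc _ hg v
        rw [← hμ _ hdet] at h1
        exact inv_smul_eq_iff.2 h1
    have h1 := Nat.sInf_le hmem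
    change sublevel ϖ (MonoidHom.comp V.ρ (proj ϖ r)) ≤ r - 1 at h1
    omega
  · rintro ⟨hρ, β, ho, hβ⟩
    have key : ∀ k, 0 < k → ∀ χ : GL (Fin 2) A →* ℂˣ,
        Factors ϖ k (twist χ (MonoidHom.comp V.ρ (proj ϖ r))) → r ≤ k := by
      intro k hk χ hF
      by_contra hlt
      have hle : k ≤ r - 1 := by omega
      refine hβ (h.dvd_of_scalar ho fun n hn' => ?_)
      obtain ⟨g, rfl⟩ := proj_surjective hA hn hr n
      have hg : g ∈ (proj ϖ k).ker := by
        rw [← mem_ker_proj_iff (Nat.sub_le r 1), mem_ker_proj] at hn'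
        exact mem_ker_proj.2 fun i j => (pow_dvd_pow ϖ hle).trans (hn' i j)
      have h1 := (factors_iff (proj_surjective hA hn hk)).1 hF g hg
      refine ⟨((χ g)⁻¹ : ℂˣ), fun v => ?_⟩
      have h2 : (χ g : ℂˣ) • V.ρ (proj ϖ r g) v = v := LinearMap.congr_fun h1 v
      exact eq_inv_smul_iff.2 h2
    refine ⟨hρ, le_antisymm (Nat.sInf_le ⟨hr, hself⟩) (le_csInf ⟨r, hr, hself⟩ ?_),
      le_antisymm (Nat.sInf_le hself') (le_csInf ⟨r, hself'⟩ ?_)⟩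
    · rintro k ⟨hk, hF⟩
      exact key k hk 1 (by rwa [twist_one])
    · rintro k ⟨hk, χ, -, hF⟩
      exact key k hk χ hF

end Primitive

section Types

variable {R : Type*} [CommRing R] {k : Type*} [Field k] {π : R} {r l q : ℕ}
  {ψ : AddChar R ℂ} {f : R →+* k}

/-- The orbits that are not scalar modulo the maximal ideal are of one of three types. -/
theorem IsSetup.exists_nonscalar_iff (h : IsSetup π r l q ψ f) (V : FDRep ℂ (GL (Fin 2) R)) :
    (Representation.IsIrreducible V.ρ ∧ ∃ β : Matrix (Fin 2) (Fin 2) R,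
        Occurs (Ideal.span {π ^ l}) ψ β V.ρ ∧ ¬ (π ∣ β 0 1 ∧ π ∣ β 1 0 ∧ π ∣ β 0 0 - β 1 1)) ↔
      OccursType (Ideal.span {π ^ l}) ψ f SplitType V ∨
        OccursType (Ideal.span {π ^ l}) ψ f IrredType V ∨
        OccursType (Ideal.span {π ^ l}) ψ f DoubleType V := by
  constructor
  · rintro ⟨hρ, β, ho, hβ⟩
    rw [← h.occurs_companion_iff hβ] at ho
    by_cases h1 : SplitType (f (det β)) (f (trace β))
    · exact Or.inl ⟨hρ, _, _, h1, ho⟩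
    · by_cases h2 : DoubleType (f (det β)) (f (trace β))
      · exact Or.inr (Or.inr ⟨hρ, _, _, h2, ho⟩)
      · exact Or.inr (Or.inl ⟨hρ, _, _, irredType_iff.2 ⟨h1, h2⟩, ho⟩)
  · have key : ∀ D, OccursType (Ideal.span {π ^ l}) ψ f D V →
        Representation.IsIrreducible V.ρ ∧ ∃ β : Matrix (Fin 2) (Fin 2) R,
          Occurs (Ideal.span {π ^ l}) ψ β V.ρ ∧
            ¬ (π ∣ β 0 1 ∧ π ∣ β 1 0 ∧ π ∣ β 0 0 - β 1 1) := by
      rintro D ⟨hρ, Δ, s, -, ho⟩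
      refine ⟨hρ, _, ho, fun h1 => h.chain.not_dvd_isUnit isUnit_one ?_⟩
      simpa [companion] using h1.1
    rintro (h1 | h1 | h1)
    · exact key _ h1
    · exact key _ h1
    · exact key _ h1

end Types

/-! ### Unramified quadratic extensions -/

section Unramified

variable {A B : Type*} [CommRing A] [CommRing B] [Algebra A B]

/-- `B` is a quadratic extension of the discrete valuation ring `A`, in which the uniformizer `ϖ`
remains prime, and `σ` is its non-trivial automorphism. The field `eq_zero` says that `A` is
separated for the `ϖ`-adic topology, and `exists_sq` that the residue field of `A` is perfect if its
characteristic is `2`. -/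
structure IsUnramifiedQuad (ϖ : A) (σ : B ≃ₐ[A] B) : Prop where
  injective : Function.Injective (algebraMap A B)
  isUnit_or : ∀ x : A, IsUnit x ∨ ϖ ∣ x
  ne_zero : ϖ ≠ 0
  eq_zero : ∀ x : A, (∀ n : ℕ, ϖ ^ n ∣ x) → x = 0
  exists_sq : ϖ ∣ 2 → ∀ x : A, ∃ c, ϖ ∣ c ^ 2 - x
  maximal : (Ideal.span {algebraMap A B ϖ}).IsMaximal
  involutive : ∀ b, σ (σ b) = b
  fixed : ∀ b, σ b = b → ∃ a, algebraMap A B a = b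
  exists_ne : ∃ b, σ b ≠ b

namespace IsUnramifiedQuad

variable {ϖ : A} {σ : B ≃ₐ[A] B}

theorem map_ne_zero [IsDomain B] (e : IsUnramifiedQuad ϖ σ) (n : ℕ) :
    algebraMap A B (ϖ ^ n) ≠ 0 := by
  rw [map_pow]
  refine pow_ne_zero _ fun h => e.ne_zero (e.injective ?_)
  rw [h, map_zero]

/-- The quotient of two elements of `A` is fixed by `σ`, so it belongs to `A`. -/
theorem pow_dvd [IsDomain B] (e : IsUnramifiedQuad ϖ σ) {n : ℕ} {a : A}
    (h : algebraMap A B (ϖ ^ n) ∣ algebraMap A B a) : ϖ ^ n ∣ a := by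
  obtain ⟨b, hb⟩ := h
  have h1 := congrArg σ hb
  rw [map_mul, AlgEquiv.commutes, AlgEquiv.commutes, hb] at h1
  obtain ⟨c, rfl⟩ := e.fixed b (mul_left_cancel₀ (e.map_ne_zero n) h1).symm
  exact ⟨c, e.injective (by rw [hb, map_mul])⟩

theorem dvd_mul_iff (e : IsUnramifiedQuad ϖ σ) {x y : B} :
    algebraMap A B ϖ ∣ x * y ↔ algebraMap A B ϖ ∣ x ∨ algebraMap A B ϖ ∣ y := by
  have := e.maximal.isPrime
  simpa only [Ideal.mem_span_singleton] using this.mul_mem_iff_mem_or_mem (x := x) (y := y)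

/-- The automorphism acts non-trivially on the residue field. Otherwise every element of `B` is
congruent to an element of `A`, because the residue field is perfect, and `b - σ(b)` is infinitely
divisible by `ϖ`. -/
theorem exists_not_dvd [IsDomain B] (e : IsUnramifiedQuad ϖ σ) :
    ∃ ω, ¬ algebraMap A B ϖ ∣ ω - σ ω := by
  by_contra! hall
  have hlift : ∀ b : B, ∃ c : A, algebraMap A B ϖ ∣ b - algebraMap A B c := by
    intro b
    rcases e.isUnit_or 2 with ⟨u, hu⟩ | h2
    · obtain ⟨t, ht⟩ := e.fixed (b + σ b) (by rw [map_add, e.involutive, add_comm])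
      refine ⟨((u⁻¹ : Aˣ) : A) * t, ?_⟩
      have h1 : algebraMap A B ((u⁻¹ : Aˣ) : A) * 2 = 1 := by
        rw [← map_ofNat (algebraMap A B), ← hu, ← map_mul, Units.inv_mul, map_one]
      have h2 : b - algebraMap A B (((u⁻¹ : Aˣ) : A) * t) =
          algebraMap A B ((u⁻¹ : Aˣ) : A) * (b - σ b) := by
        rw [map_mul, ht]
        linear_combination (-b) * h1
      rw [h2]
      exact (hall b).mul_left _
    · obtain ⟨n, hn⟩ := e.fixed (b * σ b) (by rw [map_mul, e.involutive, mul_comm])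
      obtain ⟨c, hc⟩ := e.exists_sq h2 n
      refine ⟨c, ?_⟩
      have h3 : algebraMap A B ϖ ∣ (b - algebraMap A B c) * (b - algebraMap A B c) := by
        have h4 := map_dvd (algebraMap A B) hc
        have h5 := map_dvd (algebraMap A B) h2
        rw [map_sub, map_pow, hn] at h4
        rw [map_ofNat] at h5
        have := dvd_add (dvd_add (dvd_sub ((hall b).mul_left b)
          (h5.mul_right (b * algebraMap A B c))) h4) (h5.mul_right (b * σ b))
        convert this using 1
        ring
      exact (e.dvd_mul_iff.1 h3).elim id id
  obtain ⟨b, hb⟩ := e.exists_ne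
  have hdiv : ∀ (n : ℕ) (b : B), ∃ b', b - σ b = algebraMap A B (ϖ ^ n) * (b' - σ b') := by
    intro n
    induction n with
    | zero => exact fun b => ⟨b, by simp⟩
    | succ n ih =>
      intro b
      obtain ⟨b', hb'⟩ := ih b
      obtain ⟨c, b'', hc⟩ := hlift b'
      refine ⟨b'', ?_⟩
      have h1 : b' = algebraMap A B c + algebraMap A B ϖ * b'' := by linear_combination hc
      rw [hb', h1, map_add, map_mul, AlgEquiv.commutes, AlgEquiv.commutes, pow_succ, map_mul]
      ring
  obtain ⟨d, hd⟩ := e.fixed ((b - σ b) ^ 2) (by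
    rw [map_pow, map_sub, e.involutive]; ring)
  have hd0 : d = 0 := e.eq_zero d fun n => by
    refine e.pow_dvd ?_
    obtain ⟨b', hb'⟩ := hdiv n b
    rw [hd, hb', mul_pow, pow_two]
    exact (dvd_mul_right _ _).mul_right _
  rw [hd0, map_zero] at hd
  exact hb (sub_eq_zero.1 (pow_eq_zero_iff two_ne_zero |>.1 hd.symm)).symm

/-- The square of `ω - σ(ω)` is fixed by `σ`, so it belongs to `A`, where units are detected modulo
`ϖ`. -/
theorem isUnit_of_not_dvd (e : IsUnramifiedQuad ϖ σ) {ω : B}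
    (hω : ¬ algebraMap A B ϖ ∣ ω - σ ω) : IsUnit (ω - σ ω) := by
  obtain ⟨d, hd⟩ := e.fixed ((ω - σ ω) * (ω - σ ω)) (by
    rw [map_mul, map_sub, e.involutive]; ring)
  have hu : IsUnit d := (e.isUnit_or d).resolve_right fun h => by
    have h1 := map_dvd (algebraMap A B) h
    rw [hd, e.dvd_mul_iff] at h1
    exact hω (h1.elim id id)
  have h2 := hu.map (algebraMap A B)
  rw [hd] at h2
  exact isUnit_of_mul_isUnit_left h2

/-- The truncation of an unramified quadratic extension. -/
theorem isQuadExt [IsDomain B] (e : IsUnramifiedQuad ϖ σ) (r : ℕ) :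
    IsQuadExt (Ideal.Quotient.mk (Ideal.span {ϖ ^ r}) ϖ) (truncMap B ϖ r) (truncAut ϖ r σ) := by
  have hι : ∀ a, truncMap B ϖ r (Ideal.Quotient.mk _ a) = Ideal.Quotient.mk _ (algebraMap A B a) :=
    fun a => rfl
  have hσ : ∀ b, truncAut ϖ r σ (Ideal.Quotient.mk _ b) = Ideal.Quotient.mk _ (σ b) := fun b => rfl
  have hmk : ∀ b, (Ideal.Quotient.mk (Ideal.span {algebraMap A B ϖ ^ r}) b = 0) ↔
      algebraMap A B (ϖ ^ r) ∣ b := fun b => by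
    rw [Ideal.Quotient.eq_zero_iff_mem, Ideal.mem_span_singleton, map_pow]
  obtain ⟨ω, hω⟩ := e.exists_not_dvd
  have hu := e.isUnit_of_not_dvd hω
  refine ⟨?_, ?_, ?_, ?_, ⟨Ideal.Quotient.mk _ ω, hu.map (Ideal.Quotient.mk _)⟩, ?_⟩
  · rw [injective_iff_map_eq_zero]
    intro x hx
    obtain ⟨a, rfl⟩ := Ideal.Quotient.mk_surjective x
    rw [hι, hmk] at hx
    rw [Ideal.Quotient.eq_zero_iff_mem, Ideal.mem_span_singleton]
    exact e.pow_dvd hx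
  · intro x
    obtain ⟨a, rfl⟩ := Ideal.Quotient.mk_surjective x
    rw [hι, hσ, AlgEquiv.commutes]
  · intro z
    obtain ⟨b, rfl⟩ := Ideal.Quotient.mk_surjective z
    rw [hσ, hσ, e.involutive]
  · intro z hz
    obtain ⟨b, rfl⟩ := Ideal.Quotient.mk_surjective z
    rw [hσ, eq_comm, ← sub_eq_zero, ← map_sub, hmk] at hz
    -- `b = x + y ω` with `y = (b - σ(b)) / (ω - σ(ω))`
    obtain ⟨u, hu⟩ := hu
    have hσu : σ u = -u := by rw [hu, map_sub, e.involutive, neg_sub]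
    obtain ⟨c, hc⟩ := hz
    have hc' : σ c = -c := by
      have h1 := congrArg σ hc
      rw [map_sub, e.involutive, map_mul, AlgEquiv.commutes] at h1
      refine mul_left_cancel₀ (e.map_ne_zero r) ?_
      linear_combination -h1 - hc
    obtain ⟨y, hy⟩ := e.fixed (c * ((u⁻¹ : Bˣ) : B)) (by
      refine u.isUnit.mul_right_cancel ?_
      have h1 : σ ((u⁻¹ : Bˣ) : B) * σ u = 1 := by rw [← map_mul, Units.inv_mul, map_one]
      have h2 := u.inv_mul
      rw [hσu] at h1
      rw [map_mul, hc']
      linear_combination c * h1 - c * h2)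
    have hy' : algebraMap A B y * (ω - σ ω) = c := by
      rw [hy, ← hu, mul_assoc, Units.inv_mul, mul_one]
    obtain ⟨x, hx⟩ := e.fixed (b - algebraMap A B (ϖ ^ r) * (algebraMap A B y * ω)) (by
      rw [map_sub, map_mul, map_mul, AlgEquiv.commutes, AlgEquiv.commutes]
      linear_combination -hc + algebraMap A B (ϖ ^ r) * hy')
    refine ⟨Ideal.Quotient.mk _ x, ?_⟩
    rw [hι, hx, ← sub_eq_zero, ← map_sub, hmk]
    exact ⟨-(algebraMap A B y * ω), by ring⟩
  · intro z
    obtain ⟨b, rfl⟩ := Ideal.Quotient.mk_surjective z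
    by_cases hb : algebraMap A B ϖ ∣ b
    · exact Or.inr (map_dvd (Ideal.Quotient.mk _) hb)
    · left
      have h1 : b ∉ Ideal.span {algebraMap A B ϖ} := by rwa [Ideal.mem_span_singleton]
      obtain ⟨c, hc⟩ := e.maximal.exists_inv h1
      obtain ⟨c', m, hm, hcm⟩ : ∃ c' m, m ∈ Ideal.span {algebraMap A B ϖ} ∧ c' * b + m = 1 := by
        exact ⟨c, hc⟩
      obtain ⟨w, rfl⟩ := Ideal.mem_span_singleton.1 hm
      have hnil : IsNilpotent (Ideal.Quotient.mk (Ideal.span {algebraMap A B ϖ ^ r})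
          (algebraMap A B ϖ * w)) := ⟨r, by
        rw [map_mul, mul_pow, ← map_pow (Ideal.Quotient.mk _) (algebraMap A B ϖ),
          (hmk _).2 (by rw [map_pow]), zero_mul]⟩
      have h2 := hnil.isUnit_one_sub
      rw [← map_one (Ideal.Quotient.mk _), ← map_sub, ← hcm, add_sub_cancel_right, map_mul] at h2
      exact isUnit_of_mul_isUnit_right h2

end IsUnramifiedQuad

end Unramified

/-! ### Non-archimedean local fields -/

section LocalField

theorem isChain_trunc {A : Type*} [CommRing A] [IsDomain A] {ϖ : A} {q : ℕ}
    (hA : ∀ x : A, IsUnit x ∨ ϖ ∣ x) (h0 : ϖ ≠ 0) (hu : ¬ IsUnit ϖ)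
    [Finite (A ⧸ Ideal.span {ϖ})] (hq : Nat.card (A ⧸ Ideal.span {ϖ}) = q) {r : ℕ} (hr : 0 < r) :
    IsChain (Trunc ϖ r) (Ideal.Quotient.mk (Ideal.span {ϖ ^ r}) ϖ) r q where
  finite := by
    have h1 := Ideal.finite_quotient_pow (I := Ideal.span {ϖ}) ⟨{ϖ}, by simp⟩ r
    rwa [Ideal.span_singleton_pow] at h1
  isUnit_or x := by
    obtain ⟨a, rfl⟩ := Ideal.Quotient.mk_surjective x
    exact (hA a).imp (fun h => h.map _) (fun h => map_dvd _ h)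
  not_isUnit := not_isUnit_mk hu hr dvd_rfl
  pow_eq := by
    rw [← map_pow, Ideal.Quotient.eq_zero_iff_mem]
    exact Ideal.mem_span_singleton_self _
  dvd_of_mul i hi x hx := by
    obtain ⟨a, rfl⟩ := Ideal.Quotient.mk_surjective x
    rw [← map_pow, ← map_mul, Ideal.Quotient.eq_zero_iff_mem, Ideal.mem_span_singleton] at hx
    rw [← map_pow]
    refine map_dvd _ ?_
    rw [show r = i + (r - i) by omega, pow_add] at hx
    exact (mul_dvd_mul_iff_left (pow_ne_zero i h0)).1 hx
  card_residue := by
    rw [← hq]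
    have h1 := DoubleQuot.quotQuotEquivQuotOfLE (I := Ideal.span {ϖ ^ r}) (J := Ideal.span {ϖ})
      (by rw [Ideal.span_singleton_le_span_singleton]; exact dvd_pow_self ϖ hr.ne')
    rw [Ideal.map_span, Set.image_singleton] at h1
    exact Nat.card_congr h1.toEquiv

variable {F : Type*} [Field F] {E : Type*} [Field E] [Algebra F E]

/-- The fixed field of the non-trivial automorphism of a quadratic extension. -/
theorem fixed_of_finrank_eq_two (hE : Module.finrank F E = 2) (σ : E ≃ₐ[F] E)
    (hσ : σ ≠ AlgEquiv.refl) :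
    (∀ x, σ (σ x) = x) ∧ ∀ x, σ x = x → ∃ y, algebraMap F E y = x := by
  have : FiniteDimensional F E := FiniteDimensional.of_finrank_pos (by omega)
  let H : Subgroup (E ≃ₐ[F] E) := Subgroup.zpowers σ
  have h1 := IntermediateField.finrank_fixedField_eq_card H
  have h2 := Module.finrank_mul_finrank F (IntermediateField.fixedField H) E
  have h3 : 1 < Nat.card H := by
    rw [Nat.card_zpowers]
    have h4 : orderOf σ ≠ 1 := fun h => hσ (orderOf_eq_one_iff.1 h)
    have h5 : orderOf σ ≠ 0 := (orderOf_pos σ).ne'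
    omega
  rw [h1, hE] at h2
  have h4 : Nat.card H = 2 := by
    have := Nat.le_of_dvd two_pos (Dvd.intro_left _ h2)
    omega
  have h5 : Module.finrank F (IntermediateField.fixedField H) = 1 := by
    rw [h4] at h2; omega
  constructor
  · intro x
    have h6 : σ ^ 2 = 1 := by rw [← h4, Nat.card_zpowers, pow_orderOf_eq_one]
    have := AlgEquiv.congr_fun h6 x
    rwa [pow_two] at this
  · intro x hx
    have h6 : x ∈ IntermediateField.fixedField H := by
      rintro ⟨g, n, rfl⟩
      change (σ ^ n) x = x
      have h7 : σ ∈ MulAction.stabilizer (E ≃ₐ[F] E) x := hx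
      exact Subgroup.zpow_mem _ h7 n
    rw [IntermediateField.finrank_eq_one_iff] at h5
    rw [h5] at h6
    exact IntermediateField.mem_bot.1 h6

variable [ValuativeRel F] [TopologicalSpace F] [IsNonarchimedeanLocalField F]

theorem isUnit_or_dvd {ϖ : 𝒪[F]} (hϖ : Irreducible ϖ) (x : 𝒪[F]) : IsUnit x ∨ ϖ ∣ x := by
  rw [← Ideal.mem_span_singleton, ← hϖ.maximalIdeal_eq, IsLocalRing.mem_maximalIdeal]
  exact em _

theorem isUnramifiedQuad {ϖ : 𝒪[F]} (hϖ : Irreducible ϖ) (hE : Module.finrank F E = 2)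
    (hunr : (Ideal.span {algebraMap 𝒪[F] (integralClosure 𝒪[F] E) ϖ}).IsMaximal)
    (σ : E ≃ₐ[F] E) (hσ : σ ≠ AlgEquiv.refl) :
    IsUnramifiedQuad ϖ ((σ.restrictScalars 𝒪[F]).mapIntegralClosure) := by
  obtain ⟨hinv, hfix⟩ := fixed_of_finrank_eq_two hE σ hσ
  have : FiniteDimensional F E := FiniteDimensional.of_finrank_pos (by omega)
  have hcoe : ∀ b : integralClosure 𝒪[F] E,
      (((σ.restrictScalars 𝒪[F]).mapIntegralClosure b : integralClosure 𝒪[F] E) : E) = σ b :=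
    fun b => rfl
  refine ⟨?_, isUnit_or_dvd hϖ, hϖ.ne_zero, ?_, ?_, hunr, ?_, ?_, ?_⟩
  · intro x y hxy
    have h1 := congrArg (Subtype.val) hxy
    change algebraMap 𝒪[F] E x = algebraMap 𝒪[F] E y at h1
    rw [IsScalarTower.algebraMap_apply 𝒪[F] F E, IsScalarTower.algebraMap_apply 𝒪[F] F E] at h1
    exact IsFractionRing.injective 𝒪[F] F ((algebraMap F E).injective h1)
  · intro x hx
    by_contra h0
    obtain ⟨n, u, rfl⟩ := IsDiscreteValuationRing.eq_unit_mul_pow_irreducible h0 hϖ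
    have h1 := hx (n + 1)
    rw [mul_comm, Units.dvd_mul_right, pow_dvd_pow_iff hϖ.ne_zero hϖ.not_isUnit] at h1
    omega
  · intro h2 x
    have : Fintype 𝓀[F] := Fintype.ofFinite _
    have h3 : (2 : 𝓀[F]) = 0 := by
      have h4 : IsLocalRing.residue 𝒪[F] 2 = 0 := by
        rw [IsLocalRing.residue_eq_zero_iff, hϖ.maximalIdeal_eq]
        exact Ideal.mem_span_singleton.2 h2
      rwa [map_ofNat] at h4
    have h5 : CharP 𝓀[F] 2 := CharTwo.of_one_ne_zero_of_two_eq_zero one_ne_zero h3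
    obtain ⟨y, hy⟩ := FiniteField.isSquare_of_char_two (ringChar.eq 𝓀[F] 2 ▸ rfl)
      (IsLocalRing.residue 𝒪[F] x)
    obtain ⟨c, rfl⟩ := IsLocalRing.residue_surjective y
    refine ⟨c, ?_⟩
    rw [← Ideal.mem_span_singleton, ← hϖ.maximalIdeal_eq, ← IsLocalRing.residue_eq_zero_iff,
      map_sub, map_pow, hy, pow_two, sub_self]
  · intro b
    exact Subtype.ext (hinv b)
  · intro b hb
    obtain ⟨y, hy⟩ := hfix b (congrArg Subtype.val hb)
    have hint : IsIntegral 𝒪[F] y := by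
      rw [← isIntegral_algebraMap_iff (algebraMap F E).injective, hy]
      exact b.2
    obtain ⟨a, ha⟩ := IsIntegrallyClosed.isIntegral_iff.1 hint
    refine ⟨a, Subtype.ext ?_⟩
    change algebraMap 𝒪[F] E a = b
    rw [IsScalarTower.algebraMap_apply 𝒪[F] F E, ha, hy]
  · by_contra! hall
    refine hσ (AlgEquiv.ext fun x => ?_)
    have halg : IsAlgebraic 𝒪[F] x :=
      (IsFractionRing.isAlgebraic_iff 𝒪[F] F E).2 (Algebra.IsAlgebraic.isAlgebraic x)
    obtain ⟨a, ha, hax⟩ := halg.exists_integral_multiple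
    have h1 := congrArg Subtype.val (hall ⟨a • x, hax⟩)
    rw [hcoe] at h1
    change σ (a • x) = a • x at h1
    rw [Algebra.smul_def, IsScalarTower.algebraMap_apply 𝒪[F] F E, map_mul, AlgEquiv.commutes] at h1
    refine mul_left_cancel₀ ?_ h1
    intro h2
    rw [map_eq_zero] at h2
    exact ha (IsFractionRing.injective 𝒪[F] F (by rw [h2, map_zero]))

end LocalField

/-! ### The three families -/

section Arithmetic

variable {q r d : ℕ}

/-- In this and the next two lemmas the index of the stabilizer of `ψ_β` is written out, from the
number of units of `k[β]`. -/
theorem finrank_split (hq : 1 < q) (hr : 2 ≤ r)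
    (h : d * ((q - 1) * (q - 1)) = q ^ (r - 2) * ((q ^ 2 - 1) * (q ^ 2 - q))) :
    d = (q + 1) * q ^ (r - 1) := by
  obtain ⟨m, rfl⟩ : ∃ m, q = m + 2 := ⟨q - 2, by omega⟩
  obtain ⟨n, rfl⟩ : ∃ n, r = n + 2 := ⟨r - 2, by omega⟩
  have h1 : (m + 2) ^ 2 - 1 = (m + 1) * (m + 3) := Nat.sub_eq_of_eq_add (by ring)
  have h2 : (m + 2) ^ 2 - (m + 2) = (m + 1) * (m + 2) := Nat.sub_eq_of_eq_add (by ring)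
  rw [h1, h2] at h
  simp only [Nat.add_sub_cancel, show n + 2 - 1 = n + 1 by omega,
    show m + 2 - 1 = m + 1 by omega] at h ⊢
  refine Nat.eq_of_mul_eq_mul_right (show 0 < (m + 1) * (m + 1) by positivity) ?_
  rw [h]
  ring

theorem finrank_irred (hq : 1 < q) (hr : 2 ≤ r)
    (h : d * (q * q - 1) = q ^ (r - 2) * ((q ^ 2 - 1) * (q ^ 2 - q))) :
    d = (q - 1) * q ^ (r - 1) := by
  obtain ⟨m, rfl⟩ : ∃ m, q = m + 2 := ⟨q - 2, by omega⟩
  obtain ⟨n, rfl⟩ : ∃ n, r = n + 2 := ⟨r - 2, by omega⟩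
  have h1 : (m + 2) ^ 2 - 1 = (m + 1) * (m + 3) := Nat.sub_eq_of_eq_add (by ring)
  have h2 : (m + 2) ^ 2 - (m + 2) = (m + 1) * (m + 2) := Nat.sub_eq_of_eq_add (by ring)
  rw [← pow_two, h1, h2] at h
  simp only [Nat.add_sub_cancel, show n + 2 - 1 = n + 1 by omega,
    show m + 2 - 1 = m + 1 by omega] at h ⊢
  refine Nat.eq_of_mul_eq_mul_right (show 0 < (m + 1) * (m + 3) by positivity) ?_
  rw [h]
  ring

theorem finrank_double (hq : 1 < q)
    (h : d * ((q - 1) * q) = q ^ (r - 2) * ((q ^ 2 - 1) * (q ^ 2 - q))) :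
    d = (q ^ 2 - 1) * q ^ (r - 2) := by
  have h2 : q ^ 2 - q = (q - 1) * q := by rw [pow_two, Nat.sub_mul, one_mul]
  rw [h2, ← mul_assoc (q ^ (r - 2))] at h
  have hpos : 0 < (q - 1) * q := Nat.mul_pos (by omega) (by omega)
  have := Nat.eq_of_mul_eq_mul_right hpos h
  rw [this, mul_comm]

end Arithmetic

section Families

variable {A : Type*} [CommRing A] {ϖ : A} {r l q : ℕ} {ψ : AddChar (Trunc ϖ r) ℂ}
  {k : Type*} [Field k] {f : Trunc ϖ r →+* k}

theorem mem_lvl_one {x : Trunc ϖ r} : x ∈ lvl ϖ r 1 ↔ Ideal.Quotient.mk _ ϖ ∣ x := by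
  rw [lvl, pow_one, Ideal.mem_span_singleton]

namespace IsSetup

theorem mem_lvl_iff (h : IsSetup (Ideal.Quotient.mk _ ϖ) r l q ψ f) {x : Trunc ϖ r} :
    x ∈ lvl ϖ r 1 ↔ f x = 0 := by
  rw [mem_lvl_one, h.residue.eq_zero_iff]

theorem two_le (h : IsSetup (Ideal.Quotient.mk _ ϖ) r l q ψ f) : 2 ≤ r := by
  have := h.even
  have := h.pos
  omega

theorem isPrincipalSplit_iff (h : IsSetup (Ideal.Quotient.mk _ ϖ) r l q ψ f)
    (V : FDRep ℂ (GL (Fin 2) (Trunc ϖ r))) :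
    IsPrincipalSplit ϖ l ψ V ↔
      OccursType (Ideal.span {Ideal.Quotient.mk _ ϖ ^ l}) ψ f SplitType V := by
  refine and_congr_right fun _ => ?_
  rw [← h.occurs_split_iff]
  refine exists_congr fun a => exists_congr fun d => and_congr_left fun _ => ?_
  rw [h.mem_lvl_iff, map_sub, sub_eq_zero]

theorem isNonPrincipalSplit_iff (h : IsSetup (Ideal.Quotient.mk _ ϖ) r l q ψ f)
    (V : FDRep ℂ (GL (Fin 2) (Trunc ϖ r))) :
    IsNonPrincipalSplit ϖ l ψ V ↔
      OccursType (Ideal.span {Ideal.Quotient.mk _ ϖ ^ l}) ψ f DoubleType V := by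
  refine and_congr_right fun _ => ?_
  rw [← h.occurs_double_iff]
  simp only [mem_lvl_one]
  rfl

theorem irreducible_iff (h : IsSetup (Ideal.Quotient.mk _ ϖ) r l q ψ f) (Δ s : Trunc ϖ r) :
    Irreducible (Polynomial.X ^ 2
      - Polynomial.C (Ideal.Quotient.mk (lvl ϖ r 1) s) * Polynomial.X
      + Polynomial.C (Ideal.Quotient.mk (lvl ϖ r 1) Δ)) ↔ IrredType (f Δ) (f s) := by
  have hmax : (lvl ϖ r 1).IsMaximal := by
    have := h.chain.isMaximal
    rwa [lvl, pow_one]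
  let _ : Field (Trunc ϖ r ⧸ lvl ϖ r 1) := Ideal.Quotient.field _
  set P : Polynomial (Trunc ϖ r ⧸ lvl ϖ r 1) := Polynomial.X ^ 2
      - Polynomial.C (Ideal.Quotient.mk (lvl ϖ r 1) s) * Polynomial.X
      + Polynomial.C (Ideal.Quotient.mk (lvl ϖ r 1) Δ) with hP
  have hm : P.Monic := by rw [hP]; monicity!
  have hd : P.natDegree = 2 := by rw [hP]; compute_degree!
  rw [hm.irreducible_iff_roots_eq_zero_of_degree_le_three (by omega) (by omega),
    Multiset.eq_zero_iff_forall_notMem]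
  have key : ∀ x : Trunc ϖ r, Ideal.Quotient.mk (lvl ϖ r 1) x ∈ P.roots ↔
      f x ^ 2 - f s * f x + f Δ = 0 := fun x => by
    have h1 : P.eval (Ideal.Quotient.mk (lvl ϖ r 1) x) =
        Ideal.Quotient.mk (lvl ϖ r 1) (x ^ 2 - s * x + Δ) := by
      rw [hP]
      simp only [Polynomial.eval_add, Polynomial.eval_sub, Polynomial.eval_mul, Polynomial.eval_pow,
        Polynomial.eval_X, Polynomial.eval_C, map_add, map_sub, map_mul, map_pow]
    rw [Polynomial.mem_roots hm.ne_zero, Polynomial.IsRoot, h1, Ideal.Quotient.eq_zero_iff_mem,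
      h.mem_lvl_iff, map_add, map_sub, map_mul, map_pow]
  constructor
  · intro hr x
    obtain ⟨x, rfl⟩ := h.residue.surjective x
    exact fun h0 => hr _ ((key x).2 h0)
  · intro hr x hx
    obtain ⟨x, rfl⟩ := Ideal.Quotient.mk_surjective x
    exact hr (f x) ((key x).1 hx)

theorem isCuspidal_iff (h : IsSetup (Ideal.Quotient.mk _ ϖ) r l q ψ f)
    (V : FDRep ℂ (GL (Fin 2) (Trunc ϖ r))) :
    IsCuspidal ϖ l ψ V ↔
      OccursType (Ideal.span {Ideal.Quotient.mk _ ϖ ^ l}) ψ f IrredType V := by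
  refine and_congr_right fun _ => exists_congr fun Δ => exists_congr fun s => ?_
  rw [h.irreducible_iff]
  rfl

theorem card_k (h : IsSetup (Ideal.Quotient.mk _ ϖ) r l q ψ f) : Nat.card k = q :=
  h.chain.card_k h.residue

section Counting

theorem finrank_isPrincipalSplit (h : IsSetup (Ideal.Quotient.mk _ ϖ) r l q ψ f)
    {V : FDRep ℂ (GL (Fin 2) (Trunc ϖ r))} (hV : IsPrincipalSplit ϖ l ψ V) :
    Module.finrank ℂ V = (q + 1) * q ^ (r - 1) := by
  have := h.chain.finite_k h.residue
  exact finrank_split (h.chain.one_lt_q h.residue) h.two_le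
    (h.finrank_mul (fun _ _ => card_form_split h.card_k) ((h.isPrincipalSplit_iff V).1 hV))

theorem finrank_isCuspidal (h : IsSetup (Ideal.Quotient.mk _ ϖ) r l q ψ f)
    {V : FDRep ℂ (GL (Fin 2) (Trunc ϖ r))} (hV : IsCuspidal ϖ l ψ V) :
    Module.finrank ℂ V = (q - 1) * q ^ (r - 1) := by
  have := h.chain.finite_k h.residue
  exact finrank_irred (h.chain.one_lt_q h.residue) h.two_le
    (h.finrank_mul (fun _ _ => card_form_irred h.card_k) ((h.isCuspidal_iff V).1 hV))

theorem finrank_isNonPrincipalSplit (h : IsSetup (Ideal.Quotient.mk _ ϖ) r l q ψ f)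
    {V : FDRep ℂ (GL (Fin 2) (Trunc ϖ r))} (hV : IsNonPrincipalSplit ϖ l ψ V) :
    Module.finrank ℂ V = (q ^ 2 - 1) * q ^ (r - 2) := by
  have := h.chain.finite_k h.residue
  exact finrank_double (h.chain.one_lt_q h.residue)
    (h.finrank_mul (fun _ _ => card_form_double h.card_k) ((h.isNonPrincipalSplit_iff V).1 hV))

/-- The number of isomorphism classes, with the powers of `q` cancelled. -/
theorem numIso_eq (h : IsSetup (Ideal.Quotient.mk _ ϖ) r l q ψ f) {D : k → k → Prop} {u : ℕ}
    (hu : ∀ Δ s, D Δ s → Nat.card {p : k × k // p.1 ^ 2 + s * p.1 * p.2 + Δ * p.2 ^ 2 ≠ 0} = u) :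
    (numIso (OccursType (Ideal.span {Ideal.Quotient.mk _ ϖ ^ l}) ψ f D) : ℚ) * q =
      q ^ (2 * r - 3) * Nat.card {p : k × k // D p.1 p.2} * u := by
  have h1 := (h.numIso_occursType hu).1
  have hq : (q : ℚ) ≠ 0 := by
    have := h.chain.one_lt_q h.residue
    exact_mod_cast (by omega : q ≠ 0)
  have h2 : 2 * r = 2 * r - 3 + 3 := by
    have := h.two_le
    omega
  have h3 : (numIso (OccursType (Ideal.span {Ideal.Quotient.mk _ ϖ ^ l}) ψ f D) : ℚ) * q ^ 4 =
      q ^ (2 * r) * Nat.card {p : k × k // D p.1 p.2} * u := by exact_mod_cast h1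
  rw [h2, pow_add] at h3
  refine mul_right_cancel₀ (pow_ne_zero 3 hq) ?_
  linear_combination h3

theorem numIso_congr {G : Type*} [Group G] {P Q : FDRep ℂ G → Prop} (h : ∀ V, P V ↔ Q V) :
    numIso P = numIso Q := by rw [funext fun V => propext (h V)]

theorem numIso_isPrincipalSplit (h : IsSetup (Ideal.Quotient.mk _ ϖ) r l q ψ f) :
    (numIso (IsPrincipalSplit ϖ l ψ) : ℚ) = 1 / 2 * (q - 1) ^ 3 * q ^ (2 * r - 3) := by
  have := h.chain.finite_k h.residue
  have hq := h.chain.one_lt_q h.residue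
  have h1 := h.numIso_eq fun Δ s => card_form_split h.card_k (Δ := Δ) (s := s)
  have h2 : (2 : ℚ) * Nat.card {p : k × k // SplitType p.1 p.2} = q * (q - 1) := by
    have := two_mul_card_splitType h.card_k
    rw [← Nat.cast_pred (by omega)]
    exact_mod_cast this
  rw [Nat.cast_mul, Nat.cast_pred (by omega)] at h1
  rw [numIso_congr h.isPrincipalSplit_iff]
  refine mul_right_cancel₀ (b := (q : ℚ)) (by exact_mod_cast (by omega : q ≠ 0)) ?_
  rw [h1]
  linear_combination (1 / 2 * (q : ℚ) ^ (2 * r - 3) * (q - 1) ^ 2) * h2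

theorem numIso_isCuspidal (h : IsSetup (Ideal.Quotient.mk _ ϖ) r l q ψ f) :
    (numIso (IsCuspidal ϖ l ψ) : ℚ) = 1 / 2 * (q - 1) * (q ^ 2 - 1) * q ^ (2 * r - 3) := by
  have := h.chain.finite_k h.residue
  have hq := h.chain.one_lt_q h.residue
  have h1 := h.numIso_eq fun Δ s => card_form_irred h.card_k (Δ := Δ) (s := s)
  have h2 : (2 : ℚ) * Nat.card {p : k × k // IrredType p.1 p.2} = q * (q - 1) := by
    have := two_mul_card_irredType h.card_k
    rw [← Nat.cast_pred (by omega)]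
    exact_mod_cast this
  rw [Nat.cast_pred (by positivity), Nat.cast_mul] at h1
  rw [numIso_congr h.isCuspidal_iff]
  refine mul_right_cancel₀ (b := (q : ℚ)) (by exact_mod_cast (by omega : q ≠ 0)) ?_
  rw [h1]
  linear_combination (1 / 2 * (q : ℚ) ^ (2 * r - 3) * (q ^ 2 - 1)) * h2

theorem numIso_isNonPrincipalSplit (h : IsSetup (Ideal.Quotient.mk _ ϖ) r l q ψ f) :
    (numIso (IsNonPrincipalSplit ϖ l ψ) : ℚ) = (q - 1) * q ^ (2 * r - 2) := by
  have := h.chain.finite_k h.residue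
  have hq := h.chain.one_lt_q h.residue
  have h1 := h.numIso_eq fun Δ s => card_form_double h.card_k (Δ := Δ) (s := s)
  rw [card_doubleType h.card_k, Nat.cast_mul, Nat.cast_pred (by omega)] at h1
  rw [numIso_congr h.isNonPrincipalSplit_iff]
  refine mul_right_cancel₀ (b := (q : ℚ)) (by exact_mod_cast (by omega : q ≠ 0)) ?_
  have h2 : 2 * r - 2 = 2 * r - 3 + 1 := by
    have := h.two_le
    omega
  rw [h1, h2, pow_succ]
  ring

theorem not_split_and_cuspidal (h : IsSetup (Ideal.Quotient.mk _ ϖ) r l q ψ f)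
    (V : FDRep ℂ (GL (Fin 2) (Trunc ϖ r))) :
    ¬ (IsPrincipalSplit ϖ l ψ V ∧ IsCuspidal ϖ l ψ V) := by
  rw [h.isPrincipalSplit_iff, h.isCuspidal_iff]
  exact h.not_occursType_and (fun _ _ h1 => (irredType_iff.1 h1.2).1 h1.1) V

theorem not_split_and_nonsplit (h : IsSetup (Ideal.Quotient.mk _ ϖ) r l q ψ f)
    (V : FDRep ℂ (GL (Fin 2) (Trunc ϖ r))) :
    ¬ (IsPrincipalSplit ϖ l ψ V ∧ IsNonPrincipalSplit ϖ l ψ V) := by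
  rw [h.isPrincipalSplit_iff, h.isNonPrincipalSplit_iff]
  exact h.not_occursType_and (fun _ _ => not_split_and_double) V

theorem not_cuspidal_and_nonsplit (h : IsSetup (Ideal.Quotient.mk _ ϖ) r l q ψ f)
    (V : FDRep ℂ (GL (Fin 2) (Trunc ϖ r))) :
    ¬ (IsCuspidal ϖ l ψ V ∧ IsNonPrincipalSplit ϖ l ψ V) := by
  rw [h.isCuspidal_iff, h.isNonPrincipalSplit_iff]
  exact h.not_occursType_and (fun _ _ h1 => (irredType_iff.1 h1.1).2 h1.2) V

theorem stronglyPrimitive_iff_families (h : IsSetup (Ideal.Quotient.mk _ ϖ) r l q ψ f)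
    (hA : ∀ x : A, IsUnit x ∨ ϖ ∣ x) (V : FDRep ℂ (GL (Fin 2) (Trunc ϖ r))) :
    StronglyPrimitive ϖ r V ↔
      IsPrincipalSplit ϖ l ψ V ∨ IsCuspidal ϖ l ψ V ∨ IsNonPrincipalSplit ϖ l ψ V := by
  rw [h.stronglyPrimitive_iff hA, h.exists_nonscalar_iff, h.isPrincipalSplit_iff,
    h.isCuspidal_iff, h.isNonPrincipalSplit_iff]

theorem numIso_stronglyPrimitive (h : IsSetup (Ideal.Quotient.mk _ ϖ) r l q ψ f)
    (hA : ∀ x : A, IsUnit x ∨ ϖ ∣ x) :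
    (numIso (StronglyPrimitive ϖ r) : ℚ) = (q - 1) * q ^ (2 * r - 1) := by
  have := h.chain.finite_k h.residue
  have hfin : ∀ {P : FDRep ℂ (GL (Fin 2) (Trunc ϖ r)) → Prop} {D : k → k → Prop} {u : ℕ},
      (∀ V, P V ↔ OccursType (Ideal.span {Ideal.Quotient.mk _ ϖ ^ l}) ψ f D V) →
      (∀ Δ s, D Δ s →
        Nat.card {p : k × k // p.1 ^ 2 + s * p.1 * p.2 + Δ * p.2 ^ 2 ≠ 0} = u) →
      ((Quotient.mk (isIsomorphicSetoid (FDRep ℂ (GL (Fin 2) (Trunc ϖ r))))) ''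
        {V | P V}).Finite := fun {P D u} hP hu => by
    have := (h.numIso_occursType hu).2
    rwa [← funext fun V => propext (hP V)] at this
  have hf1 := hfin h.isPrincipalSplit_iff fun Δ s => card_form_split h.card_k (Δ := Δ) (s := s)
  have hf2 := hfin h.isCuspidal_iff fun Δ s => card_form_irred h.card_k (Δ := Δ) (s := s)
  have hf3 := hfin h.isNonPrincipalSplit_iff
    fun Δ s => card_form_double h.card_k (Δ := Δ) (s := s)
  have hc : ∀ V V' : FDRep ℂ (GL (Fin 2) (Trunc ϖ r)), Equivalent V.ρ V'.ρ →
      IsCuspidal ϖ l ψ V → IsCuspidal ϖ l ψ V' := fun V V' e hV => by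
    rw [h.isCuspidal_iff] at hV ⊢
    exact hV.of_equivalent e
  have hn : ∀ V V' : FDRep ℂ (GL (Fin 2) (Trunc ϖ r)), Equivalent V.ρ V'.ρ →
      IsNonPrincipalSplit ϖ l ψ V → IsNonPrincipalSplit ϖ l ψ V' := fun V V' e hV => by
    rw [h.isNonPrincipalSplit_iff] at hV ⊢
    exact hV.of_equivalent e
  have hunion : (Quotient.mk (isIsomorphicSetoid (FDRep ℂ (GL (Fin 2) (Trunc ϖ r))))) ''
      {V | IsCuspidal ϖ l ψ V ∨ IsNonPrincipalSplit ϖ l ψ V} =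
      (Quotient.mk (isIsomorphicSetoid _)) '' {V | IsCuspidal ϖ l ψ V} ∪
      (Quotient.mk (isIsomorphicSetoid _)) '' {V | IsNonPrincipalSplit ϖ l ψ V} := by
    rw [← Set.image_union]
    rfl
  rw [numIso_congr (h.stronglyPrimitive_iff_families hA), numIso_or
    (Q := fun V => IsCuspidal ϖ l ψ V ∨ IsNonPrincipalSplit ϖ l ψ V)
    (fun V V' e => Or.imp (hc V V' e) (hn V V' e))
    (fun V hV => hV.2.elim (fun h2 => h.not_split_and_cuspidal V ⟨hV.1, h2⟩)
      fun h2 => h.not_split_and_nonsplit V ⟨hV.1, h2⟩) hf1 (by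
      rw [hunion]
      exact hf2.union hf3),
    numIso_or hn h.not_cuspidal_and_nonsplit hf2 hf3, Nat.cast_add, Nat.cast_add,
    h.numIso_isPrincipalSplit, h.numIso_isCuspidal, h.numIso_isNonPrincipalSplit]
  have h1 : 2 * r - 1 = 2 * r - 3 + 2 := by
    have := h.two_le
    omega
  have h2 : 2 * r - 2 = 2 * r - 3 + 1 := by
    have := h.two_le
    omega
  rw [h1, h2, pow_succ, pow_succ, pow_succ]
  ring

end Counting

section Principal

theorem isPrincipalSplit_iff_exists (h : IsSetup (Ideal.Quotient.mk _ ϖ) r l q ψ f)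
    (hI : lvl ϖ r l * lvl ϖ r l = ⊥) (V : FDRep ℂ (GL (Fin 2) (Trunc ϖ r))) :
    IsPrincipalSplit ϖ l ψ V ↔
      ∃ μ μ', RegularPair μ μ' ∧ Equivalent V.ρ (principalRep hI μ μ') := by
  constructor
  · rintro ⟨hρ, a, d, had, ho⟩
    have had' : f a ≠ f d := by
      rwa [h.mem_lvl_iff, map_sub, sub_eq_zero] at had
    obtain ⟨μ, μ', ha, hd, e⟩ := h.exists_equivalent_principalRep hI hρ had' ho
    exact ⟨μ, μ', (h.regular_iff ha hd).2 had', e⟩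
  · rintro ⟨μ, μ', hreg, e⟩
    obtain ⟨a, ha⟩ := h.exists_hasShift μ
    obtain ⟨d, hd⟩ := h.exists_hasShift μ'
    have had := (h.regular_iff ha hd).1 hreg
    refine ⟨e.symm.isIrreducible (h.isIrreducible_principalRep hI ha hd had), a, d, ?_,
      (h.occurs_principalRep hI ha hd had).of_equivalent e.symm⟩
    rwa [h.mem_lvl_iff, map_sub, sub_eq_zero]

theorem equivalent_principalRep_iff_of_regular (h : IsSetup (Ideal.Quotient.mk _ ϖ) r l q ψ f)
    (hI : lvl ϖ r l * lvl ϖ r l = ⊥) {μ₁ μ₁' μ₂ μ₂' : (Trunc ϖ r)ˣ →* ℂˣ}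
    (h₁ : RegularPair μ₁ μ₁') (h₂ : RegularPair μ₂ μ₂') :
    Equivalent (principalRep hI μ₁ μ₁') (principalRep hI μ₂ μ₂') ↔
      (μ₁ = μ₂ ∧ μ₁' = μ₂') ∨ (μ₁ = μ₂' ∧ μ₁' = μ₂) := by
  obtain ⟨a₁, ha₁⟩ := h.exists_hasShift μ₁
  obtain ⟨d₁, hd₁⟩ := h.exists_hasShift μ₁'
  obtain ⟨a₂, ha₂⟩ := h.exists_hasShift μ₂
  obtain ⟨d₂, hd₂⟩ := h.exists_hasShift μ₂'
  exact h.equivalent_principalRep_iff hI ha₁ hd₁ ((h.regular_iff ha₁ hd₁).1 h₁) ha₂ hd₂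
    ((h.regular_iff ha₂ hd₂).1 h₂)

end Principal

section NonPrincipal

theorem isNonPrincipalSplit_of_twist (h : IsSetup (Ideal.Quotient.mk _ ϖ) r l q ψ f)
    (χ : (Trunc ϖ r)ˣ →* ℂˣ) {Δ s : Trunc ϖ r} (hΔ : Δ ∈ lvl ϖ r 1) (hs : s ∈ lvl ϖ r 1)
    {θ : unitsAdjoin (companion Δ s) →* ℂˣ}
    (hθ : Agrees (lvl_sq ϖ h.even) ψ (companion Δ s) θ)
    {V : FDRep ℂ (GL (Fin 2) (Trunc ϖ r))} (e : Equivalent V.ρ (xiRep h.even ψ χ Δ s θ hθ)) :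
    IsNonPrincipalSplit ϖ l ψ V :=
  (h.isNonPrincipalSplit_iff V).2
    (h.occurs_double_of_twist (lvl_sq ϖ h.even) χ (mem_lvl_one.1 hΔ) (mem_lvl_one.1 hs) hθ e)

theorem exists_twist_of_hasShift (h : IsSetup (Ideal.Quotient.mk _ ϖ) r l q ψ f)
    {χ : (Trunc ϖ r)ˣ →* ℂˣ} {a Δ s : Trunc ϖ r} (hχ : HasShift (Ideal.Quotient.mk _ ϖ) l ψ χ a)
    {V : FDRep ℂ (GL (Fin 2) (Trunc ϖ r))} (hV : Representation.IsIrreducible V.ρ)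
    (ho : Occurs (Ideal.span {Ideal.Quotient.mk _ ϖ ^ l}) ψ (companion Δ s) V.ρ)
    {Δ' s' : Trunc ϖ r} (hΔ : Δ' - (Δ - a * s + a ^ 2) ∈ lvl ϖ r l)
    (hs : s' - (s - 2 * a) ∈ lvl ϖ r l) :
    ∃ θ hθ, Equivalent V.ρ (xiRep h.even ψ χ Δ' s' θ hθ) :=
  h.exists_equivalent_twist (lvl_sq ϖ h.even) hV hχ ho (Ideal.mem_span_singleton.1 hΔ)
    (Ideal.mem_span_singleton.1 hs)

theorem hasShift_of_twistFamily (h : IsSetup (Ideal.Quotient.mk _ ϖ) r l q ψ f)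
    {χ : Trunc ϖ r ⧸ lvl ϖ r l → ((Trunc ϖ r)ˣ →* ℂˣ)} (hχ : IsTwistFamily ψ l χ)
    (a : Trunc ϖ r) :
    HasShift (Ideal.Quotient.mk _ ϖ) l ψ (χ (Ideal.Quotient.mk _ a)) a := fun x u hu => by
  have := hχ a x u
  rw [h.sub_eq] at this
  exact this hu

/-- A character in a twist family of depth `1` is determined on `1 + π^l R` by an element of `R`
with prescribed reduction. -/
theorem exists_hasShift_of_twistFamily (h : IsSetup (Ideal.Quotient.mk _ ϖ) r l q ψ f)
    {χ : Trunc ϖ r ⧸ lvl ϖ r 1 → ((Trunc ϖ r)ˣ →* ℂˣ)} (hχ : IsTwistFamily ψ 1 χ)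
    (a : Trunc ϖ r) :
    ∃ a', f a' = f a ∧
      HasShift (Ideal.Quotient.mk _ ϖ) l ψ (χ (Ideal.Quotient.mk _ a)) a' := by
  obtain ⟨a', ha'⟩ := h.exists_hasShift (χ (Ideal.Quotient.mk _ a))
  refine ⟨a', h.map_eq (h.dvd_of_psi fun x => ?_), ha'⟩
  set π := Ideal.Quotient.mk (Ideal.span {ϖ ^ r}) ϖ with hπ
  let u := unitOneAdd h.sq_eq (π ^ (l - 1) * x)
  have h1 := ha' (π ^ (l - 1) * x) u rfl
  rw [hχ a x u (by rw [coe_unitOneAdd, h.pow_pred, mul_assoc])] at h1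
  have h2 : π ^ (r - 1) * ((a' - a) * x) =
      π ^ l * (a' * (π ^ (l - 1) * x)) - π ^ (r - 1) * (a * x) := by
    rw [h.pow_pred]; ring
  rw [h2, sub_eq_add_neg, AddChar.map_add_eq_mul, ← h1, ← AddChar.map_add_eq_mul, add_neg_cancel,
    AddChar.map_zero_eq_one]

theorem exists_twist_of_isNonPrincipalSplit (h : IsSetup (Ideal.Quotient.mk _ ϖ) r l q ψ f)
    {χ : Trunc ϖ r ⧸ lvl ϖ r 1 → ((Trunc ϖ r)ˣ →* ℂˣ)} (hχ : IsTwistFamily ψ 1 χ)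
    {V : FDRep ℂ (GL (Fin 2) (Trunc ϖ r))} (hV : IsNonPrincipalSplit ϖ l ψ V) :
    ∃ a, ∃ Δ ∈ lvl ϖ r 1, ∃ s ∈ lvl ϖ r 1,
      ∀ Δ' s', Δ' - Δ ∈ lvl ϖ r l → s' - s ∈ lvl ϖ r l →
        ∃ θ hθ, Equivalent V.ρ (xiRep h.even ψ (χ a) Δ' s' θ hθ) := by
  obtain ⟨hρ, Δ, s, ⟨x, hΔ, hs⟩, ho⟩ := (h.isNonPrincipalSplit_iff V).1 hV
  obtain ⟨a, rfl⟩ := h.residue.surjective x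
  obtain ⟨a', ha', hsh⟩ := h.exists_hasShift_of_twistFamily hχ a
  rw [← ha'] at hΔ hs
  obtain ⟨h1, h2⟩ := h.dvd_of_doubleType hΔ hs
  exact ⟨_, _, mem_lvl_one.2 h1, _, mem_lvl_one.2 h2, fun Δ' s' h3 h4 =>
    h.exists_twist_of_hasShift hsh hρ ho h3 h4⟩

/-- If `2` is a unit, the trace can be removed by a twist. -/
theorem exists_twist_of_isUnit_two (h : IsSetup (Ideal.Quotient.mk _ ϖ) r l q ψ f)
    (h2 : IsUnit (2 : Trunc ϖ r))
    {χ : Trunc ϖ r ⧸ lvl ϖ r l → ((Trunc ϖ r)ˣ →* ℂˣ)} (hχ : IsTwistFamily ψ l χ)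
    {V : FDRep ℂ (GL (Fin 2) (Trunc ϖ r))} (hV : IsNonPrincipalSplit ϖ l ψ V) :
    ∃ a, ∃ Δ ∈ lvl ϖ r 1, ∀ Δ', Δ' - Δ ∈ lvl ϖ r l →
      ∃ θ hθ, Equivalent V.ρ (xiRep h.even ψ (χ a) Δ' 0 θ hθ) := by
  obtain ⟨hρ, Δ, s, ⟨x, hΔ, hs⟩, ho⟩ := (h.isNonPrincipalSplit_iff V).1 hV
  obtain ⟨a, rfl⟩ := h2.dvd (a := s)
  have hx : x = f a := by
    have h3 := h2.map f
    rw [map_mul] at hs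
    rw [map_ofNat] at h3 hs
    refine h3.mul_left_cancel ?_
    linear_combination -hs
  subst hx
  obtain ⟨h3, -⟩ := h.dvd_of_doubleType hΔ hs
  exact ⟨_, _, mem_lvl_one.2 h3, fun Δ' h4 =>
    h.exists_twist_of_hasShift (h.hasShift_of_twistFamily hχ a) hρ ho h4 (by simp)⟩

end NonPrincipal

section Cuspidal

variable {B : Type*} [CommRing B] [Algebra A B] {σ : B ≃ₐ[A] B}

theorem isUnit_iff_notMem (h : IsSetup (Ideal.Quotient.mk _ ϖ) r l q ψ f)
    (e : IsQuadExt (Ideal.Quotient.mk (Ideal.span {ϖ ^ r}) ϖ) (truncMap B ϖ r) (truncAut ϖ r σ))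
    (z : Trunc (algebraMap A B ϖ) r) : IsUnit z ↔ z ∉ lvl (algebraMap A B ϖ) r 1 := by
  rw [mem_lvl_one]
  exact ⟨e.not_dvd_isUnit h.chain, (e.isUnit_or z).resolve_right⟩

variable {ν ν' : (Trunc (algebraMap A B ϖ) r)ˣ →* ℂˣ}

theorem regularPairE_iff (h : IsSetup (Ideal.Quotient.mk _ ϖ) r l q ψ f)
    (e : IsQuadExt (Ideal.Quotient.mk (Ideal.span {ϖ ^ r}) ϖ) (truncMap B ϖ r) (truncAut ϖ r σ))
    {τ : Trunc (algebraMap A B ϖ) r}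
    (hs : HasShiftE (Ideal.Quotient.mk _ ϖ) l ψ (truncMap B ϖ r) (truncAut ϖ r σ)
      (normChar (truncAut ϖ r σ) ν ν') τ) :
    RegularPairE ϖ σ ν ν' ↔ IsUnit (τ - truncAut ϖ r σ τ) :=
  h.regularE_iff e hs

theorem isCuspidal_iff_exists (h : IsSetup (Ideal.Quotient.mk _ ϖ) r l q ψ f)
    (e : IsQuadExt (Ideal.Quotient.mk (Ideal.span {ϖ ^ r}) ϖ) (truncMap B ϖ r) (truncAut ϖ r σ))
    (V : FDRep ℂ (GL (Fin 2) (Trunc ϖ r))) :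
    IsCuspidal ϖ l ψ V ↔
      ∃ ν ν', RegularPairE ϖ σ ν ν' ∧ IsCuspidalRep h.even ψ σ ν ν' V.ρ := by
  rw [h.isCuspidal_iff]
  constructor
  · rintro ⟨hρ, Δ, s, hirr, ho⟩
    obtain ⟨ν, ν', τ, ht, hn, hτ, hθ, he⟩ :=
      h.exists_equivalent_quadChar e (lvl_sq ϖ h.even) hρ hirr ho
    refine ⟨ν, ν', (h.regularPairE_iff e
      ((h.agrees_quadChar_iff e (lvl_sq ϖ h.even) ht hn hτ).1 hθ)).2 hτ,
      ⟨τ, s, Δ, ht, hn, (h.isUnit_iff_notMem e _).1 hτ⟩, hθ, he⟩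
  · rintro ⟨ν, ν', -, x, hx, he⟩
    exact ⟨he.symm.isIrreducible
      (h.chain.isIrreducible_piRep h.psi h.even h.pos (lvl_sq ϖ h.even) hx), x.n, x.t,
      e.irredType h.chain h.residue x.trace_eq x.norm_eq ((h.isUnit_iff_notMem e _).2 x.elliptic),
      (IsChain.occurs_piRep (lvl_sq ϖ h.even) hx).of_equivalent he.symm⟩

theorem exists_isCuspidalRep (h : IsSetup (Ideal.Quotient.mk _ ϖ) r l q ψ f)
    (e : IsQuadExt (Ideal.Quotient.mk (Ideal.span {ϖ ^ r}) ϖ) (truncMap B ϖ r) (truncAut ϖ r σ))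
    (hreg : RegularPairE ϖ σ ν ν') :
    ∃ V : FDRep ℂ (GL (Fin 2) (Trunc ϖ r)), IsCuspidalRep h.even ψ σ ν ν' V.ρ := by
  have := h.chain.finite
  obtain ⟨τ, hs⟩ := h.exists_hasShiftE e (normChar (truncAut ϖ r σ) ν ν')
  have hτ := (h.regularPairE_iff e hs).1 hreg
  obtain ⟨t, ht⟩ := e.exists_trace τ
  obtain ⟨n, hn⟩ := e.exists_norm τ
  have hθ := (h.agrees_quadChar_iff e (lvl_sq ϖ h.even) ht hn hτ).2 hs
  obtain ⟨V, hV⟩ := exists_fdRep (piRep (lvl_sq ϖ h.even) ψ (companion n t) _ hθ)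
  exact ⟨V, ⟨τ, t, n, ht, hn, (h.isUnit_iff_notMem e _).1 hτ⟩, hθ, hV⟩

theorem equivalent_of_isCuspidalRep (h : IsSetup (Ideal.Quotient.mk _ ϖ) r l q ψ f)
    (e : IsQuadExt (Ideal.Quotient.mk (Ideal.span {ϖ ^ r}) ϖ) (truncMap B ϖ r) (truncAut ϖ r σ))
    {V W : Type*} [AddCommGroup V] [Module ℂ V] [AddCommGroup W] [Module ℂ W]
    {ρ : Representation ℂ (GL (Fin 2) (Trunc ϖ r)) V}
    {ρ' : Representation ℂ (GL (Fin 2) (Trunc ϖ r)) W}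
    (hV : IsCuspidalRep h.even ψ σ ν ν' ρ) (hW : IsCuspidalRep h.even ψ σ ν ν' ρ') :
    Equivalent ρ ρ' := by
  obtain ⟨x, hx, he⟩ := hV
  obtain ⟨y, hy, he'⟩ := hW
  exact (he.trans (h.equivalent_of_hasShiftE e (lvl_sq ϖ h.even) x.trace_eq x.norm_eq y.trace_eq
    y.norm_eq ((h.isUnit_iff_notMem e _).2 x.elliptic) ((h.isUnit_iff_notMem e _).2 y.elliptic)
    hx hy)).trans he'.symm

/-- The representation `𝒞_{ν,ν'}` depends only on the character `z ↦ ν(z) ν'(σ(z))`. -/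
theorem isCuspidalRep_swap (h : IsSetup (Ideal.Quotient.mk _ ϖ) r l q ψ f)
    (e : IsQuadExt (Ideal.Quotient.mk (Ideal.span {ϖ ^ r}) ϖ) (truncMap B ϖ r) (truncAut ϖ r σ))
    {V : Type*} [AddCommGroup V] [Module ℂ V]
    {ρ : Representation ℂ (GL (Fin 2) (Trunc ϖ r)) V}
    (hV : IsCuspidalRep h.even ψ σ ν ν' ρ) :
    IsCuspidalRep h.even ψ σ (ν'.comp (Units.map (truncAut ϖ r σ)))
      (ν.comp (Units.map (truncAut ϖ r σ))) ρ := by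
  obtain ⟨x, hx, he⟩ := hV
  have key : ∀ θ, θ = x.θ ν ν' → ∃ hθ : Agrees (lvl_sq ϖ h.even) ψ x.β θ,
      Equivalent ρ (piRep (lvl_sq ϖ h.even) ψ x.β θ hθ) := by
    rintro _ rfl
    exact ⟨hx, he⟩
  refine ⟨x, key _ ?_⟩
  ext g : 1
  let z := quadHom (truncMap B ϖ r) (truncAut ϖ r σ) x.trace_eq x.norm_eq g
  let s : Trunc (algebraMap A B ϖ) r →* Trunc (algebraMap A B ϖ) r := truncAut ϖ r σ
  have hz : Units.map s (Units.map s z) = z :=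
    Units.ext (e.involutive z)
  change ν' (Units.map s z) *
    ν (Units.map s (Units.map s z)) =
    ν z * ν' (Units.map s z)
  rw [hz, mul_comm]

end Cuspidal

end IsSetup

end Families

universe u

/-- The hypotheses on `F`, `r` and `ψ` in abstract form. -/
theorem exists_isSetup {F : Type u} [Field F] [ValuativeRel F] [TopologicalSpace F]
    [IsNonarchimedeanLocalField F] {ϖ : 𝒪[F]} (hϖ : Irreducible ϖ) {q : ℕ} (hq : q = Nat.card 𝓀[F])
    {r l : ℕ} (hl : 0 < l) (hr : r = 2 * l) (ψ : AddChar (Trunc ϖ r) ℂ)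
    (hψ : ∃ x ∈ lvl ϖ r (r - 1), ψ x ≠ 1) :
    ∃ (k : Type u) (_ : Field k) (f : Trunc ϖ r →+* k),
      IsSetup (Ideal.Quotient.mk _ ϖ) r l q ψ f := by
  have hfin : Finite 𝓀[F] := inferInstance
  have hcard : Nat.card (𝒪[F] ⧸ Ideal.span {ϖ}) = q := by rw [hq, ← hϖ.maximalIdeal_eq]; rfl
  have : Finite (𝒪[F] ⧸ Ideal.span {ϖ}) := by rw [← hϖ.maximalIdeal_eq]; exact hfin
  have hch : IsChain (Trunc ϖ r) (Ideal.Quotient.mk (Ideal.span {ϖ ^ r}) ϖ) r q :=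
    isChain_trunc (isUnit_or_dvd hϖ) hϖ.ne_zero hϖ.not_isUnit hcard (by omega)
  have := hch.isMaximal
  let fld : Field (Trunc ϖ r ⧸ Ideal.span {Ideal.Quotient.mk (Ideal.span {ϖ ^ r}) ϖ}) :=
    Ideal.Quotient.field _
  refine ⟨_, fld, Ideal.Quotient.mk _, hch, hψ, hr, hl, Ideal.Quotient.mk_surjective, fun x => ?_⟩
  rw [← Ideal.mem_span_singleton]
  exact Ideal.Quotient.eq_zero_iff_mem

theorem isUnit_two {F : Type*} [Field F] [ValuativeRel F] [TopologicalSpace F]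
    [IsNonarchimedeanLocalField F] {ϖ : 𝒪[F]} (hϖ : Irreducible ϖ) (h : ringChar 𝓀[F] ≠ 2) :
    IsUnit (2 : 𝒪[F]) := by
  refine (isUnit_or_dvd hϖ 2).resolve_right fun h2 => h ?_
  have h4 : IsLocalRing.residue 𝒪[F] 2 = 0 := by
    rw [IsLocalRing.residue_eq_zero_iff, hϖ.maximalIdeal_eq]
    exact Ideal.mem_span_singleton.2 h2
  rw [map_ofNat] at h4
  have := CharTwo.of_one_ne_zero_of_two_eq_zero (R := 𝓀[F]) one_ne_zero h4
  exact ringChar.eq 𝓀[F] 2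

end GL2Rep

end

theorem mainTheorem10
    {F : Type*} [Field F] [ValuativeRel F] [TopologicalSpace F] [IsNonarchimedeanLocalField F]
    (ϖ : 𝒪[F]) (hϖ : Irreducible ϖ)
    -- `E / F` is the unramified quadratic extension, with non-trivial automorphism `σ`
    {E : Type*} [Field E] [Algebra F E] (hE : Module.finrank F E = 2)
    (hunr : (Ideal.span {algebraMap 𝒪[F] (integralClosure 𝒪[F] E) ϖ}).IsMaximal)
    (σ : E ≃ₐ[F] E) (hσ : σ ≠ AlgEquiv.refl)
    (q : ℕ) (hq : q = Nat.card 𝓀[F])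
    -- the level `r = 2 l` is even
    (r l : ℕ) (hl : 0 < l) (hr : r = 2 * l)
    -- `ψ` is an additive character of level `r`
    (ψ : AddChar (GL2Rep.Trunc ϖ r) ℂ)
    (hψ : ∃ x ∈ GL2Rep.lvl ϖ r (r - 1), ψ x ≠ 1) :
    let σO : integralClosure 𝒪[F] E ≃ₐ[𝒪[F]] integralClosure 𝒪[F] E :=
      (σ.restrictScalars 𝒪[F]).mapIntegralClosure
    let hI := GL2Rep.lvl_sq ϖ hr
    -- the three families are disjoint, and together they are the strongly primitive irreducibles
    (∀ V : FDRep ℂ (GL (Fin 2) (GL2Rep.Trunc ϖ r)),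
      (GL2Rep.StronglyPrimitive ϖ r V ↔
        GL2Rep.IsPrincipalSplit ϖ l ψ V ∨ GL2Rep.IsCuspidal ϖ l ψ V ∨
          GL2Rep.IsNonPrincipalSplit ϖ l ψ V) ∧
      ¬ (GL2Rep.IsPrincipalSplit ϖ l ψ V ∧ GL2Rep.IsCuspidal ϖ l ψ V) ∧
      ¬ (GL2Rep.IsPrincipalSplit ϖ l ψ V ∧ GL2Rep.IsNonPrincipalSplit ϖ l ψ V) ∧
      ¬ (GL2Rep.IsCuspidal ϖ l ψ V ∧ GL2Rep.IsNonPrincipalSplit ϖ l ψ V)) ∧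
    (GL2Rep.numIso (GL2Rep.StronglyPrimitive ϖ r) : ℚ) = (q - 1) * q ^ (2 * r - 1) ∧
    -- principal split representations
    (∀ V, GL2Rep.IsPrincipalSplit ϖ l ψ V ↔
      ∃ μ μ', GL2Rep.RegularPair μ μ' ∧ GL2Rep.Equivalent V.ρ (GL2Rep.principalRep hI μ μ')) ∧
    (∀ μ₁ μ₁' μ₂ μ₂', GL2Rep.RegularPair μ₁ μ₁' → GL2Rep.RegularPair μ₂ μ₂' →
      (GL2Rep.Equivalent (GL2Rep.principalRep hI μ₁ μ₁') (GL2Rep.principalRep hI μ₂ μ₂') ↔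
        (μ₁ = μ₂ ∧ μ₁' = μ₂') ∨ (μ₁ = μ₂' ∧ μ₁' = μ₂))) ∧
    (∀ V, GL2Rep.IsPrincipalSplit ϖ l ψ V → Module.finrank ℂ V = (q + 1) * q ^ (r - 1)) ∧
    (GL2Rep.numIso (GL2Rep.IsPrincipalSplit ϖ l ψ) : ℚ) =
      1 / 2 * (q - 1) ^ 3 * q ^ (2 * r - 3) ∧
    -- cuspidal representations
    (∀ V, GL2Rep.IsCuspidal ϖ l ψ V ↔
      ∃ ν ν', GL2Rep.RegularPairE ϖ σO ν ν' ∧ GL2Rep.IsCuspidalRep hr ψ σO ν ν' V.ρ) ∧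
    -- `𝒞_{ν,ν'}` exists, and is unique up to isomorphism
    (∀ ν ν', GL2Rep.RegularPairE ϖ σO ν ν' →
      (∃ V : FDRep ℂ (GL (Fin 2) (GL2Rep.Trunc ϖ r)),
        GL2Rep.IsCuspidalRep hr ψ σO ν ν' V.ρ) ∧
      (∀ V V' : FDRep ℂ (GL (Fin 2) (GL2Rep.Trunc ϖ r)),
        GL2Rep.IsCuspidalRep hr ψ σO ν ν' V.ρ → GL2Rep.IsCuspidalRep hr ψ σO ν ν' V'.ρ →
          Nonempty (V ≅ V')) ∧
      -- `𝒞_{ν,ν'} ≅ 𝒞_{ν'∘σ,ν∘σ}`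
      (∀ V : FDRep ℂ (GL (Fin 2) (GL2Rep.Trunc ϖ r)),
        GL2Rep.IsCuspidalRep hr ψ σO ν ν' V.ρ →
          GL2Rep.IsCuspidalRep hr ψ σO
            (ν'.comp (Units.map (GL2Rep.truncAut ϖ r σO)))
            (ν.comp (Units.map (GL2Rep.truncAut ϖ r σO))) V.ρ)) ∧
    (∀ V, GL2Rep.IsCuspidal ϖ l ψ V → Module.finrank ℂ V = (q - 1) * q ^ (r - 1)) ∧
    (GL2Rep.numIso (GL2Rep.IsCuspidal ϖ l ψ) : ℚ) =
      1 / 2 * (q - 1) * (q ^ 2 - 1) * q ^ (2 * r - 3) ∧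
    -- non-principal split representations: description in any residual characteristic
    (∀ χ, GL2Rep.IsTwistFamily ψ 1 χ →
      (∀ a, ∀ Δ ∈ GL2Rep.lvl ϖ r 1, ∀ s ∈ GL2Rep.lvl ϖ r 1, ∀ θ hθ,
        ∀ V : FDRep ℂ (GL (Fin 2) (GL2Rep.Trunc ϖ r)),
          GL2Rep.Equivalent V.ρ (GL2Rep.xiRep hr ψ (χ a) Δ s θ hθ) →
            GL2Rep.IsNonPrincipalSplit ϖ l ψ V) ∧
      (∀ V, GL2Rep.IsNonPrincipalSplit ϖ l ψ V →
        ∃ a, ∃ Δ ∈ GL2Rep.lvl ϖ r 1, ∃ s ∈ GL2Rep.lvl ϖ r 1,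
          ∀ Δ' s', Δ' - Δ ∈ GL2Rep.lvl ϖ r l → s' - s ∈ GL2Rep.lvl ϖ r l →
            ∃ θ hθ, GL2Rep.Equivalent V.ρ (GL2Rep.xiRep hr ψ (χ a) Δ' s' θ hθ))) ∧
    -- the representations `Ξ_{a,Δ,θ}` in odd residual characteristic
    (ringChar 𝓀[F] ≠ 2 → ∀ χ, GL2Rep.IsTwistFamily ψ l χ →
      (∀ a, ∀ Δ ∈ GL2Rep.lvl ϖ r 1, ∀ θ hθ,
        ∀ V : FDRep ℂ (GL (Fin 2) (GL2Rep.Trunc ϖ r)),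
          GL2Rep.Equivalent V.ρ (GL2Rep.xiRep hr ψ (χ a) Δ 0 θ hθ) →
            GL2Rep.IsNonPrincipalSplit ϖ l ψ V) ∧
      (∀ V, GL2Rep.IsNonPrincipalSplit ϖ l ψ V →
        ∃ a, ∃ Δ ∈ GL2Rep.lvl ϖ r 1, ∀ Δ', Δ' - Δ ∈ GL2Rep.lvl ϖ r l →
          ∃ θ hθ, GL2Rep.Equivalent V.ρ (GL2Rep.xiRep hr ψ (χ a) Δ' 0 θ hθ))) ∧
    (∀ V, GL2Rep.IsNonPrincipalSplit ϖ l ψ V →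
      Module.finrank ℂ V = (q ^ 2 - 1) * q ^ (r - 2)) ∧
    (GL2Rep.numIso (GL2Rep.IsNonPrincipalSplit ϖ l ψ) : ℚ) = (q - 1) * q ^ (2 * r - 2) := by
  intro σO hI
  obtain ⟨k, _, f, h⟩ := GL2Rep.exists_isSetup hϖ hq hl hr ψ hψ
  have hA := GL2Rep.isUnit_or_dvd hϖ
  have e : GL2Rep.IsQuadExt (Ideal.Quotient.mk (Ideal.span {ϖ ^ r}) ϖ)
      (GL2Rep.truncMap (integralClosure 𝒪[F] E) ϖ r) (GL2Rep.truncAut ϖ r σO) :=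
    (GL2Rep.isUnramifiedQuad hϖ hE hunr σ hσ).isQuadExt r
  refine ⟨fun V => ⟨h.stronglyPrimitive_iff_families hA V, h.not_split_and_cuspidal V,
      h.not_split_and_nonsplit V, h.not_cuspidal_and_nonsplit V⟩,
    h.numIso_stronglyPrimitive hA,
    h.isPrincipalSplit_iff_exists hI,
    fun _ _ _ _ h₁ h₂ => h.equivalent_principalRep_iff_of_regular hI h₁ h₂,
    fun _ => h.finrank_isPrincipalSplit, h.numIso_isPrincipalSplit,
    h.isCuspidal_iff_exists e,
    fun ν ν' hreg => ⟨h.exists_isCuspidalRep e hreg,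
      fun V V' hV hV' => GL2Rep.nonempty_iso_iff.2 (h.equivalent_of_isCuspidalRep e hV hV'),
      fun V hV => h.isCuspidalRep_swap e hV⟩,
    fun _ => h.finrank_isCuspidal, h.numIso_isCuspidal,
    fun χ hχ => ⟨fun a Δ hΔ s hs θ hθ V e' => h.isNonPrincipalSplit_of_twist (χ a) hΔ hs hθ e',
      fun V hV => h.exists_twist_of_isNonPrincipalSplit hχ hV⟩,
    fun hp χ hχ => ⟨fun a Δ hΔ θ hθ V e' =>
        h.isNonPrincipalSplit_of_twist (χ a) hΔ (Ideal.zero_mem _) hθ e',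
      fun V hV => h.exists_twist_of_isUnit_two ?_ hχ hV⟩,
    fun _ => h.finrank_isNonPrincipalSplit, h.numIso_isNonPrincipalSplit⟩
  have h2 := (GL2Rep.isUnit_two hϖ hp).map (Ideal.Quotient.mk (Ideal.span {ϖ ^ r}))
  rwa [map_ofNat] at h2
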